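/- Let $(N^{m+1},h)$ be a smooth Riemannian manifold of dimension $m+1$ with constant sectional curvature $c\in\mathbb R$, let $(M^m,g)$ be a connected smooth Riemannian manifold of dimension $m$, and let $\varphi:(M,g)\to(N,h)$ be a smooth isometric immersion (a hypersurface). Denote by $B=\nabla d\varphi$ its second fundamental form, by $\tau(\varphi)=\operatorname{trace}_g\nabla d\varphi$ its tension field, by $H=\frac1m\operatorname{trace}_g B=\frac1m\tau(\varphi)$ its mean curvature vector field, and by $$\tau_2(\varphi)=-\Delta\tau(\varphi)-\operatorname{trace}_g R^N(d\varphi\,\cdot,\tau(\varphi))\,d\varphi\,\cdot$$ its bitension field, where $\Delta=-\operatorname{trace}_g\nabla^2$ is the rough Laplacian on sections of $\varphi^{-1}TN$ and $R^N(X,Y)Z=\nabla_X\nabla_YZ-\nabla_Y\nabla_XZ-\nabla_{[X,Y]}Z$. Suppose that (i) at every point $p\in M$ the hypersurface has at most two distinct principal curvatures, i.e. for every unit normal vector $\eta$ at $p$ the Weingarten operator $A$ of $T_pM$, defined by $\langle AX,Y\rangle=\langle B(X,Y),\eta\rangle$, has at most two distinct eigenvalues; (ii) $\varphi$ is proper biharmonic,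 i.e. $\tau_2(\varphi)=0$ on $M$ and $\tau(\varphi)$ does not vanish identically. Then $M$ has constant mean curvature: the function $|H|$ is constant on $M$. -/

import Mathlib

open scoped Manifold ContDiff

noncomputable section

/-! ## Tensor calculus in local coordinates

All objects of this section live on (open parts of) coordinate spaces `ℝⁿ`. A metric is given by
its matrix of components, a map by its coordinate expression and a vector field along a map by its
components. -/

/-- The coordinate space `ℝⁿ`. -/
abbrev Coord (n : ℕ) := EuclideanSpace ℝ (Fin n)

namespace Coord

variable {m n : ℕ}

/-- The partial derivative `∂ᵢ f`. -/
def pd (i : Fin n) (f : Coord n → ℝ) (x : Coord n) : ℝ :=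
  fderiv ℝ f x (EuclideanSpace.single i 1)

/-- The Christoffel symbol `Γᵏᵢⱼ` of the Levi-Civita connection of the metric `g`:
`Γᵏᵢⱼ = ½ ∑ₗ gᵏˡ (∂ᵢ gⱼₗ + ∂ⱼ gᵢₗ - ∂ₗ gᵢⱼ)`. -/
def christoffel (g : Coord n → Matrix (Fin n) (Fin n) ℝ) (k i j : Fin n) (x : Coord n) : ℝ :=
  (1 / 2) * ∑ l, (g x)⁻¹ k l *
    (pd i (fun y => g y j l) x + pd j (fun y => g y i l) x - pd l (fun y => g y i j) x)

/-- The component `Rˡₖᵢⱼ` of the curvature tensor of the metric `g`, that is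
`R(∂ᵢ, ∂ⱼ) ∂ₖ = ∑ₗ Rˡₖᵢⱼ ∂ₗ` with the sign convention
`R(X, Y) Z = ∇_X ∇_Y Z - ∇_Y ∇_X Z - ∇_[X,Y] Z`. -/
def riemann (g : Coord n → Matrix (Fin n) (Fin n) ℝ) (l k i j : Fin n) (x : Coord n) : ℝ :=
  pd i (christoffel g l j k) x - pd j (christoffel g l i k) x
    + ∑ p, (christoffel g l i p x * christoffel g p j k x
        - christoffel g l j p x * christoffel g p i k x)

/-- The components of the vector `R(X, Y) Z` at the point `x`. -/
def riemannVec (g : Coord n → Matrix (Fin n) (Fin n) ℝ) (x : Coord n) (X Y Z : Fin n → ℝ) :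
    Fin n → ℝ :=
  fun l => ∑ i, ∑ j, ∑ k, riemann g l k i j x * X i * Y j * Z k

/-- The scalar product `⟨X, Y⟩` of two vectors with respect to the matrix `G` of a metric. -/
def dot (G : Matrix (Fin n) (Fin n) ℝ) (X Y : Fin n → ℝ) : ℝ :=
  ∑ i, ∑ j, G i j * X i * Y j

/-- The components of `dΦ(∂ᵢ)`. -/
def dmap (Φ : Coord m → Coord n) (i : Fin m) (x : Coord m) : Fin n → ℝ :=
  fun a => pd i (fun y => Φ y a) x

/-- The covariant derivative `∇_{∂ᵢ} V` of a vector field `V` along the map `Φ` into a space with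
metric `h` (the connection pulled back from the Levi-Civita connection of `h`). -/
def covAlong (h : Coord n → Matrix (Fin n) (Fin n) ℝ) (Φ : Coord m → Coord n)
    (V : Coord m → Fin n → ℝ) (i : Fin m) (x : Coord m) : Fin n → ℝ :=
  fun a => pd i (fun y => V y a) x
    + ∑ b, ∑ c, christoffel h a b c (Φ x) * dmap Φ i x b * V x c

/-- The component `(∇dΦ)(∂ᵢ, ∂ⱼ) = ∇_{∂ᵢ} (dΦ(∂ⱼ)) - dΦ(∇_{∂ᵢ} ∂ⱼ)` of the second fundamental form
of the map `Φ` from a space with metric `g` to a space with metric `h`. When `Φ` is an isometric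
immersion, this is the second fundamental form `B(∂ᵢ, ∂ⱼ)` of the submanifold. -/
def secondFundForm (g : Coord m → Matrix (Fin m) (Fin m) ℝ)
    (h : Coord n → Matrix (Fin n) (Fin n) ℝ) (Φ : Coord m → Coord n) (i j : Fin m)
    (x : Coord m) : Fin n → ℝ :=
  fun a => covAlong h Φ (dmap Φ j) i x a - ∑ k, christoffel g k i j x * dmap Φ k x a

/-- The tension field `τ(Φ) = trace ∇dΦ`. -/
def tension (g : Coord m → Matrix (Fin m) (Fin m) ℝ)
    (h : Coord n → Matrix (Fin n) (Fin n) ℝ) (Φ : Coord m → Coord n)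
    (x : Coord m) : Fin n → ℝ :=
  fun a => ∑ i, ∑ j, (g x)⁻¹ i j * secondFundForm g h Φ i j x a

/-- The rough Laplacian `Δ V = - trace ∇² V` on vector fields along `Φ`, where
`∇² V (∂ᵢ, ∂ⱼ) = ∇_{∂ᵢ} ∇_{∂ⱼ} V - ∇_{∇_{∂ᵢ} ∂ⱼ} V`. -/
def roughLaplacian (g : Coord m → Matrix (Fin m) (Fin m) ℝ)
    (h : Coord n → Matrix (Fin n) (Fin n) ℝ) (Φ : Coord m → Coord n)
    (V : Coord m → Fin n → ℝ) (x : Coord m) : Fin n → ℝ :=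
  fun a => - ∑ i, ∑ j, (g x)⁻¹ i j *
    (covAlong h Φ (covAlong h Φ V j) i x a - ∑ k, christoffel g k i j x * covAlong h Φ V k x a)

/-- The bitension field `τ₂(Φ) = - Δ τ(Φ) - trace R(dΦ ·, τ(Φ)) dΦ ·`. -/
def bitension (g : Coord m → Matrix (Fin m) (Fin m) ℝ)
    (h : Coord n → Matrix (Fin n) (Fin n) ℝ) (Φ : Coord m → Coord n)
    (x : Coord m) : Fin n → ℝ :=
  fun a => - roughLaplacian g h Φ (tension g h Φ) x a
    - ∑ i, ∑ j, (g x)⁻¹ i j *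
        riemannVec h (Φ x) (dmap Φ i x) (tension g h Φ x) (dmap Φ j x) a

/-- The length `|H|` of the mean curvature vector field `H = (1/m) trace B` of an isometric
immersion `Φ`. -/
def meanCurvature (g : Coord m → Matrix (Fin m) (Fin m) ℝ)
    (h : Coord n → Matrix (Fin n) (Fin n) ℝ) (Φ : Coord m → Coord n) (x : Coord m) : ℝ :=
  let H : Fin n → ℝ :=
    fun a => (1 / (m : ℝ)) * ∑ i, ∑ j, (g x)⁻¹ i j * secondFundForm g h Φ i j x a
  √(dot (h (Φ x)) H H)

/-- `η` is a unit normal vector of `Φ` at `x`. -/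
def IsUnitNormal (h : Coord n → Matrix (Fin n) (Fin n) ℝ) (Φ : Coord m → Coord n)
    (x : Coord m) (η : Fin n → ℝ) : Prop :=
  (∀ i, dot (h (Φ x)) η (dmap Φ i x) = 0) ∧ dot (h (Φ x)) η η = 1

/-- `k` is a principal curvature at `x` with respect to the unit normal vector `η`, that is, an
eigenvalue of the Weingarten operator `A`, `⟨A X, Y⟩ = ⟨B(X, Y), η⟩`: there is `X ≠ 0` with
`⟨B(X, ∂ⱼ), η⟩ = k ⟨X, ∂ⱼ⟩` for all `j`. -/
def IsPrincipalCurvature (g : Coord m → Matrix (Fin m) (Fin m) ℝ)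
    (h : Coord n → Matrix (Fin n) (Fin n) ℝ) (Φ : Coord m → Coord n)
    (x : Coord m) (η : Fin n → ℝ) (k : ℝ) : Prop :=
  ∃ X : Fin m → ℝ, X ≠ 0 ∧ ∀ j,
    ∑ i, X i * dot (h (Φ x)) (secondFundForm g h Φ i j x) η = k * ∑ i, X i * g x i j

end Coord

/-! ## Riemannian manifolds and isometric immersions -/

section Manifolds

variable {m n : ℕ}
  {M : Type*} [TopologicalSpace M] [ChartedSpace (Coord m) M] [IsManifold 𝓘(ℝ, Coord m) ∞ M]
  {N : Type*} [TopologicalSpace N] [ChartedSpace (Coord n) N] [IsManifold 𝓘(ℝ, Coord n) ∞ N]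

/-- Smooth Riemannian metrics on an `n`-dimensional smooth manifold `N` (without boundary). -/
abbrev SmoothMetric (n : ℕ) (N : Type*) [TopologicalSpace N] [ChartedSpace (Coord n) N]
    [IsManifold 𝓘(ℝ, Coord n) ∞ N] :=
  Bundle.ContMDiffRiemannianMetric 𝓘(ℝ, Coord n) ∞ (Coord n)
    (fun p : N => TangentSpace 𝓘(ℝ, Coord n) p)

/-- `e` is a smooth chart of the manifold `N`. -/
def IsSmoothChart (e : OpenPartialHomeomorph N (Coord n)) : Prop :=
  e ∈ IsManifold.maximalAtlas 𝓘(ℝ, Coord n) ∞ N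

/-- The components `hᵢⱼ = h(∂ᵢ, ∂ⱼ)` of the metric `h` in the chart `e`, as functions of the
coordinates; `∂ᵢ` is the image of the `i`-th basis vector under the differential of `e⁻¹`. -/
def SmoothMetric.inChart (h : SmoothMetric n N) (e : OpenPartialHomeomorph N (Coord n))
    (x : Coord n) : Matrix (Fin n) (Fin n) ℝ :=
  Matrix.of fun i j => h.inner (e.symm x)
    (mfderiv 𝓘(ℝ, Coord n) 𝓘(ℝ, Coord n) e.symm x (EuclideanSpace.single i (1 : ℝ)))
    (mfderiv 𝓘(ℝ, Coord n) 𝓘(ℝ, Coord n) e.symm x (EuclideanSpace.single j (1 : ℝ)))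

/-- The Riemannian manifold `(N, h)` has constant sectional curvature `c`:
`⟨R(X, Y) Y, X⟩ = c (|X|² |Y|² - ⟨X, Y⟩²)` for all tangent vectors `X`, `Y` at all points. -/
def HasConstSectionalCurvature (h : SmoothMetric n N) (c : ℝ) : Prop :=
  ∀ e : OpenPartialHomeomorph N (Coord n), IsSmoothChart e → ∀ x ∈ e.target,
    ∀ X Y : Fin n → ℝ,
      Coord.dot (h.inChart e x) (Coord.riemannVec (h.inChart e) x X Y Y) X
        = c * (Coord.dot (h.inChart e x) X X * Coord.dot (h.inChart e x) Y Y
            - Coord.dot (h.inChart e x) X Y ^ 2)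

/-- `φ : (M, g) → (N, h)` is a smooth isometric (Riemannian) immersion: `φ^* h = g`. -/
def IsIsometricImmersion (g : SmoothMetric m M) (h : SmoothMetric n N) (φ : M → N) : Prop :=
  ContMDiff 𝓘(ℝ, Coord m) 𝓘(ℝ, Coord n) ∞ φ ∧
    ∀ (p : M) (u v : TangentSpace 𝓘(ℝ, Coord m) p),
      h.inner (φ p) (mfderiv 𝓘(ℝ, Coord m) 𝓘(ℝ, Coord n) φ p u)
        (mfderiv 𝓘(ℝ, Coord m) 𝓘(ℝ, Coord n) φ p v) = g.inner p u v

/-- The coordinate expression of `φ` in the charts `e` and `e'`. -/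
def mapInCharts (φ : M → N) (e : OpenPartialHomeomorph M (Coord m))
    (e' : OpenPartialHomeomorph N (Coord n)) (x : Coord m) : Coord n :=
  e' (φ (e.symm x))

/-- A property of the coordinate expression of `φ` (in terms of the components of the two metrics)
holds at all points and in all charts. -/
def InAllCharts (g : SmoothMetric m M) (h : SmoothMetric n N) (φ : M → N)
    (P : (Coord m → Matrix (Fin m) (Fin m) ℝ) → (Coord n → Matrix (Fin n) (Fin n) ℝ) →
      (Coord m → Coord n) → Coord m → Prop) : Prop :=
  ∀ (e : OpenPartialHomeomorph M (Coord m)) (e' : OpenPartialHomeomorph N (Coord n)),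
    IsSmoothChart e → IsSmoothChart e' → ∀ x ∈ e.target, φ (e.symm x) ∈ e'.source →
      P (g.inChart e) (h.inChart e') (mapInCharts φ e e') x

/-- `φ` is harmonic: its tension field vanishes identically. -/
def IsHarmonicMap (g : SmoothMetric m M) (h : SmoothMetric n N) (φ : M → N) : Prop :=
  InAllCharts g h φ fun G K Φ x => Coord.tension G K Φ x = 0

/-- `φ` is biharmonic: its bitension field vanishes identically. -/
def IsBiharmonicMap (g : SmoothMetric m M) (h : SmoothMetric n N) (φ : M → N) : Prop :=
  InAllCharts g h φ fun G K Φ x => Coord.bitension G K Φ x = 0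

/-- `φ` is proper biharmonic: it is biharmonic and not harmonic. -/
def IsProperBiharmonicMap (g : SmoothMetric m M) (h : SmoothMetric n N) (φ : M → N) : Prop :=
  IsBiharmonicMap g h φ ∧ ¬ IsHarmonicMap g h φ

/-- At every point there are at most two distinct principal curvatures. -/
def HasAtMostTwoPrincipalCurvatures (g : SmoothMetric m M) (h : SmoothMetric n N) (φ : M → N) :
    Prop :=
  InAllCharts g h φ fun G K Φ x => ∀ η : Fin n → ℝ, Coord.IsUnitNormal K Φ x η →
    {k : ℝ | Coord.IsPrincipalCurvature G K Φ x η k}.encard ≤ 2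

/-- The mean curvature `|H|` of the isometric immersion `φ` at `p`, computed in the preferred
charts around `p` and `φ p`. -/
def meanCurvatureAt (g : SmoothMetric m M) (h : SmoothMetric n N) (φ : M → N) (p : M) : ℝ :=
  Coord.meanCurvature (g.inChart (chartAt (Coord m) p)) (h.inChart (chartAt (Coord n) (φ p)))
    (mapInCharts φ (chartAt (Coord m) p) (chartAt (Coord n) (φ p))) (chartAt (Coord m) p p)

end Manifolds

end

/-! Where τ ≠ 0 put F = |τ| = m|H| and η = τ/F, and let A be the Weingarten operator of η, so that
∇η = -A on tangent vectors and trace A = F. Biharmonicity splits into a normal part, trace Hess F =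
(|A|² - mc)F (`biharmonic_normal`), and a tangential part, 2A(grad F) = -F grad F
(`biharmonic_tangent`). The tangential part rests on div A = dF, a consequence of the Codazzi
equation in constant curvature.

It suffices that |τ|² has zero derivative everywhere (`dd_tension_sq`). At a zero of |τ|², which is
a minimum, this is clear. A nonzero derivative elsewhere would produce an open set on which F > 0
and grad F ≠ 0. There -F/2 is a principal curvature, and it is not the only one because trace A = F
> 0. So the eigenvalues are -F/2, with multiplicity d, and tF with t = (1 + d/2)/(m - d)
(`weingarten_structure`). The quotient |A|²/F² is continuous and strictly increasing as a function
of d, hence d is locally constant (`exists_constant_multiplicity`).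

If d ≥ 2, some v ≠ 0 orthogonal to grad F lies in the same eigenspace. As is classical, the Codazzi
equation makes a principal curvature of multiplicity at least two constant along its own
eigendistribution. Thus |grad F|² = (grad F)(F) = 0, which is absurd (`false_of_multiple`).

If d = 1, let s = |grad F| and N = grad F/s. The Codazzi equation determines ∇N: the integral curves
of N are geodesics, and ∇_X N = ρX for tangent X ⟂ N, with ρ = as/F and a = -3/(m + 2) (`covDir_N`).
Writing ' for the derivative along N and K = |A|²/F², three equations hold: F' = s; s' + (m - 1)sρ =
(KF² - mc)F from the normal part; ρ' + ρ² - tF²/2 = -c from the Gauss equation. Eliminating s'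
expresses a multiple of s² as a polynomial in F. Differentiating once more and eliminating again
leaves (nonzero constant) · F² = constant, against F' = s > 0 (`false_of_biharmonic`).

All of this takes place in coordinates. For the passage to M, changes of coordinates are isometries
between spaces of equal dimension, hence totally geodesic, so |τ|² does not depend on the charts
(`dot_tension_eq`). Therefore |H| is locally constant, and M is connected. -/

open scoped Manifold ContDiff

noncomputable section

namespace Coord

variable {m n : ℕ}

/-! ### Directional derivatives of scalar functions -/

/-- The derivative of `f` in the constant direction `X`. -/
def dd (X : Coord m) (f : Coord m → ℝ) (x : Coord m) : ℝ := fderiv ℝ f x X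

theorem pd_eq_dd (i : Fin m) (f : Coord m → ℝ) (x : Coord m) :
    pd i f x = dd (EuclideanSpace.single i 1) f x := rfl

theorem coord_eq_sum (X : Coord m) : X = ∑ i, X i • EuclideanSpace.single i (1 : ℝ) := by
  ext j
  simp [Finset.sum_apply, Pi.single_apply]

theorem dd_eq_sum (X : Coord m) (f : Coord m → ℝ) (x : Coord m) :
    dd X f x = ∑ i, X i * pd i f x := by
  conv_lhs => rw [dd, coord_eq_sum X]
  simp [pd]

variable {U : Set (Coord m)} {x : Coord m} {f f₁ f₂ : Coord m → ℝ} {X Y : Coord m}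

theorem dd_add (h₁ : DifferentiableAt ℝ f₁ x) (h₂ : DifferentiableAt ℝ f₂ x) :
    dd X (fun y => f₁ y + f₂ y) x = dd X f₁ x + dd X f₂ x := by
  simp [dd, fderiv_fun_add h₁ h₂]

theorem dd_sub (h₁ : DifferentiableAt ℝ f₁ x) (h₂ : DifferentiableAt ℝ f₂ x) :
    dd X (fun y => f₁ y - f₂ y) x = dd X f₁ x - dd X f₂ x := by
  simp [dd, fderiv_fun_sub h₁ h₂]

theorem dd_mul (h₁ : DifferentiableAt ℝ f₁ x) (h₂ : DifferentiableAt ℝ f₂ x) :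
    dd X (fun y => f₁ y * f₂ y) x = dd X f₁ x * f₂ x + f₁ x * dd X f₂ x := by
  simp [dd, fderiv_fun_mul h₁ h₂]; ring

theorem dd_const_mul (c : ℝ) (h₁ : DifferentiableAt ℝ f x) :
    dd X (fun y => c * f y) x = c * dd X f x := by
  simp [dd, fderiv_const_mul h₁]

theorem dd_neg : dd X (fun y => - f y) x = - dd X f x := by
  simp [dd]

theorem dd_const (c : ℝ) : dd X (fun _ => c) x = 0 := by
  simp [dd]

theorem dd_sum {ι : Type*} {s : Finset ι} {f : ι → Coord m → ℝ}
    (h : ∀ i ∈ s, DifferentiableAt ℝ (f i) x) :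
    dd X (fun y => ∑ i ∈ s, f i y) x = ∑ i ∈ s, dd X (f i) x := by
  simp [dd, fderiv_fun_sum h]

theorem dd_congr (hU : IsOpen U) (hx : x ∈ U) (h : ∀ y ∈ U, f₁ y = f₂ y) :
    dd X f₁ x = dd X f₂ x := by
  have : f₁ =ᶠ[nhds x] f₂ := by
    filter_upwards [hU.mem_nhds hx] with y hy using h y hy
  simp [dd, this.fderiv_eq]

theorem dd_eq_zero_of_const (hU : IsOpen U) (hx : x ∈ U) {c : ℝ} (h : ∀ y ∈ U, f y = c) :
    dd X f x = 0 := by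
  rw [dd_congr hU hx h, dd_const]

theorem diffAt_of_smooth (hU : IsOpen U) (hx : x ∈ U) (hf : ContDiffOn ℝ ∞ f U) :
    DifferentiableAt ℝ f x :=
  (hf.contDiffAt (hU.mem_nhds hx)).differentiableAt (by simp)

theorem smooth_dd (hU : IsOpen U) (hf : ContDiffOn ℝ ∞ f U) : ContDiffOn ℝ ∞ (dd X f) U :=
  (hf.fderiv_of_isOpen hU (by simp)).clm_apply contDiffOn_const

theorem dd_comm (hU : IsOpen U) (hx : x ∈ U) (hf : ContDiffOn ℝ ∞ f U) :
    dd X (dd Y f) x = dd Y (dd X f) x := by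
  have hd : DifferentiableAt ℝ (fderiv ℝ f) x :=
    ((hf.fderiv_of_isOpen (m := ∞) hU (by simp)).contDiffAt (hU.mem_nhds hx)).differentiableAt
      (by simp)
  have key : ∀ X Y : Coord m, dd X (dd Y f) x = fderiv ℝ (fderiv ℝ f) x X Y := by
    intro X Y
    change fderiv ℝ (fun y => fderiv ℝ f y Y) x X = _
    rw [fderiv_clm_apply hd (differentiableAt_const _)]
    simp
  rw [key, key]
  exact ((hf.contDiffAt (hU.mem_nhds hx)).isSymmSndFDerivAt (by
    rw [minSmoothness_of_isRCLikeNormedField]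
    exact WithTop.coe_le_coe.2 (le_top : (2 : ℕ∞) ≤ ⊤))) X Y

/-- The differential of `Φ` in the constant direction `X`, as a field along `Φ`. -/
def dmapDir (Φ : Coord m → Coord n) (X : Coord m) (x : Coord m) : Fin n → ℝ :=
  fun a => dd X (fun y => Φ y a) x

theorem dmap_eq (Φ : Coord m → Coord n) (i : Fin m) :
    dmap Φ i = dmapDir Φ (EuclideanSpace.single i 1) := rfl

theorem dmapDir_eq_sum (Φ : Coord m → Coord n) (X : Coord m) (x : Coord m) :
    dmapDir Φ X x = ∑ i, X i • dmap Φ i x := by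
  ext a
  simp [dmapDir, dd_eq_sum, dmap, Finset.sum_apply]

theorem dd_comp {Φ : Coord m → Coord n} {f : Coord n → ℝ}
    (hΦ : ∀ a, DifferentiableAt ℝ (fun y => Φ y a) x) (hf : DifferentiableAt ℝ f (Φ x)) :
    dd X (fun y => f (Φ y)) x = ∑ a, pd a f (Φ x) * dmapDir Φ X x a := by
  have hΦ' : DifferentiableAt ℝ Φ x := differentiableAt_euclidean.2 hΦ
  have h1 : fderiv ℝ (fun y => f (Φ y)) x = (fderiv ℝ f (Φ x)).comp (fderiv ℝ Φ x) :=
    fderiv_comp x hf hΦ'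
  rw [dd, h1, ContinuousLinearMap.comp_apply]
  have h2 : ∀ a, (fderiv ℝ Φ x X) a = dmapDir Φ X x a := by
    intro a
    have := ((PiLp.hasFDerivAt_apply (𝕜 := ℝ) 2 (Φ x) a).comp x
      hΦ'.hasFDerivAt).fderiv
    exact (congrArg (fun L => L X) this).symm
  have h3 := dd_eq_sum (fderiv ℝ Φ x X) f (Φ x)
  rw [dd] at h3
  rw [h3]
  exact Finset.sum_congr rfl fun a _ => by rw [h2, mul_comm]

/-- A field of vectors all of whose components are smooth on `U`. -/
def SmoothField (V : Coord m → Fin n → ℝ) (U : Set (Coord m)) : Prop :=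
  ∀ a, ContDiffOn ℝ ∞ (fun y => V y a) U

theorem SmoothField.mono {V : Coord m → Fin n → ℝ} {U' : Set (Coord m)} (h : SmoothField V U)
    (hU : U' ⊆ U) : SmoothField V U' := fun a => (h a).mono hU

theorem smoothField_dmapDir {Φ : Coord m → Coord n} (hU : IsOpen U)
    (hΦ : ∀ a, ContDiffOn ℝ ∞ (fun y => Φ y a) U) : SmoothField (dmapDir Φ X) U :=
  fun a => smooth_dd hU (hΦ a)

theorem SmoothField.smul {V : Coord m → Fin n → ℝ} (hf : ContDiffOn ℝ ∞ f U)
    (hV : SmoothField V U) : SmoothField (fun y => f y • V y) U :=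
  fun a => hf.mul (hV a)

theorem SmoothField.sub {V W : Coord m → Fin n → ℝ}
    (hV : SmoothField V U) (hW : SmoothField W U) : SmoothField (fun y => V y - W y) U :=
  fun a => (hV a).sub (hW a)

theorem SmoothField.sum {ι : Type*} {s : Finset ι} {V : ι → Coord m → Fin n → ℝ}
    (hV : ∀ i ∈ s, SmoothField (V i) U) : SmoothField (fun y => ∑ i ∈ s, V i y) U := by
  intro a
  simp only [Finset.sum_apply]
  exact ContDiffOn.sum fun i hi => hV i hi a

/-! ### The scalar product -/

section Dot

variable (G : Matrix (Fin n) (Fin n) ℝ) (u v w : Fin n → ℝ)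

theorem dot_add_left : dot G (u + v) w = dot G u w + dot G v w := by
  simp only [dot, Pi.add_apply, ← Finset.sum_add_distrib]
  exact Finset.sum_congr rfl fun i _ => Finset.sum_congr rfl fun j _ => by ring

theorem dot_add_right : dot G u (v + w) = dot G u v + dot G u w := by
  simp only [dot, Pi.add_apply, ← Finset.sum_add_distrib]
  exact Finset.sum_congr rfl fun i _ => Finset.sum_congr rfl fun j _ => by ring

theorem dot_smul_left (c : ℝ) : dot G (c • u) v = c * dot G u v := by
  simp only [dot, Pi.smul_apply, smul_eq_mul, Finset.mul_sum]
  exact Finset.sum_congr rfl fun i _ => Finset.sum_congr rfl fun j _ => by ring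

theorem dot_smul_right (c : ℝ) : dot G u (c • v) = c * dot G u v := by
  simp only [dot, Pi.smul_apply, smul_eq_mul, Finset.mul_sum]
  exact Finset.sum_congr rfl fun i _ => Finset.sum_congr rfl fun j _ => by ring

theorem dot_zero_left : dot G 0 v = 0 := by simp [dot]

theorem dot_zero_right : dot G u 0 = 0 := by simp [dot]

theorem dot_neg_left : dot G (-u) v = - dot G u v := by
  rw [← neg_one_smul ℝ u, dot_smul_left]; ring

theorem dot_neg_right : dot G u (-v) = - dot G u v := by
  rw [← neg_one_smul ℝ v, dot_smul_right]; ring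

theorem dot_sub_left : dot G (u - v) w = dot G u w - dot G v w := by
  rw [sub_eq_add_neg, dot_add_left, dot_neg_left]; ring

theorem dot_sub_right : dot G u (v - w) = dot G u v - dot G u w := by
  rw [sub_eq_add_neg, dot_add_right, dot_neg_right]; ring

theorem dot_sum_left {ι : Type*} (s : Finset ι) (u : ι → Fin n → ℝ) :
    dot G (∑ i ∈ s, u i) v = ∑ i ∈ s, dot G (u i) v := by
  classical
  induction s using Finset.induction_on with
  | empty => simp [dot_zero_left]
  | insert a s ha ih => rw [Finset.sum_insert ha, Finset.sum_insert ha, dot_add_left, ih]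

theorem dot_sum_right {ι : Type*} (s : Finset ι) (v : ι → Fin n → ℝ) :
    dot G u (∑ i ∈ s, v i) = ∑ i ∈ s, dot G u (v i) := by
  classical
  induction s using Finset.induction_on with
  | empty => simp [dot_zero_right]
  | insert a s ha ih => rw [Finset.sum_insert ha, Finset.sum_insert ha, dot_add_right, ih]

variable {G}

theorem dot_comm (hG : G.IsSymm) : dot G u v = dot G v u := by
  rw [dot, dot, Finset.sum_comm]
  refine Finset.sum_congr rfl fun i _ => Finset.sum_congr rfl fun j _ => ?_
  rw [hG.apply i j]; ring

theorem dot_eq_dotProduct : dot G u v = u ⬝ᵥ (G.mulVec v) := by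
  simp only [dot, dotProduct, Matrix.mulVec, Finset.mul_sum]
  exact Finset.sum_congr rfl fun i _ => Finset.sum_congr rfl fun j _ => by ring

theorem posDef_isSymm (hG : G.PosDef) : G.IsSymm := by
  have := hG.isHermitian
  rwa [Matrix.IsHermitian, Matrix.conjTranspose_eq_transpose_of_trivial] at this

theorem dot_self_pos (hG : G.PosDef) (hu : u ≠ 0) : 0 < dot G u u := by
  rw [dot_eq_dotProduct]
  simpa using hG.dotProduct_mulVec_pos hu

theorem dot_self_nonneg (hG : G.PosDef) : 0 ≤ dot G u u := by
  by_cases hu : u = 0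
  · simp [hu, dot_zero_left]
  · exact (dot_self_pos u hG hu).le

theorem eq_zero_of_dot_self (hG : G.PosDef) (hu : dot G u u = 0) : u = 0 := by
  by_contra h
  exact (dot_self_pos u hG h).ne' hu

theorem isUnit_det_of_posDef (hG : G.PosDef) : IsUnit G.det := hG.det_pos.ne'.isUnit

end Dot

/-! ### Metrics on open sets of the coordinate space -/

/-- `h` is a smooth Riemannian metric on the open set `W`. -/
structure MetricOn (h : Coord n → Matrix (Fin n) (Fin n) ℝ) (W : Set (Coord n)) : Prop where
  isOpen : IsOpen W
  smooth : ∀ i j, ContDiffOn ℝ ∞ (fun y => h y i j) W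
  posDef : ∀ y ∈ W, (h y).PosDef

section Metric

variable {h : Coord n → Matrix (Fin n) (Fin n) ℝ} {W : Set (Coord n)} {y : Coord n}

theorem smooth_det {k : ℕ} {A : Coord n → Matrix (Fin k) (Fin k) ℝ}
    (hA : ∀ i j, ContDiffOn ℝ ∞ (fun y => A y i j) W) :
    ContDiffOn ℝ ∞ (fun y => (A y).det) W := by
  simp only [Matrix.det_apply']
  exact ContDiffOn.sum fun σ _ => contDiffOn_const.mul (contDiffOn_prod fun i _ => hA _ _)

/-- Cramer's rule: the entries of the inverse are quotients of polynomials in the entries of h, with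
nonvanishing denominator det h. -/
theorem MetricOn.smooth_inv (H : MetricOn h W) (i j : Fin n) :
    ContDiffOn ℝ ∞ (fun y => (h y)⁻¹ i j) W := by
  have h1 : ∀ y ∈ W, (h y)⁻¹ i j = ((h y).det)⁻¹ * (h y).adjugate i j := by
    intro y _
    rw [Matrix.inv_def, Ring.inverse_eq_inv', Matrix.smul_apply, smul_eq_mul]
  refine ContDiffOn.congr (ContDiffOn.mul ((smooth_det H.smooth).inv fun y hy =>
    (H.posDef y hy).det_pos.ne') ?_) h1
  simp only [Matrix.adjugate_apply]
  refine smooth_det fun k l => ?_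
  by_cases hk : k = j
  · subst hk; simpa [Matrix.updateRow_self] using contDiffOn_const
  · simpa [Matrix.updateRow_ne hk] using H.smooth k l

theorem MetricOn.isSymm (H : MetricOn h W) (hy : y ∈ W) : (h y).IsSymm :=
  posDef_isSymm (H.posDef y hy)

theorem MetricOn.inv_mul (H : MetricOn h W) (hy : y ∈ W) : (h y)⁻¹ * h y = 1 :=
  Matrix.nonsing_inv_mul _ (isUnit_det_of_posDef (H.posDef y hy))

theorem MetricOn.mul_inv (H : MetricOn h W) (hy : y ∈ W) : h y * (h y)⁻¹ = 1 :=
  Matrix.mul_nonsing_inv _ (isUnit_det_of_posDef (H.posDef y hy))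

theorem MetricOn.smooth_christoffel (H : MetricOn h W) (k i j : Fin n) :
    ContDiffOn ℝ ∞ (christoffel h k i j) W :=
  contDiffOn_const.mul (ContDiffOn.sum fun l _ => (H.smooth_inv k l).mul
    (((smooth_dd H.isOpen (H.smooth j l)).add (smooth_dd H.isOpen (H.smooth i l))).sub
      (smooth_dd H.isOpen (H.smooth i j))))

theorem MetricOn.pd_symm (H : MetricOn h W) (hy : y ∈ W) (l i j : Fin n) :
    pd l (fun z => h z i j) y = pd l (fun z => h z j i) y :=
  dd_congr H.isOpen hy fun _ hz => (H.isSymm hz).apply j i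

theorem MetricOn.christoffel_symm (H : MetricOn h W) (hy : y ∈ W) (k i j : Fin n) :
    christoffel h k i j y = christoffel h k j i y := by
  simp only [christoffel]
  congr 1
  refine Finset.sum_congr rfl fun l _ => ?_
  rw [H.pd_symm hy l i j]; ring

/-- The Christoffel symbols with lowered index. -/
theorem MetricOn.lower_christoffel (H : MetricOn h W) (hy : y ∈ W) (a i j : Fin n) :
    ∑ k, h y a k * christoffel h k i j y = (1 / 2) * (pd i (fun z => h z j a) y
      + pd j (fun z => h z i a) y - pd a (fun z => h z i j) y) := by
  set q : Fin n → ℝ := fun l => pd i (fun z => h z j l) y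
      + pd j (fun z => h z i l) y - pd l (fun z => h z i j) y with hq
  have : ∑ k, h y a k * christoffel h k i j y = (1 / 2) * ∑ l, (h y * (h y)⁻¹) a l * q l := by
    simp only [christoffel, Matrix.mul_apply, Finset.mul_sum, Finset.sum_mul]
    rw [Finset.sum_comm]
    exact Finset.sum_congr rfl fun l _ => Finset.sum_congr rfl fun k _ => by simp only [hq]; ring
  rw [this, H.mul_inv hy]
  simp [Matrix.one_apply, hq]

/-- This is ∇h = 0. In the sum of the two lowered Christoffel symbols only the two halves of ∂_d hₐᵦ
survive; the other terms cancel by the symmetry of h. -/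
theorem MetricOn.pd_metric (H : MetricOn h W) (hy : y ∈ W) (d a b : Fin n) :
    pd d (fun z => h z a b) y = ∑ k, h y a k * christoffel h k d b y
      + ∑ k, h y b k * christoffel h k d a y := by
  rw [H.lower_christoffel hy, H.lower_christoffel hy, H.pd_symm hy d b a, H.pd_symm hy a d b,
    H.pd_symm hy b d a]
  rw [H.pd_symm hy a b d]
  ring

end Metric

end Coord

end

noncomputable section

namespace Coord

variable {m n : ℕ}

/-! ### The covariant derivative along a map -/

/-- The matrix of the connection pulled back by `Φ`, in the direction `X`. -/
def conn (h : Coord n → Matrix (Fin n) (Fin n) ℝ) (Φ : Coord m → Coord n) (X : Coord m)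
    (a c : Fin n) (x : Coord m) : ℝ :=
  ∑ b, christoffel h a b c (Φ x) * dmapDir Φ X x b

/-- The covariant derivative of a field along `Φ` in the constant direction `X`. -/
def covDir (h : Coord n → Matrix (Fin n) (Fin n) ℝ) (Φ : Coord m → Coord n) (X : Coord m)
    (V : Coord m → Fin n → ℝ) (x : Coord m) : Fin n → ℝ :=
  fun a => dd X (fun y => V y a) x + ∑ c, conn h Φ X a c x * V x c

theorem covAlong_eq (h : Coord n → Matrix (Fin n) (Fin n) ℝ) (Φ : Coord m → Coord n)
    (V : Coord m → Fin n → ℝ) (i : Fin m) :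
    covAlong h Φ V i = covDir h Φ (EuclideanSpace.single i 1) V := by
  funext x a
  simp only [covAlong, covDir, conn, pd_eq_dd, dmap_eq, Finset.sum_mul]
  rw [Finset.sum_comm]

/-- Constant directions commute, so torsion and curvature identities for `covDir` carry no bracket
terms. Linearity in X leads back to the coordinate frame. -/
theorem covDir_eq_sum (h : Coord n → Matrix (Fin n) (Fin n) ℝ) (Φ : Coord m → Coord n)
    (X : Coord m) (V : Coord m → Fin n → ℝ) (x : Coord m) :
    covDir h Φ X V x = ∑ i, X i • covAlong h Φ V i x := by
  funext a
  simp only [covAlong_eq, covDir, Finset.sum_apply, Pi.smul_apply, smul_eq_mul, mul_add,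
    Finset.sum_add_distrib, dd_eq_sum X, pd_eq_dd]
  congr 1
  simp only [conn, dmapDir_eq_sum Φ X, Finset.sum_apply, Pi.smul_apply, smul_eq_mul,
    Finset.mul_sum, Finset.sum_mul, dmap_eq]
  rw [Finset.sum_comm' (t' := Finset.univ) (s' := fun _ => Finset.univ) (by simp)]
  conv_rhs => rw [Finset.sum_comm]
  rw [Finset.sum_comm]
  refine Finset.sum_congr rfl fun c _ => ?_
  rw [Finset.sum_comm]
  exact Finset.sum_congr rfl fun i _ => Finset.sum_congr rfl fun b _ => by ring

/-- `Φ` is a smooth map from the open set `U` to the open set `W` with the metric `h`. -/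
structure MapOn (h : Coord n → Matrix (Fin n) (Fin n) ℝ) (W : Set (Coord n))
    (Φ : Coord m → Coord n) (U : Set (Coord m)) : Prop where
  metric : MetricOn h W
  isOpen : IsOpen U
  smooth : ∀ a, ContDiffOn ℝ ∞ (fun y => Φ y a) U
  mapsTo : ∀ x ∈ U, Φ x ∈ W

namespace MapOn

variable {h : Coord n → Matrix (Fin n) (Fin n) ℝ} {W : Set (Coord n)}
  {Φ : Coord m → Coord n} {U : Set (Coord m)} {x : Coord m} {X Y : Coord m}
  {V V₁ V₂ : Coord m → Fin n → ℝ} {f : Coord m → ℝ}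

theorem mono {U' : Set (Coord m)} (H : MapOn h W Φ U) (hU : U' ⊆ U) (ho : IsOpen U') :
    MapOn h W Φ U' :=
  ⟨H.metric, ho, fun a => (H.smooth a).mono hU, fun x hx => H.mapsTo x (hU hx)⟩

theorem smooth_comp (H : MapOn h W Φ U) {f : Coord n → ℝ} (hf : ContDiffOn ℝ ∞ f W) :
    ContDiffOn ℝ ∞ (fun y => f (Φ y)) U :=
  hf.comp (contDiffOn_euclidean.2 H.smooth) H.mapsTo

theorem smooth_dmapDir (H : MapOn h W Φ U) : SmoothField (dmapDir Φ X) U :=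
  smoothField_dmapDir H.isOpen H.smooth

theorem smooth_conn (H : MapOn h W Φ U) (a c : Fin n) : ContDiffOn ℝ ∞ (conn h Φ X a c) U :=
  ContDiffOn.sum fun b _ =>
    (H.smooth_comp (H.metric.smooth_christoffel a b c)).mul (H.smooth_dmapDir b)

theorem smooth_covDir (H : MapOn h W Φ U) (hV : SmoothField V U) :
    SmoothField (covDir h Φ X V) U := fun a =>
  (smooth_dd H.isOpen (hV a)).add (ContDiffOn.sum fun c _ => (H.smooth_conn a c).mul (hV c))

theorem smooth_dot (H : MapOn h W Φ U) (h₁ : SmoothField V₁ U) (h₂ : SmoothField V₂ U) :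
    ContDiffOn ℝ ∞ (fun y => dot (h (Φ y)) (V₁ y) (V₂ y)) U :=
  ContDiffOn.sum fun a _ => ContDiffOn.sum fun b _ =>
    ((H.smooth_comp (H.metric.smooth a b)).mul (h₁ a)).mul (h₂ b)

theorem isSymm (H : MapOn h W Φ U) (hx : x ∈ U) : (h (Φ x)).IsSymm :=
  H.metric.isSymm (H.mapsTo x hx)

theorem covDir_congr (H : MapOn h W Φ U) (hx : x ∈ U) (hV : ∀ y ∈ U, V₁ y = V₂ y) :
    covDir h Φ X V₁ x = covDir h Φ X V₂ x := by
  funext a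
  simp only [covDir]
  rw [dd_congr H.isOpen hx fun y hy => congrFun (hV y hy) a, hV x hx]

theorem covDir_smul (H : MapOn h W Φ U) (hx : x ∈ U) (hf : ContDiffOn ℝ ∞ f U)
    (hV : SmoothField V U) : covDir h Φ X (fun y => f y • V y) x
      = dd X f x • V x + f x • covDir h Φ X V x := by
  funext a
  simp only [covDir, Pi.smul_apply, Pi.add_apply, smul_eq_mul]
  rw [dd_mul (diffAt_of_smooth H.isOpen hx hf) (diffAt_of_smooth H.isOpen hx (hV a)), mul_add,
    Finset.mul_sum, add_assoc]
  congr 2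
  exact Finset.sum_congr rfl fun c _ => by ring

theorem covDir_add (H : MapOn h W Φ U) (hx : x ∈ U) (h₁ : SmoothField V₁ U)
    (h₂ : SmoothField V₂ U) : covDir h Φ X (fun y => V₁ y + V₂ y) x
      = covDir h Φ X V₁ x + covDir h Φ X V₂ x := by
  funext a
  simp only [covDir, Pi.add_apply, mul_add, Finset.sum_add_distrib]
  rw [dd_add (diffAt_of_smooth H.isOpen hx (h₁ a)) (diffAt_of_smooth H.isOpen hx (h₂ a))]
  ring

theorem covDir_sub (H : MapOn h W Φ U) (hx : x ∈ U) (h₁ : SmoothField V₁ U)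
    (h₂ : SmoothField V₂ U) : covDir h Φ X (fun y => V₁ y - V₂ y) x
      = covDir h Φ X V₁ x - covDir h Φ X V₂ x := by
  funext a
  simp only [covDir, Pi.sub_apply, mul_sub, Finset.sum_sub_distrib]
  rw [dd_sub (diffAt_of_smooth H.isOpen hx (h₁ a)) (diffAt_of_smooth H.isOpen hx (h₂ a))]
  ring

theorem covDir_sum (H : MapOn h W Φ U) (hx : x ∈ U) {ι : Type*} {s : Finset ι}
    {V : ι → Coord m → Fin n → ℝ} (hV : ∀ i ∈ s, SmoothField (V i) U) :
    covDir h Φ X (fun y => ∑ i ∈ s, V i y) x = ∑ i ∈ s, covDir h Φ X (V i) x := by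
  funext a
  simp only [covDir, Finset.sum_apply, Finset.sum_add_distrib, Finset.mul_sum]
  rw [dd_sum fun i hi => diffAt_of_smooth H.isOpen hx (hV i hi a), Finset.sum_comm]

/-- The connection is compatible with the metric. -/
theorem dd_dot (H : MapOn h W Φ U) (hx : x ∈ U) (h₁ : SmoothField V₁ U)
    (h₂ : SmoothField V₂ U) :
    dd X (fun y => dot (h (Φ y)) (V₁ y) (V₂ y)) x
      = dot (h (Φ x)) (covDir h Φ X V₁ x) (V₂ x) + dot (h (Φ x)) (V₁ x) (covDir h Φ X V₂ x) := by
  have hW := H.mapsTo x hx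
  have hd : ∀ {f : Coord m → ℝ}, ContDiffOn ℝ ∞ f U → DifferentiableAt ℝ f x :=
    fun hf => diffAt_of_smooth H.isOpen hx hf
  -- The equation ∇h = 0 pulled back by Φ, from the chain rule and `pd_metric`.
  have hh : ∀ a b, dd X (fun y => h (Φ y) a b) x = ∑ k, h (Φ x) a k * conn h Φ X k b x
      + ∑ k, h (Φ x) b k * conn h Φ X k a x := by
    intro a b
    rw [dd_comp (f := fun z => h z a b) (fun a => hd (H.smooth a))
      (diffAt_of_smooth H.metric.isOpen hW (H.metric.smooth a b))]
    simp only [H.metric.pd_metric hW, conn, Finset.mul_sum, add_mul, Finset.sum_add_distrib,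
      Finset.sum_mul]
    congr 1 <;>
    · rw [Finset.sum_comm]
      exact Finset.sum_congr rfl fun _ _ => Finset.sum_congr rfl fun _ _ => by ring
  have hterm : ∀ a b, dd X (fun y => h (Φ y) a b * V₁ y a * V₂ y b) x
      = (∑ k, h (Φ x) a k * conn h Φ X k b x + ∑ k, h (Φ x) b k * conn h Φ X k a x)
          * V₁ x a * V₂ x b + h (Φ x) a b * dd X (fun y => V₁ y a) x * V₂ x b
        + h (Φ x) a b * V₁ x a * dd X (fun y => V₂ y b) x := by
    intro a b
    have s1 := H.smooth_comp (H.metric.smooth a b)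
    rw [dd_mul (hd (s1.mul (h₁ a))) (hd (h₂ b)), dd_mul (hd s1) (hd (h₁ a)), hh]
    ring
  simp only [dot]
  rw [dd_sum fun a _ => hd (ContDiffOn.sum fun b _ =>
    ((H.smooth_comp (H.metric.smooth a b)).mul (h₁ a)).mul (h₂ b))]
  have : ∀ a, dd X (fun y => ∑ b, h (Φ y) a b * V₁ y a * V₂ y b) x
      = ∑ b, dd X (fun y => h (Φ y) a b * V₁ y a * V₂ y b) x := fun a =>
    dd_sum fun b _ => hd (((H.smooth_comp (H.metric.smooth a b)).mul (h₁ a)).mul (h₂ b))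
  simp only [this, hterm, covDir, mul_add, add_mul, Finset.sum_add_distrib]
  have e1 : ∑ a, ∑ b, (∑ k, h (Φ x) a k * conn h Φ X k b x) * V₁ x a * V₂ x b
      = ∑ a, ∑ b, h (Φ x) a b * V₁ x a * ∑ c, conn h Φ X b c x * V₂ x c := by
    refine Finset.sum_congr rfl fun a _ => ?_
    simp only [Finset.sum_mul, Finset.mul_sum]
    rw [Finset.sum_comm]
    exact Finset.sum_congr rfl fun _ _ => Finset.sum_congr rfl fun _ _ => by ring
  have e2 : ∑ a, ∑ b, (∑ k, h (Φ x) b k * conn h Φ X k a x) * V₁ x a * V₂ x b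
      = ∑ a, ∑ b, h (Φ x) a b * (∑ c, conn h Φ X a c x * V₁ x c) * V₂ x b := by
    rw [Finset.sum_comm]
    conv_rhs => rw [Finset.sum_comm]
    refine Finset.sum_congr rfl fun b _ => ?_
    simp only [Finset.sum_mul, Finset.mul_sum]
    rw [Finset.sum_comm]
    refine Finset.sum_congr rfl fun k _ => Finset.sum_congr rfl fun a _ => ?_
    rw [(H.isSymm hx).apply k b]; ring
  rw [e1, e2]
  ring

/-- The connection is torsion free. -/
theorem covDir_dmapDir_comm (H : MapOn h W Φ U) (hx : x ∈ U) :
    covDir h Φ X (dmapDir Φ Y) x = covDir h Φ Y (dmapDir Φ X) x := by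
  funext a
  simp only [covDir]
  congr 1
  · exact dd_comm H.isOpen hx (H.smooth a)
  · simp only [conn, Finset.sum_mul]
    rw [Finset.sum_comm]
    refine Finset.sum_congr rfl fun b _ => Finset.sum_congr rfl fun c _ => ?_
    rw [H.metric.christoffel_symm (H.mapsTo x hx)]; ring

/-- The curvature dω + ω ∧ ω of the pulled-back connection matrix ω. Differentiating ω produces
second derivatives of Φ, but these are symmetric in X and Y and cancel, so only the curvature of h
remains. -/
theorem dd_conn_sub (H : MapOn h W Φ U) (hx : x ∈ U) (a k : Fin n) :
    dd X (conn h Φ Y a k) x - dd Y (conn h Φ X a k) x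
      + ∑ p, (conn h Φ X a p x * conn h Φ Y p k x - conn h Φ Y a p x * conn h Φ X p k x)
      = ∑ i, ∑ j, riemann h a k i j (Φ x) * dmapDir Φ X x i * dmapDir Φ Y x j := by
  have hW := H.mapsTo x hx
  have hd : ∀ {f : Coord m → ℝ}, ContDiffOn ℝ ∞ f U → DifferentiableAt ℝ f x :=
    fun hf => diffAt_of_smooth H.isOpen hx hf
  have h1 : ∀ X Y : Coord m, dd X (conn h Φ Y a k) x
      = ∑ i, ∑ j, pd i (christoffel h a j k) (Φ x) * dmapDir Φ X x i * dmapDir Φ Y x j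
        + ∑ j, christoffel h a j k (Φ x) * dd X (dd Y (fun y => Φ y j)) x := by
    intro X Y
    have : dd X (conn h Φ Y a k) x
        = ∑ b, dd X (fun y => christoffel h a b k (Φ y) * dmapDir Φ Y y b) x :=
      dd_sum fun b _ => hd ((H.smooth_comp (H.metric.smooth_christoffel a b k)).mul
        (H.smooth_dmapDir b))
    rw [this, Finset.sum_comm, ← Finset.sum_add_distrib]
    refine Finset.sum_congr rfl fun b _ => ?_
    rw [dd_mul (hd (H.smooth_comp (H.metric.smooth_christoffel a b k))) (hd (H.smooth_dmapDir b)),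
      dd_comp (fun a => hd (H.smooth a))
        (diffAt_of_smooth H.metric.isOpen hW (H.metric.smooth_christoffel a b k)), Finset.sum_mul]
    rfl
  have h2 : ∀ X Y : Coord m, ∑ p, conn h Φ X a p x * conn h Φ Y p k x
      = ∑ i, ∑ j, (∑ p, christoffel h a i p (Φ x) * christoffel h p j k (Φ x))
          * dmapDir Φ X x i * dmapDir Φ Y x j := by
    intro X Y
    simp only [conn, Finset.sum_mul, Finset.mul_sum]
    rw [Finset.sum_comm]
    conv_lhs => enter [2, y]; rw [Finset.sum_comm]
    rw [Finset.sum_comm]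
    refine Finset.sum_congr rfl fun i _ => Finset.sum_congr rfl fun j _ =>
      Finset.sum_congr rfl fun p _ => by ring
  have h3 : ∀ (f : Fin n → Fin n → ℝ) (X Y : Coord m),
      ∑ i, ∑ j, f i j * dmapDir Φ Y x i * dmapDir Φ X x j
        = ∑ i, ∑ j, f j i * dmapDir Φ X x i * dmapDir Φ Y x j := by
    intro f X Y
    rw [Finset.sum_comm]
    exact Finset.sum_congr rfl fun i _ => Finset.sum_congr rfl fun j _ => by ring
  have h4 : ∑ j, christoffel h a j k (Φ x) * dd Y (dd X (fun y => Φ y j)) x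
      = ∑ j, christoffel h a j k (Φ x) * dd X (dd Y (fun y => Φ y j)) x :=
    Finset.sum_congr rfl fun j _ => by rw [dd_comm H.isOpen hx (H.smooth j)]
  rw [Finset.sum_sub_distrib, h1 X Y, h1 Y X, h2 X Y, h2 Y X, h4]
  rw [h3 (fun i j => pd i (christoffel h a j k) (Φ x)) X Y,
    h3 (fun i j => ∑ p, christoffel h a i p (Φ x) * christoffel h p j k (Φ x)) X Y]
  simp only [riemann, Finset.sum_sub_distrib, add_mul, sub_mul, Finset.sum_add_distrib]
  ring

/-- The curvature of the connection along `Φ` is the pullback of the curvature of `h`. -/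
theorem covDir_covDir_sub (H : MapOn h W Φ U) (hx : x ∈ U) (hV : SmoothField V U) :
    covDir h Φ X (covDir h Φ Y V) x - covDir h Φ Y (covDir h Φ X V) x
      = riemannVec h (Φ x) (dmapDir Φ X x) (dmapDir Φ Y x) (V x) := by
  have hd : ∀ {f : Coord m → ℝ}, ContDiffOn ℝ ∞ f U → DifferentiableAt ℝ f x :=
    fun hf => diffAt_of_smooth H.isOpen hx hf
  funext a
  -- The bracketed terms with first derivatives of V are symmetric in X and Y, so they drop out of
  -- the commutator.
  have h1 : ∀ X Y : Coord m, covDir h Φ X (covDir h Φ Y V) x a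
      = dd X (dd Y (fun y => V y a)) x + ∑ c, dd X (conn h Φ Y a c) x * V x c
        + (∑ c, conn h Φ Y a c x * dd X (fun y => V y c) x
          + ∑ c, conn h Φ X a c x * dd Y (fun y => V y c) x)
        + ∑ k, (∑ p, conn h Φ X a p x * conn h Φ Y p k x) * V x k := by
    intro X Y
    have e1 : dd X (fun y => covDir h Φ Y V y a) x
        = dd X (dd Y (fun y => V y a)) x + ∑ c, dd X (fun y => conn h Φ Y a c y * V y c) x := by
      rw [← dd_sum fun c _ => hd ((H.smooth_conn a c).mul (hV c))]
      exact dd_add (hd (smooth_dd H.isOpen (hV a)))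
        (hd (ContDiffOn.sum fun c _ => (H.smooth_conn a c).mul (hV c)))
    have e2 : ∀ c, dd X (fun y => conn h Φ Y a c y * V y c) x
        = dd X (conn h Φ Y a c) x * V x c + conn h Φ Y a c x * dd X (fun y => V y c) x :=
      fun c => dd_mul (hd (H.smooth_conn a c)) (hd (hV c))
    have e3 : ∑ c, conn h Φ X a c x * covDir h Φ Y V x c
        = ∑ c, conn h Φ X a c x * dd Y (fun y => V y c) x
          + ∑ k, (∑ p, conn h Φ X a p x * conn h Φ Y p k x) * V x k := by
      simp only [covDir, mul_add, Finset.sum_add_distrib]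
      congr 1
      simp only [Finset.mul_sum, Finset.sum_mul]
      rw [Finset.sum_comm]
      exact Finset.sum_congr rfl fun _ _ => Finset.sum_congr rfl fun _ _ => by ring
    change dd X (fun y => covDir h Φ Y V y a) x + _ = _
    rw [e1, e3]
    simp only [e2, Finset.sum_add_distrib]
    ring
  rw [Pi.sub_apply, h1 X Y, h1 Y X, dd_comm H.isOpen hx (hV a)]
  have h2 : riemannVec h (Φ x) (dmapDir Φ X x) (dmapDir Φ Y x) (V x) a
      = ∑ k, (∑ i, ∑ j, riemann h a k i j (Φ x) * dmapDir Φ X x i * dmapDir Φ Y x j)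
          * V x k := by
    simp only [riemannVec, Finset.sum_mul]
    conv_lhs => enter [2, i]; rw [Finset.sum_comm]
    rw [Finset.sum_comm]
  rw [h2]
  simp only [← H.dd_conn_sub hx, add_mul, sub_mul, Finset.sum_add_distrib, Finset.sum_sub_distrib]
  ring

end MapOn

end Coord

end

noncomputable section

namespace Coord

variable {m n : ℕ}

/-! ### Symmetries of the curvature tensor and constant curvature -/

/-- A tensor with the symmetries of a curvature tensor vanishes if its sectional values vanish. -/
theorem curvature_polarization {E : Type*} [AddCommGroup E] (S : E → E → E → E → ℝ)
    (add₁ : ∀ X X' Y Z W, S (X + X') Y Z W = S X Y Z W + S X' Y Z W)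
    (add₂ : ∀ X Y Y' Z W, S X (Y + Y') Z W = S X Y Z W + S X Y' Z W)
    (add₃ : ∀ X Y Z Z' W, S X Y (Z + Z') W = S X Y Z W + S X Y Z' W)
    (add₄ : ∀ X Y Z W W', S X Y Z (W + W') = S X Y Z W + S X Y Z W')
    (skew₁₂ : ∀ X Y Z W, S X Y Z W = - S Y X Z W) (skew₃₄ : ∀ X Y Z W, S X Y Z W = - S X Y W Z)
    (bianchi : ∀ X Y Z W, S X Y Z W + S Y Z X W + S Z X Y W = 0)
    (sec : ∀ X Y, S X Y Y X = 0) (X Y Z W : E) : S X Y Z W = 0 := by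
  -- Pair symmetry: the Bianchi identity at the four cyclic shifts of (X, Y, Z, W), combined with
  -- skew-symmetry.
  have pair : ∀ X Y Z W, S X Y Z W = S Z W X Y := by
    intro X Y Z W
    have b1 := bianchi X Y Z W
    have b2 := bianchi Y Z W X
    have b3 := bianchi Z W X Y
    have b4 := bianchi W X Y Z
    linarith [skew₁₂ X Y Z W, skew₃₄ X Y Z W, skew₁₂ Y Z X W, skew₃₄ Y Z X W, skew₁₂ Z X Y W,
      skew₃₄ Z X Y W, skew₃₄ Y Z W X, skew₃₄ Z W Y X, skew₁₂ Z W X Y, skew₃₄ W Y Z X,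
      skew₁₂ W Y Z X, skew₃₄ W X Z Y, skew₁₂ W X Z Y, skew₃₄ X Z W Y, skew₁₂ X Z W Y,
      skew₃₄ X Y W Z, skew₁₂ X Y W Z, skew₃₄ Y W X Z, skew₁₂ Y W X Z, skew₃₄ W X Y Z,
      skew₁₂ W X Y Z, skew₁₂ Y W Z X]
  -- Polarization of the sectional values in the outer arguments.
  have mid : ∀ X Y W, S X Y Y W = 0 := by
    intro X Y W
    have h1 := sec (X + W) Y
    rw [add₁, add₄, add₄, sec, sec] at h1
    have h2 : S W Y Y X = S X Y Y W := by
      rw [pair, skew₁₂, skew₃₄, neg_neg]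
    linarith
  -- Polarization in the inner arguments. Then S changes sign under every exchange of neighbours,
  -- the three Bianchi terms coincide, and 3S = 0.
  have alt : ∀ X Y Z W, S X Y Z W = - S X Z Y W := by
    intro X Y Z W
    have h1 := mid X (Y + Z) W
    rw [add₂, add₃, add₃, mid, mid] at h1
    linarith
  have b := bianchi X Y Z W
  have h1 : S Y Z X W = S X Y Z W := by rw [alt, skew₁₂, neg_neg]
  have h2 : S Z X Y W = S X Y Z W := by rw [skew₁₂, alt, neg_neg]
  linarith

section RiemannVec

variable (h : Coord n → Matrix (Fin n) (Fin n) ℝ) (x : Coord n) (X X' Y Y' Z Z' : Fin n → ℝ)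

theorem riemannVec_add₁ :
    riemannVec h x (X + X') Y Z = riemannVec h x X Y Z + riemannVec h x X' Y Z := by
  funext l
  simp only [riemannVec, Pi.add_apply, ← Finset.sum_add_distrib]
  exact Finset.sum_congr rfl fun _ _ => Finset.sum_congr rfl fun _ _ =>
    Finset.sum_congr rfl fun _ _ => by ring

theorem riemannVec_add₂ :
    riemannVec h x X (Y + Y') Z = riemannVec h x X Y Z + riemannVec h x X Y' Z := by
  funext l
  simp only [riemannVec, Pi.add_apply, ← Finset.sum_add_distrib]
  exact Finset.sum_congr rfl fun _ _ => Finset.sum_congr rfl fun _ _ =>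
    Finset.sum_congr rfl fun _ _ => by ring

theorem riemannVec_add₃ :
    riemannVec h x X Y (Z + Z') = riemannVec h x X Y Z + riemannVec h x X Y Z' := by
  funext l
  simp only [riemannVec, Pi.add_apply, ← Finset.sum_add_distrib]
  exact Finset.sum_congr rfl fun _ _ => Finset.sum_congr rfl fun _ _ =>
    Finset.sum_congr rfl fun _ _ => by ring

end RiemannVec

namespace MetricOn

variable {h : Coord n → Matrix (Fin n) (Fin n) ℝ} {W : Set (Coord n)} {x : Coord n}

theorem mapOn_id (H : MetricOn h W) : MapOn h W id W where
  metric := H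
  isOpen := H.isOpen
  smooth a := contDiffOn_euclidean.1 contDiffOn_id a
  mapsTo _ hx := hx

theorem dmapDir_id (X : Fin n → ℝ) (x : Coord n) :
    dmapDir (id : Coord n → Coord n) (WithLp.toLp 2 X) x = X := by
  funext a
  have := (PiLp.hasFDerivAt_apply (𝕜 := ℝ) 2 x a).fderiv
  exact congrArg (fun L => L (WithLp.toLp 2 X)) this

theorem smoothField_const (v : Fin n → ℝ) : SmoothField (fun _ : Coord n => v) W :=
  fun _ => contDiffOn_const

/-- The commutator form of the curvature, along the identity map and in constant directions. The
algebraic symmetries are read off from it. -/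
theorem riemannVec_eq (H : MetricOn h W) (hx : x ∈ W) (X Y Z : Fin n → ℝ) :
    riemannVec h x X Y Z
      = covDir h id (WithLp.toLp 2 X) (covDir h id (WithLp.toLp 2 Y) fun _ => Z) x
        - covDir h id (WithLp.toLp 2 Y) (covDir h id (WithLp.toLp 2 X) fun _ => Z) x := by
  rw [H.mapOn_id.covDir_covDir_sub hx (smoothField_const Z), dmapDir_id, dmapDir_id]
  rfl

theorem riemannVec_skew (H : MetricOn h W) (hx : x ∈ W) (X Y Z : Fin n → ℝ) :
    riemannVec h x X Y Z = - riemannVec h x Y X Z := by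
  rw [H.riemannVec_eq hx, H.riemannVec_eq hx, neg_sub]

/-- For fields with constant components torsion-freeness reads ∇_Y Z = ∇_Z Y, so the six second
derivatives cancel in pairs. -/
theorem riemannVec_bianchi (H : MetricOn h W) (hx : x ∈ W) (X Y Z : Fin n → ℝ) :
    riemannVec h x X Y Z + riemannVec h x Y Z X + riemannVec h x Z X Y = 0 := by
  have key : ∀ X Y Z : Fin n → ℝ,
      covDir h id (WithLp.toLp 2 X) (covDir h id (WithLp.toLp 2 Y) fun _ => Z) x
        = covDir h id (WithLp.toLp 2 X) (covDir h id (WithLp.toLp 2 Z) fun _ => Y) x := by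
    intro X Y Z
    refine H.mapOn_id.covDir_congr hx fun y hy => ?_
    have := H.mapOn_id.covDir_dmapDir_comm hy (X := WithLp.toLp 2 Y) (Y := WithLp.toLp 2 Z)
    have e : ∀ Z : Fin n → ℝ, dmapDir (id : Coord n → Coord n) (WithLp.toLp 2 Z) = fun _ => Z :=
      fun Z => funext fun x => dmapDir_id Z x
    rwa [e, e] at this
  rw [H.riemannVec_eq hx, H.riemannVec_eq hx, H.riemannVec_eq hx, key X Y Z, key Y Z X, key Z X Y]
  abel

/-- Second derivatives of the function ⟨Z, V⟩ commute, for Z and V with constant components. Metric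
compatibility expands them into the two curvature terms and terms symmetric in X and Y. -/
theorem dot_riemannVec_skew (H : MetricOn h W) (hx : x ∈ W) (X Y Z V : Fin n → ℝ) :
    dot (h x) (riemannVec h x X Y Z) V = - dot (h x) (riemannVec h x X Y V) Z := by
  have M := H.mapOn_id
  have sZ := smoothField_const (W := W) Z
  have sV := smoothField_const (W := W) V
  have key : ∀ X Y : Coord n, dd X (dd Y (fun y => dot (h y) Z V)) x
      = dot (h x) (covDir h id X (covDir h id Y fun _ => Z) x) V
        + dot (h x) (covDir h id Y (fun _ => Z) x) (covDir h id X (fun _ => V) x)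
        + (dot (h x) (covDir h id X (fun _ => Z) x) (covDir h id Y (fun _ => V) x)
          + dot (h x) Z (covDir h id X (covDir h id Y fun _ => V) x)) := by
    intro X Y
    have e1 : ∀ y ∈ W, dd Y (fun y => dot (h y) Z V) y
        = dot (h y) (covDir h id Y (fun _ => Z) y) V
          + dot (h y) Z (covDir h id Y (fun _ => V) y) := fun y hy => M.dd_dot hy sZ sV
    have s1 := M.smooth_dot (M.smooth_covDir sZ (X := Y)) sV
    have s2 := M.smooth_dot sZ (M.smooth_covDir sV (X := Y))
    rw [dd_congr H.isOpen hx e1]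
    refine (dd_add (diffAt_of_smooth H.isOpen hx s1) (diffAt_of_smooth H.isOpen hx s2)).trans ?_
    congr 1
    · exact M.dd_dot hx (M.smooth_covDir sZ) sV
    · exact M.dd_dot hx sZ (M.smooth_covDir sV)
  have hcomm := dd_comm (X := WithLp.toLp 2 X) (Y := WithLp.toLp 2 Y) H.isOpen hx
    (M.smooth_dot sZ sV)
  change dd _ (dd _ (fun y => dot (h y) Z V)) x = dd _ (dd _ (fun y => dot (h y) Z V)) x at hcomm
  rw [key, key] at hcomm
  rw [H.riemannVec_eq hx, H.riemannVec_eq hx, dot_sub_left, dot_sub_left,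
    dot_comm _ Z (H.isSymm hx), dot_comm _ Z (H.isSymm hx)]
  linarith

/-- The curvature tensor of a metric of constant sectional curvature. -/
theorem riemannVec_of_const (H : MetricOn h W) (hx : x ∈ W) {c : ℝ}
    (hc : ∀ X Y : Fin n → ℝ, dot (h x) (riemannVec h x X Y Y) X
      = c * (dot (h x) X X * dot (h x) Y Y - dot (h x) X Y ^ 2)) (X Y Z : Fin n → ℝ) :
    riemannVec h x X Y Z = c • (dot (h x) Y Z • X - dot (h x) X Z • Y) := by
  have sym := fun u v => dot_comm (G := h x) u v (H.isSymm hx)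
  -- The difference between R and the constant curvature model has the symmetries of a curvature
  -- tensor and vanishing sectional values.
  have key := curvature_polarization (fun X Y Z V => dot (h x) (riemannVec h x X Y Z) V
    - c * (dot (h x) Y Z * dot (h x) X V - dot (h x) X Z * dot (h x) Y V))
    (by intros; simp only [riemannVec_add₁, dot_add_left]; ring)
    (by intros; simp only [riemannVec_add₂, dot_add_left]; ring)
    (by intros; simp only [riemannVec_add₃, dot_add_left, dot_add_right]; ring)
    (by intros; simp only [dot_add_right]; ring)
    (by intro X Y Z V; rw [H.riemannVec_skew hx X Y, dot_neg_left]; ring)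
    (by intro X Y Z V; rw [H.dot_riemannVec_skew hx X Y Z]; ring)
    (by
      intro X Y Z V
      have := congrArg (fun u => dot (h x) u V) (H.riemannVec_bianchi hx X Y Z)
      simp only [dot_add_left, dot_zero_left] at this
      rw [sym Y Z, sym X Z, sym Y X]
      linarith)
    (by
      intro X Y
      rw [hc, sym Y X]; ring)
  have h0 : riemannVec h x X Y Z - c • (dot (h x) Y Z • X - dot (h x) X Z • Y) = 0 := by
    refine eq_zero_of_dot_self _ (H.posDef x hx) ?_
    have := key X Y Z (riemannVec h x X Y Z - c • (dot (h x) Y Z • X - dot (h x) X Z • Y))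
    rw [dot_sub_left, dot_smul_left, dot_sub_left, dot_smul_left, dot_smul_left]
    exact this
  exact sub_eq_zero.1 h0

end MetricOn

end Coord

end

noncomputable section

namespace Coord

variable {m n : ℕ}

/-! ### Isometric immersions -/

/-- `Φ` is an isometric immersion of the open set `U` with the metric `g` into the open set `W`
with the metric `h`. -/
structure IsometricOn (g : Coord m → Matrix (Fin m) (Fin m) ℝ)
    (h : Coord n → Matrix (Fin n) (Fin n) ℝ) (W : Set (Coord n))
    (Φ : Coord m → Coord n) (U : Set (Coord m)) : Prop extends MapOn h W Φ U where
  posDef : ∀ x ∈ U, (g x).PosDef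
  isometric : ∀ x ∈ U, ∀ i j, g x i j = dot (h (Φ x)) (dmap Φ i x) (dmap Φ j x)

theorem secondFundForm_eq (g : Coord m → Matrix (Fin m) (Fin m) ℝ)
    (h : Coord n → Matrix (Fin n) (Fin n) ℝ) (Φ : Coord m → Coord n) (i j : Fin m)
    (x : Coord m) : secondFundForm g h Φ i j x
      = covAlong h Φ (dmap Φ j) i x - ∑ k, christoffel g k i j x • dmap Φ k x := by
  funext a
  simp [secondFundForm, Finset.sum_apply]

theorem tension_eq_sum (g : Coord m → Matrix (Fin m) (Fin m) ℝ)
    (h : Coord n → Matrix (Fin n) (Fin n) ℝ) (Φ : Coord m → Coord n) (x : Coord m) :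
    tension g h Φ x = ∑ i, ∑ j, (g x)⁻¹ i j • secondFundForm g h Φ i j x := by
  funext a
  simp [tension, Finset.sum_apply]

theorem bitension_eq_sum (g : Coord m → Matrix (Fin m) (Fin m) ℝ)
    (h : Coord n → Matrix (Fin n) (Fin n) ℝ) (Φ : Coord m → Coord n) (x : Coord m) :
    bitension g h Φ x = ∑ i, ∑ j, (g x)⁻¹ i j •
      (covAlong h Φ (covAlong h Φ (tension g h Φ) j) i x
        - ∑ k, christoffel g k i j x • covAlong h Φ (tension g h Φ) k x
        - riemannVec h (Φ x) (dmap Φ i x) (tension g h Φ x) (dmap Φ j x)) := by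
  funext a
  simp [bitension, roughLaplacian, Finset.sum_apply, mul_sub, Finset.sum_sub_distrib]

namespace IsometricOn

variable {g : Coord m → Matrix (Fin m) (Fin m) ℝ}
  {h : Coord n → Matrix (Fin n) (Fin n) ℝ} {W : Set (Coord n)}
  {Φ : Coord m → Coord n} {U : Set (Coord m)} {x : Coord m}

theorem restrict {U' : Set (Coord m)} (H : IsometricOn g h W Φ U) (hU : U' ⊆ U)
    (ho : IsOpen U') : IsometricOn g h W Φ U' :=
  ⟨H.toMapOn.mono hU ho, fun x hx => H.posDef x (hU hx), fun x hx => H.isometric x (hU hx)⟩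

theorem smooth_dmap (H : IsometricOn g h W Φ U) (i : Fin m) : SmoothField (dmap Φ i) U :=
  H.toMapOn.smooth_dmapDir

theorem metricOn (H : IsometricOn g h W Φ U) : MetricOn g U where
  isOpen := H.isOpen
  smooth i j := (H.smooth_dot (H.smooth_dmap i) (H.smooth_dmap j)).congr
    fun x hx => H.isometric x hx i j
  posDef := H.posDef

/-- Koszul's formula. With Tᵢ = dΦ(∂ᵢ) and gᵢⱼ = ⟨Tᵢ, Tⱼ⟩, compatibility and torsion-freeness make
the left side the same combination of derivatives of g as the lowered Christoffel symbol. -/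
theorem dot_covAlong_dmap (H : IsometricOn g h W Φ U) (hx : x ∈ U) (i j k : Fin m) :
    dot (h (Φ x)) (covAlong h Φ (dmap Φ j) i x) (dmap Φ k x)
      = ∑ l, g x k l * christoffel g l i j x := by
  rw [H.metricOn.lower_christoffel hx]
  have sym := fun u v => dot_comm (G := h (Φ x)) u v (H.isSymm hx)
  have key : ∀ i j k, pd i (fun z => g z j k) x
      = dot (h (Φ x)) (covAlong h Φ (dmap Φ j) i x) (dmap Φ k x)
        + dot (h (Φ x)) (covAlong h Φ (dmap Φ k) i x) (dmap Φ j x) := by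
    intro i j k
    rw [pd_eq_dd, dd_congr H.isOpen hx fun y hy => H.isometric y hy j k,
      H.dd_dot hx (H.smooth_dmap j) (H.smooth_dmap k), sym (dmap Φ j x), covAlong_eq, covAlong_eq]
  have tor : ∀ i j, covAlong h Φ (dmap Φ j) i x = covAlong h Φ (dmap Φ i) j x := by
    intro i j
    rw [covAlong_eq, covAlong_eq]
    exact H.toMapOn.covDir_dmapDir_comm hx
  rw [key i j k, key j i k, key k i j, tor j i, tor k i, tor k j]
  ring

/-- The second fundamental form of an isometric immersion is normal. -/
theorem dot_secondFundForm_dmap (H : IsometricOn g h W Φ U) (hx : x ∈ U) (i j k : Fin m) :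
    dot (h (Φ x)) (secondFundForm g h Φ i j x) (dmap Φ k x) = 0 := by
  rw [secondFundForm_eq, dot_sub_left, H.dot_covAlong_dmap hx, dot_sum_left, sub_eq_zero]
  refine Finset.sum_congr rfl fun l _ => ?_
  rw [dot_smul_left, ← H.isometric x hx, (H.metricOn.isSymm hx).apply, mul_comm]

theorem dot_tension_dmap (H : IsometricOn g h W Φ U) (hx : x ∈ U) (k : Fin m) :
    dot (h (Φ x)) (tension g h Φ x) (dmap Φ k x) = 0 := by
  rw [tension_eq_sum, dot_sum_left]
  refine Finset.sum_eq_zero fun i _ => ?_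
  rw [dot_sum_left]
  refine Finset.sum_eq_zero fun j _ => ?_
  rw [dot_smul_left, H.dot_secondFundForm_dmap hx, mul_zero]

theorem smooth_tension (H : IsometricOn g h W Φ U) : SmoothField (tension g h Φ) U := by
  rw [show tension g h Φ = fun x => _ from funext fun x => tension_eq_sum g h Φ x]
  refine SmoothField.sum fun i _ => SmoothField.sum fun j _ =>
    SmoothField.smul (H.metricOn.smooth_inv i j) ?_
  rw [show secondFundForm g h Φ i j = fun x => _ from
    funext fun x => secondFundForm_eq g h Φ i j x, covAlong_eq]
  exact (H.smooth_covDir (H.smooth_dmap j)).sub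
    (SmoothField.sum fun k _ =>
      SmoothField.smul (H.metricOn.smooth_christoffel k i j) (H.smooth_dmap k))

end IsometricOn

/-! ### Hypersurfaces of spaces of constant curvature -/

/-- `Φ` is an isometric immersion of a hypersurface into a space of constant curvature `c`, with
the unit normal field `η` and the tension field `F η`. -/
structure HypersurfaceOn (c : ℝ) (g : Coord m → Matrix (Fin m) (Fin m) ℝ)
    (h : Coord (m + 1) → Matrix (Fin (m + 1)) (Fin (m + 1)) ℝ) (W : Set (Coord (m + 1)))
    (Φ : Coord m → Coord (m + 1)) (U : Set (Coord m)) (F : Coord m → ℝ)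
    (η : Coord m → Fin (m + 1) → ℝ) : Prop extends IsometricOn g h W Φ U where
  curvature : ∀ y ∈ W, ∀ X Y Z : Fin (m + 1) → ℝ,
    riemannVec h y X Y Z = c • (dot (h y) Y Z • X - dot (h y) X Z • Y)
  smooth_F : ContDiffOn ℝ ∞ F U
  smooth_normal : SmoothField η U
  unit : ∀ x ∈ U, dot (h (Φ x)) (η x) (η x) = 1
  normal : ∀ x ∈ U, ∀ i, dot (h (Φ x)) (η x) (dmap Φ i x) = 0
  tension_eq : ∀ x ∈ U, tension g h Φ x = F x • η x

namespace HypersurfaceOn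

variable {c : ℝ} {g : Coord m → Matrix (Fin m) (Fin m) ℝ}
  {h : Coord (m + 1) → Matrix (Fin (m + 1)) (Fin (m + 1)) ℝ} {W : Set (Coord (m + 1))}
  {Φ : Coord m → Coord (m + 1)} {U : Set (Coord m)} {F : Coord m → ℝ}
  {η : Coord m → Fin (m + 1) → ℝ} {x : Coord m} {X Y : Coord m}

theorem restrictTo {U' : Set (Coord m)} (H : HypersurfaceOn c g h W Φ U F η) (hU : U' ⊆ U)
    (ho : IsOpen U') : HypersurfaceOn c g h W Φ U' F η :=
  ⟨H.toIsometricOn.restrict hU ho, H.curvature, H.smooth_F.mono hU, H.smooth_normal.mono hU,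
    fun x hx => H.unit x (hU hx), fun x hx => H.normal x (hU hx),
    fun x hx => H.tension_eq x (hU hx)⟩

theorem sym (H : HypersurfaceOn c g h W Φ U F η) (hx : x ∈ U) (u v : Fin (m + 1) → ℝ) :
    dot (h (Φ x)) u v = dot (h (Φ x)) v u := dot_comm u v (H.isSymm hx)

theorem normalDir (H : HypersurfaceOn c g h W Φ U F η) (hx : x ∈ U) (X : Coord m) :
    dot (h (Φ x)) (η x) (dmapDir Φ X x) = 0 := by
  rw [dmapDir_eq_sum, dot_sum_right]
  exact Finset.sum_eq_zero fun i _ => by rw [dot_smul_right, H.normal x hx, mul_zero]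

/-- The vector `t η + ∑ gⁱʲ rⱼ Tᵢ` has the components `t` and `rₖ`. -/
theorem dot_combination (H : HypersurfaceOn c g h W Φ U F η) (hx : x ∈ U) (t : ℝ)
    (r : Fin m → ℝ) :
    dot (h (Φ x)) (t • η x + ∑ i, ∑ j, ((g x)⁻¹ i j * r j) • dmap Φ i x) (η x) = t ∧
    ∀ k, dot (h (Φ x)) (t • η x + ∑ i, ∑ j, ((g x)⁻¹ i j * r j) • dmap Φ i x) (dmap Φ k x)
      = r k := by
  constructor
  · rw [dot_add_left, dot_smul_left, H.unit x hx, mul_one, dot_sum_left,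
      Finset.sum_eq_zero, add_zero]
    intro i _
    rw [dot_sum_left, Finset.sum_eq_zero]
    intro j _
    rw [dot_smul_left, H.sym hx, H.normal x hx, mul_zero]
  · intro k
    rw [dot_add_left, dot_smul_left, H.normal x hx, mul_zero, zero_add, dot_sum_left]
    have : ∀ i, dot (h (Φ x)) (∑ j, ((g x)⁻¹ i j * r j) • dmap Φ i x) (dmap Φ k x)
        = ∑ j, g x k i * (g x)⁻¹ i j * r j := by
      intro i
      rw [dot_sum_left]
      refine Finset.sum_congr rfl fun j _ => ?_
      rw [dot_smul_left, ← H.isometric x hx, (H.metricOn.isSymm hx).apply]; ring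
    simp only [this]
    rw [Finset.sum_comm]
    simp only [← Finset.sum_mul, ← Matrix.mul_apply, H.metricOn.mul_inv hx, Matrix.one_apply]
    simp

/-- Vectors along a hypersurface are determined by their tangential and normal components. -/
theorem ext_dot (H : HypersurfaceOn c g h W Φ U F η) (hx : x ∈ U) {u v : Fin (m + 1) → ℝ}
    (hη : dot (h (Φ x)) u (η x) = dot (h (Φ x)) v (η x))
    (hT : ∀ i, dot (h (Φ x)) u (dmap Φ i x) = dot (h (Φ x)) v (dmap Φ i x)) : u = v := by
  -- The components with respect to η and the Tᵢ form a linear map from ℝᵐ⁺¹ to ℝᵐ⁺¹. It is onto by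
  -- `dot_combination`, hence injective; this is where codimension one is used.
  let L : (Fin (m + 1) → ℝ) →ₗ[ℝ] (Fin (m + 1) → ℝ) :=
    { toFun := fun w => Fin.cons (dot (h (Φ x)) w (η x)) fun i => dot (h (Φ x)) w (dmap Φ i x)
      map_add' := by
        intro a b
        funext i
        refine Fin.cases ?_ (fun i => ?_) i <;> simp [dot_add_left]
      map_smul' := by
        intro a b
        funext i
        refine Fin.cases ?_ (fun i => ?_) i <;> simp [dot_smul_left] }
  have hs : Function.Surjective L := by
    intro r
    obtain ⟨h1, h2⟩ := H.dot_combination hx (r 0) fun i => r i.succ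
    refine ⟨(r 0) • η x + ∑ i, ∑ j, ((g x)⁻¹ i j * r j.succ) • dmap Φ i x, funext fun i => ?_⟩
    refine Fin.cases ?_ (fun i => ?_) i
    · exact h1
    · exact h2 i
  refine LinearMap.injective_iff_surjective.2 hs (funext fun i => ?_)
  refine Fin.cases ?_ (fun i => ?_) i
  · exact hη
  · exact hT i

/-- A vector u ⟂ η equals its tangential expansion ∑ gⁱʲ ⟨u, Tⱼ⟩ Tᵢ, so nothing is required of v. -/
theorem dot_tangent (H : HypersurfaceOn c g h W Φ U F η) (hx : x ∈ U) {u : Fin (m + 1) → ℝ}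
    (hu : dot (h (Φ x)) u (η x) = 0) (v : Fin (m + 1) → ℝ) :
    dot (h (Φ x)) u v
      = ∑ i, ∑ j, (g x)⁻¹ i j * dot (h (Φ x)) u (dmap Φ j x) * dot (h (Φ x)) (dmap Φ i x) v := by
  obtain ⟨h1, h2⟩ := H.dot_combination hx 0 fun j => dot (h (Φ x)) u (dmap Φ j x)
  have := H.ext_dot hx (hu.trans h1.symm) fun i => (h2 i).symm
  conv_lhs => rw [this]
  simp only [zero_smul, zero_add, dot_sum_left, dot_smul_left]

theorem dot_covDir_normal (H : HypersurfaceOn c g h W Φ U F η) (hx : x ∈ U) (X : Coord m) :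
    dot (h (Φ x)) (covDir h Φ X η x) (η x) = 0 := by
  have h1 := H.dd_dot hx H.smooth_normal H.smooth_normal (X := X)
  rw [dd_eq_zero_of_const H.isOpen hx H.unit, H.sym hx (η x)] at h1
  linarith

/-- Differentiate ⟨η, dΦ(Y)⟩ = 0. This is the Weingarten relation ∇η = -A. -/
theorem dot_covDir_normal_dmapDir (H : HypersurfaceOn c g h W Φ U F η) (hx : x ∈ U)
    (X Y : Coord m) : dot (h (Φ x)) (covDir h Φ X η x) (dmapDir Φ Y x)
      = - dot (h (Φ x)) (η x) (covDir h Φ X (dmapDir Φ Y) x) := by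
  have h1 := H.dd_dot hx H.smooth_normal (H.smooth_dmapDir (X := Y)) (X := X)
  rw [dd_eq_zero_of_const H.isOpen hx (fun y hy => H.normalDir hy Y)] at h1
  linarith

/-- The second fundamental form is symmetric. -/
theorem dot_covDir_normal_symm (H : HypersurfaceOn c g h W Φ U F η) (hx : x ∈ U)
    (X Y : Coord m) : dot (h (Φ x)) (covDir h Φ X η x) (dmapDir Φ Y x)
      = dot (h (Φ x)) (covDir h Φ Y η x) (dmapDir Φ X x) := by
  rw [H.dot_covDir_normal_dmapDir hx, H.dot_covDir_normal_dmapDir hx, H.covDir_dmapDir_comm hx]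

/-- The Codazzi equation. -/
theorem codazzi (H : HypersurfaceOn c g h W Φ U F η) (hx : x ∈ U) (X Y : Coord m) :
    covDir h Φ X (covDir h Φ Y η) x = covDir h Φ Y (covDir h Φ X η) x := by
  have h1 := H.covDir_covDir_sub hx H.smooth_normal (X := X) (Y := Y)
  -- In constant curvature R(X, Y)η = c(⟨Y, η⟩X - ⟨X, η⟩Y), which vanishes for tangent X and Y.
  rw [H.curvature _ (H.mapsTo x hx), H.sym hx _ (η x), H.sym hx _ (η x), H.normalDir hx,
    H.normalDir hx] at h1
  simpa [sub_eq_zero] using h1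

/-- The scalar product of τ = trace B with η is trace A. The Christoffel terms of the second
fundamental form are tangential and do not contribute. -/
theorem F_eq (H : HypersurfaceOn c g h W Φ U F η) (hx : x ∈ U) :
    F x = - ∑ i, ∑ j, (g x)⁻¹ i j * dot (h (Φ x)) (covAlong h Φ η i x) (dmap Φ j x) := by
  have h1 : F x = dot (h (Φ x)) (tension g h Φ x) (η x) := by
    rw [H.tension_eq x hx, dot_smul_left, H.unit x hx, mul_one]
  rw [h1, tension_eq_sum, dot_sum_left, ← Finset.sum_neg_distrib]
  refine Finset.sum_congr rfl fun i _ => ?_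
  rw [dot_sum_left, ← Finset.sum_neg_distrib]
  refine Finset.sum_congr rfl fun j _ => ?_
  rw [dot_smul_left, secondFundForm_eq, dot_sub_left, dot_sum_left, Finset.sum_eq_zero,
    covAlong_eq, covAlong_eq, dmap_eq, H.dot_covDir_normal_dmapDir hx, H.sym hx _ (η x)]
  · ring
  · intro k _
    rw [dot_smul_left, H.sym hx, H.normal x hx, mul_zero]

end HypersurfaceOn

end Coord

end

noncomputable section

namespace Coord

variable {m n : ℕ}

/-! ### The biharmonic equation of a hypersurface -/

/-- Relabelling of indices for `divergence_weingarten`, where P is the inverse metric, β is ⟨∇ᵢη,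
Tⱼ⟩ and C is ⟨∇ₗTᵢ, Tₚ⟩. It matches the derivative terms of the frame on the two sides. -/
theorem trace_four_comm {P β C : Fin m → Fin m → ℝ} (hP : ∀ i j, P i j = P j i)
    (hβ : ∀ i j, β i j = β j i) :
    ∑ i, ∑ j, P i j * ∑ p, ∑ q, P p q * β j q * C i p
      = ∑ i, ∑ p, ∑ q, P p q * β i q * ∑ j, P i j * C p j := by
  have h1 : ∀ i p, ∑ q, P p q * β i q * ∑ j, P i j * C p j
      = ∑ q, ∑ j, P p q * β i q * (P i j * C p j) := fun i p =>
    Finset.sum_congr rfl fun q _ => Finset.mul_sum _ _ _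
  have h2 : ∀ i j, P i j * ∑ p, ∑ q, P p q * β j q * C i p
      = ∑ q, ∑ p, P i j * (P p q * β j q * C i p) := by
    intro i j
    rw [Finset.sum_comm]
    simp only [Finset.mul_sum]
  simp only [h1, h2]
  conv_rhs => rw [Finset.sum_comm]
  refine Finset.sum_congr rfl fun i _ => ?_
  conv_rhs => rw [Finset.sum_comm]
  refine Finset.sum_congr rfl fun j _ => Finset.sum_congr rfl fun q _ =>
    Finset.sum_congr rfl fun p _ => ?_
  rw [hP p q, hβ j q]; ring

namespace HypersurfaceOn

variable {c : ℝ} {g : Coord m → Matrix (Fin m) (Fin m) ℝ}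
  {h : Coord (m + 1) → Matrix (Fin (m + 1)) (Fin (m + 1)) ℝ} {W : Set (Coord (m + 1))}
  {Φ : Coord m → Coord (m + 1)} {U : Set (Coord m)} {F : Coord m → ℝ}
  {η : Coord m → Fin (m + 1) → ℝ} {x : Coord m} {X Y : Coord m}

theorem inv_symm (H : HypersurfaceOn c g h W Φ U F η) (hx : x ∈ U) (i j : Fin m) :
    (g x)⁻¹ i j = (g x)⁻¹ j i := by
  have := Matrix.transpose_nonsing_inv (g x)
  rw [(H.metricOn.isSymm hx).eq] at this
  exact congrFun (congrFun this j) i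

theorem smooth_covAlong (H : HypersurfaceOn c g h W Φ U F η) (i : Fin m) :
    SmoothField (covAlong h Φ η i) U := by
  rw [covAlong_eq]; exact H.smooth_covDir H.smooth_normal

theorem pd_dot (H : HypersurfaceOn c g h W Φ U F η) (hx : x ∈ U) (i : Fin m)
    {V₁ V₂ : Coord m → Fin (m + 1) → ℝ} (h₁ : SmoothField V₁ U) (h₂ : SmoothField V₂ U) :
    pd i (fun y => dot (h (Φ y)) (V₁ y) (V₂ y)) x
      = dot (h (Φ x)) (covAlong h Φ V₁ i x) (V₂ x)
        + dot (h (Φ x)) (V₁ x) (covAlong h Φ V₂ i x) := by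
  rw [covAlong_eq, covAlong_eq]; exact H.dd_dot hx h₁ h₂

theorem covAlong_dmap_comm (H : HypersurfaceOn c g h W Φ U F η) (hx : x ∈ U) (i j : Fin m) :
    covAlong h Φ (dmap Φ j) i x = covAlong h Φ (dmap Φ i) j x := by
  rw [covAlong_eq, covAlong_eq]; exact H.covDir_dmapDir_comm hx

theorem covAlong_normal_symm (H : HypersurfaceOn c g h W Φ U F η) (hx : x ∈ U) (i j : Fin m) :
    dot (h (Φ x)) (covAlong h Φ η i x) (dmap Φ j x)
      = dot (h (Φ x)) (covAlong h Φ η j x) (dmap Φ i x) := by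
  rw [covAlong_eq, covAlong_eq]; exact H.dot_covDir_normal_symm hx _ _

theorem dot_covAlong_normal (H : HypersurfaceOn c g h W Φ U F η) (hx : x ∈ U) (i : Fin m) :
    dot (h (Φ x)) (covAlong h Φ η i x) (η x) = 0 := by
  rw [covAlong_eq]; exact H.dot_covDir_normal hx _

theorem codazzi_index (H : HypersurfaceOn c g h W Φ U F η) (hx : x ∈ U) (i j : Fin m) :
    covAlong h Φ (covAlong h Φ η j) i x = covAlong h Φ (covAlong h Φ η i) j x := by
  simp only [covAlong_eq]; exact H.codazzi hx _ _

/-- The trace is written as -∑ ⟨∇ᵢη, T'ᵢ⟩ with the dual frame T'ᵢ = ∑ gⁱʲTⱼ. The derivative of T'ᵢ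
is then found from the constancy of ⟨Tₚ, T'ᵢ⟩, without differentiating the inverse metric. -/
theorem pd_F_eq (H : HypersurfaceOn c g h W Φ U F η) (hx : x ∈ U) (l : Fin m) :
    pd l F x = - ∑ i, ∑ j, (g x)⁻¹ i j *
        dot (h (Φ x)) (covAlong h Φ (covAlong h Φ η i) l x) (dmap Φ j x)
      + ∑ i, ∑ p, ∑ q, (g x)⁻¹ p q * dot (h (Φ x)) (covAlong h Φ η i x) (dmap Φ q x) *
        ∑ j, (g x)⁻¹ i j * dot (h (Φ x)) (covAlong h Φ (dmap Φ p) l x) (dmap Φ j x) := by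
  set T' : Fin m → Coord m → Fin (m + 1) → ℝ := fun i y => ∑ j, (g y)⁻¹ i j • dmap Φ j y with hT'
  have sT' : ∀ i, SmoothField (T' i) U := fun i =>
    SmoothField.sum fun j _ => SmoothField.smul (H.metricOn.smooth_inv i j) (H.smooth_dmap j)
  have dT' : ∀ i (y) (u : Fin (m + 1) → ℝ), dot (h (Φ y)) u (T' i y)
      = ∑ j, (g y)⁻¹ i j * dot (h (Φ y)) u (dmap Φ j y) := by
    intro i y u
    simp only [hT', dot_sum_right, dot_smul_right]
  have hF : ∀ y ∈ U, F y = - ∑ i, dot (h (Φ y)) (covAlong h Φ η i y) (T' i y) := by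
    intro y hy
    simp only [H.F_eq hy, dT']
  have hdual : ∀ p i, dot (h (Φ x)) (dmap Φ p x) (covAlong h Φ (T' i) l x)
      = - ∑ j, (g x)⁻¹ i j * dot (h (Φ x)) (covAlong h Φ (dmap Φ p) l x) (dmap Φ j x) := by
    intro p i
    have h0 : pd l (fun y => dot (h (Φ y)) (dmap Φ p y) (T' i y)) x = 0 := by
      refine dd_eq_zero_of_const H.isOpen hx (c := (1 : Matrix (Fin m) (Fin m) ℝ) i p)
        fun y hy => ?_
      rw [dT', ← H.metricOn.inv_mul hy, Matrix.mul_apply]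
      refine Finset.sum_congr rfl fun j _ => ?_
      rw [← H.isometric y hy, (H.metricOn.isSymm hy).apply]
    rw [H.pd_dot hx l (H.smooth_dmap p) (sT' i), dT'] at h0
    linarith
  have hd : ∀ i, DifferentiableAt ℝ (fun y => dot (h (Φ y)) (covAlong h Φ η i y) (T' i y)) x :=
    fun i => diffAt_of_smooth H.isOpen hx (H.smooth_dot (H.smooth_covAlong i) (sT' i))
  rw [pd_eq_dd, dd_congr H.isOpen hx hF, dd_neg, dd_sum fun i _ => hd i]
  have : ∀ i, dd (EuclideanSpace.single l 1)
      (fun y => dot (h (Φ y)) (covAlong h Φ η i y) (T' i y)) x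
      = dot (h (Φ x)) (covAlong h Φ (covAlong h Φ η i) l x) (T' i x)
        + dot (h (Φ x)) (covAlong h Φ η i x) (covAlong h Φ (T' i) l x) :=
    fun i => H.pd_dot hx l (H.smooth_covAlong i) (sT' i)
  rw [Finset.sum_congr rfl fun i _ => this i, Finset.sum_add_distrib, neg_add]
  simp only [dT']
  congr 1
  rw [← Finset.sum_neg_distrib]
  refine Finset.sum_congr rfl fun i _ => ?_
  rw [H.dot_tangent hx (H.dot_covAlong_normal hx i), ← Finset.sum_neg_distrib]
  refine Finset.sum_congr rfl fun p _ => ?_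
  rw [← Finset.sum_neg_distrib]
  refine Finset.sum_congr rfl fun q _ => ?_
  rw [hdual]; ring

/-- The divergence of the Weingarten operator is the gradient of its trace. -/
theorem divergence_weingarten (H : HypersurfaceOn c g h W Φ U F η) (hx : x ∈ U) (l : Fin m) :
    ∑ i, ∑ j, (g x)⁻¹ i j *
      (dot (h (Φ x)) (covAlong h Φ (covAlong h Φ η j) i x) (dmap Φ l x)
        - ∑ k, christoffel g k i j x * dot (h (Φ x)) (covAlong h Φ η k x) (dmap Φ l x))
      = - pd l F x := by
  have h1 : ∀ i j, dot (h (Φ x)) (covAlong h Φ η l x) (covAlong h Φ (dmap Φ j) i x)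
      = ∑ k, christoffel g k i j x * dot (h (Φ x)) (covAlong h Φ η k x) (dmap Φ l x) := by
    intro i j
    have e : covAlong h Φ (dmap Φ j) i x
        = secondFundForm g h Φ i j x + ∑ k, christoffel g k i j x • dmap Φ k x := by
      rw [secondFundForm_eq]; abel
    rw [e, dot_add_right, H.dot_tangent hx (H.dot_covAlong_normal hx l)]
    simp only [H.sym hx _ (secondFundForm g h Φ i j x), H.dot_secondFundForm_dmap hx, mul_zero,
      Finset.sum_const_zero, zero_add, dot_sum_right, dot_smul_right]
    exact Finset.sum_congr rfl fun k _ => by rw [H.covAlong_normal_symm hx l k]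
  -- Differentiate the symmetry ⟨∇ⱼη, Tₗ⟩ = ⟨∇ₗη, Tⱼ⟩ in the direction i, then exchange ∇ᵢ and ∇ₗ on
  -- η by the Codazzi equation.
  have h2 : ∀ i j, dot (h (Φ x)) (covAlong h Φ (covAlong h Φ η j) i x) (dmap Φ l x)
      = dot (h (Φ x)) (covAlong h Φ (covAlong h Φ η i) l x) (dmap Φ j x)
        + dot (h (Φ x)) (covAlong h Φ η l x) (covAlong h Φ (dmap Φ j) i x)
        - dot (h (Φ x)) (covAlong h Φ η j x) (covAlong h Φ (dmap Φ i) l x) := by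
    intro i j
    have e1 := H.pd_dot hx i (H.smooth_covAlong j) (H.smooth_dmap l)
    have e2 := H.pd_dot hx i (H.smooth_covAlong l) (H.smooth_dmap j)
    have e3 : pd i (fun y => dot (h (Φ y)) (covAlong h Φ η j y) (dmap Φ l y)) x
        = pd i (fun y => dot (h (Φ y)) (covAlong h Φ η l y) (dmap Φ j y)) x :=
      dd_congr H.isOpen hx fun y hy => H.covAlong_normal_symm hy j l
    rw [H.codazzi_index hx l i, H.covAlong_dmap_comm hx l i]
    linarith
  have h3 : ∀ i j, dot (h (Φ x)) (covAlong h Φ η j x) (covAlong h Φ (dmap Φ i) l x)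
      = ∑ p, ∑ q, (g x)⁻¹ p q * dot (h (Φ x)) (covAlong h Φ η j x) (dmap Φ q x)
        * dot (h (Φ x)) (covAlong h Φ (dmap Φ i) l x) (dmap Φ p x) := by
    intro i j
    rw [H.dot_tangent hx (H.dot_covAlong_normal hx j)]
    simp only [H.sym hx (dmap Φ _ x) (covAlong h Φ (dmap Φ i) l x)]
  have h4 : ∀ i j, dot (h (Φ x)) (covAlong h Φ (covAlong h Φ η j) i x) (dmap Φ l x)
        - ∑ k, christoffel g k i j x * dot (h (Φ x)) (covAlong h Φ η k x) (dmap Φ l x)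
      = dot (h (Φ x)) (covAlong h Φ (covAlong h Φ η i) l x) (dmap Φ j x)
        - ∑ p, ∑ q, (g x)⁻¹ p q * dot (h (Φ x)) (covAlong h Φ η j x) (dmap Φ q x)
        * dot (h (Φ x)) (covAlong h Φ (dmap Φ i) l x) (dmap Φ p x) := by
    intro i j
    rw [h2, h1, h3]; ring
  simp only [h4, mul_sub, Finset.sum_sub_distrib]
  rw [trace_four_comm (P := fun i j => (g x)⁻¹ i j)
    (β := fun i j => dot (h (Φ x)) (covAlong h Φ η i x) (dmap Φ j x))
    (C := fun i p => dot (h (Φ x)) (covAlong h Φ (dmap Φ i) l x) (dmap Φ p x))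
    (H.inv_symm hx) (H.covAlong_normal_symm hx), H.pd_F_eq hx l]
  ring

theorem covAlong_tension (H : HypersurfaceOn c g h W Φ U F η) (hx : x ∈ U) (j : Fin m) :
    covAlong h Φ (tension g h Φ) j x = pd j F x • η x + F x • covAlong h Φ η j x := by
  rw [covAlong_eq, covAlong_eq, H.covDir_congr hx H.tension_eq,
    H.covDir_smul hx H.smooth_F H.smooth_normal]
  rfl

theorem covAlong_covAlong_tension (H : HypersurfaceOn c g h W Φ U F η) (hx : x ∈ U)
    (i j : Fin m) : covAlong h Φ (covAlong h Φ (tension g h Φ) j) i x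
      = (pd i (pd j F) x • η x + pd j F x • covAlong h Φ η i x)
        + (pd i F x • covAlong h Φ η j x + F x • covAlong h Φ (covAlong h Φ η j) i x) := by
  have s1 : ContDiffOn ℝ ∞ (pd j F) U := smooth_dd H.isOpen H.smooth_F
  rw [covAlong_eq h Φ (covAlong h Φ (tension g h Φ) j), H.covDir_congr hx
    (fun y hy => H.covAlong_tension hy j), H.covDir_add hx (SmoothField.smul s1 H.smooth_normal)
    (SmoothField.smul H.smooth_F (H.smooth_covAlong j)), H.covDir_smul hx s1 H.smooth_normal,
    H.covDir_smul hx H.smooth_F (H.smooth_covAlong j), ← covAlong_eq, ← covAlong_eq]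
  rfl

/-- Only one term of the constant curvature formula survives because τ is normal. The result is
again normal, so c enters only the normal part of the biharmonic equation. -/
theorem riemannVec_tension (H : HypersurfaceOn c g h W Φ U F η) (hx : x ∈ U) (i j : Fin m) :
    riemannVec h (Φ x) (dmap Φ i x) (tension g h Φ x) (dmap Φ j x)
      = (-(c * g x i j * F x)) • η x := by
  rw [H.curvature _ (H.mapsTo x hx), H.dot_tension_dmap hx, ← H.isometric x hx, H.tension_eq x hx,
    zero_smul, zero_sub, smul_neg, smul_smul, smul_smul, neg_smul, mul_assoc]

theorem trace_metric (H : HypersurfaceOn c g h W Φ U F η) (hx : x ∈ U) :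
    ∑ i, ∑ j, (g x)⁻¹ i j * g x i j = m := by
  have : ∑ i, ∑ j, (g x)⁻¹ i j * g x i j = ((g x)⁻¹ * g x).trace := by
    simp only [Matrix.trace, Matrix.mul_apply, Matrix.diag_apply]
    exact Finset.sum_congr rfl fun i _ => Finset.sum_congr rfl fun j _ => by
      rw [(H.metricOn.isSymm hx).apply]
  rw [this, H.metricOn.inv_mul hx, Matrix.trace_one, Fintype.card_fin]

/-- The normal part of the biharmonic equation. -/
theorem biharmonic_normal (H : HypersurfaceOn c g h W Φ U F η) (hx : x ∈ U)
    (hb : bitension g h Φ x = 0) :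
    ∑ i, ∑ j, (g x)⁻¹ i j * (pd i (pd j F) x - ∑ k, christoffel g k i j x * pd k F x)
      = (∑ i, ∑ j, (g x)⁻¹ i j * dot (h (Φ x)) (covAlong h Φ η i x) (covAlong h Φ η j x)
          - m * c) * F x := by
  have h0 : dot (h (Φ x)) (bitension g h Φ x) (η x) = 0 := by rw [hb, dot_zero_left]
  -- Differentiate ⟨∇ⱼη, η⟩ = 0; traced, this is the source of -|A|².
  have h2 : ∀ i j, dot (h (Φ x)) (covAlong h Φ (covAlong h Φ η j) i x) (η x)
      = - dot (h (Φ x)) (covAlong h Φ η i x) (covAlong h Φ η j x) := by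
    intro i j
    have e := H.pd_dot hx i (H.smooth_covAlong j) H.smooth_normal
    have e0 : pd i (fun y => dot (h (Φ y)) (covAlong h Φ η j y) (η y)) x = 0 :=
      dd_eq_zero_of_const H.isOpen hx fun y hy => H.dot_covAlong_normal hy j
    rw [e0, H.sym hx (covAlong h Φ η j x)] at e
    linarith
  rw [bitension_eq_sum, dot_sum_left] at h0
  simp only [dot_sum_left, dot_smul_left, dot_sub_left, dot_add_left,
    H.covAlong_covAlong_tension hx, H.covAlong_tension hx, H.riemannVec_tension hx, H.unit x hx,
    H.dot_covAlong_normal hx, h2, mul_zero, mul_one, add_zero, zero_add] at h0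
  have h5 : ∀ i j, (g x)⁻¹ i j * (pd i (pd j F) x
        + F x * -dot (h (Φ x)) (covAlong h Φ η i x) (covAlong h Φ η j x)
        - ∑ k, christoffel g k i j x * pd k F x - -(c * g x i j * F x))
      = (g x)⁻¹ i j * (pd i (pd j F) x - ∑ k, christoffel g k i j x * pd k F x)
        - F x * ((g x)⁻¹ i j * dot (h (Φ x)) (covAlong h Φ η i x) (covAlong h Φ η j x))
        + c * F x * ((g x)⁻¹ i j * g x i j) := by intros; ring
  simp only [h5, Finset.sum_add_distrib, Finset.sum_sub_distrib, ← Finset.mul_sum] at h0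
  rw [H.trace_metric hx] at h0
  simp only [mul_sub, Finset.sum_sub_distrib] at h0 ⊢
  linarith

/-- The tangential part of the biharmonic equation. -/
theorem biharmonic_tangent (H : HypersurfaceOn c g h W Φ U F η) (hx : x ∈ U)
    (hb : bitension g h Φ x = 0) (l : Fin m) :
    2 * ∑ i, ∑ j, (g x)⁻¹ i j * pd j F x * dot (h (Φ x)) (covAlong h Φ η i x) (dmap Φ l x)
      = F x * pd l F x := by
  have h0 : dot (h (Φ x)) (bitension g h Φ x) (dmap Φ l x) = 0 := by rw [hb, dot_zero_left]
  rw [bitension_eq_sum, dot_sum_left] at h0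
  simp only [dot_sum_left, dot_smul_left, dot_sub_left, dot_add_left,
    H.covAlong_covAlong_tension hx, H.covAlong_tension hx, H.riemannVec_tension hx,
    H.normal x hx, mul_zero, zero_add, sub_zero] at h0
  have h5 : ∀ i j, (g x)⁻¹ i j * (pd j F x * dot (h (Φ x)) (covAlong h Φ η i x) (dmap Φ l x)
        + (pd i F x * dot (h (Φ x)) (covAlong h Φ η j x) (dmap Φ l x)
          + F x * dot (h (Φ x)) (covAlong h Φ (covAlong h Φ η j) i x) (dmap Φ l x))
        - ∑ k, christoffel g k i j x *
            (F x * dot (h (Φ x)) (covAlong h Φ η k x) (dmap Φ l x)))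
      = (g x)⁻¹ i j * pd j F x * dot (h (Φ x)) (covAlong h Φ η i x) (dmap Φ l x)
        + (g x)⁻¹ i j * pd i F x * dot (h (Φ x)) (covAlong h Φ η j x) (dmap Φ l x)
        + F x * ((g x)⁻¹ i j *
          (dot (h (Φ x)) (covAlong h Φ (covAlong h Φ η j) i x) (dmap Φ l x)
            - ∑ k, christoffel g k i j x *
                dot (h (Φ x)) (covAlong h Φ η k x) (dmap Φ l x))) := by
    intro i j
    have : ∑ k, christoffel g k i j x * (F x * dot (h (Φ x)) (covAlong h Φ η k x) (dmap Φ l x))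
        = F x * ∑ k, christoffel g k i j x *
                dot (h (Φ x)) (covAlong h Φ η k x) (dmap Φ l x) := by
      rw [Finset.mul_sum]; exact Finset.sum_congr rfl fun _ _ => by ring
    rw [this]; ring
  -- The two mixed terms have the same trace, whence the factor 2; the divergence of A supplies the
  -- remaining term -F dF.
  have h6 : ∑ i, ∑ j, (g x)⁻¹ i j * pd i F x * dot (h (Φ x)) (covAlong h Φ η j x) (dmap Φ l x)
      = ∑ i, ∑ j, (g x)⁻¹ i j * pd j F x * dot (h (Φ x)) (covAlong h Φ η i x) (dmap Φ l x) := by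
    rw [Finset.sum_comm]
    exact Finset.sum_congr rfl fun i _ => Finset.sum_congr rfl fun j _ => by
      rw [H.inv_symm hx j i]
  simp only [h5, Finset.sum_add_distrib, ← Finset.mul_sum, H.divergence_weingarten hx l, h6] at h0
  linarith

end HypersurfaceOn

end Coord

end

noncomputable section

namespace Coord

variable {m n : ℕ}

/-! ### Principal frames -/

open scoped MatrixOrder Matrix.Norms.L2Operator in
/-- Simultaneous diagonalization of a scalar product and a symmetric bilinear form. -/
theorem exists_simultaneous_diagonalization {G b : Matrix (Fin m) (Fin m) ℝ} (hG : G.PosDef)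
    (hb : b.IsSymm) : ∃ (Q : Matrix (Fin m) (Fin m) ℝ) (κ : Fin m → ℝ),
      Q.transpose * G * Q = 1 ∧ Q.transpose * b * Q = Matrix.diagonal κ := by
  -- With G = BᵀB, the matrix B⁻ᵀ b B⁻¹ is symmetric and is diagonalized by an orthogonal matrix O.
  -- Then Q = B⁻¹O serves both forms.
  obtain ⟨B, hB⟩ := CStarAlgebra.nonneg_iff_eq_star_mul_self.mp hG.posSemidef.nonneg
  rw [Matrix.star_eq_conjTranspose, Matrix.conjTranspose_eq_transpose_of_trivial] at hB
  have hdet : IsUnit B.det := by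
    have := hG.det_pos
    rw [hB, Matrix.det_mul] at this
    exact (right_ne_zero_of_mul this.ne').isUnit
  have hB1 : B * B⁻¹ = 1 := Matrix.mul_nonsing_inv _ hdet
  have hB2 : (B⁻¹).transpose * B.transpose = 1 := by
    rw [← Matrix.transpose_mul, hB1, Matrix.transpose_one]
  have hherm : ((B⁻¹).transpose * b * B⁻¹).IsHermitian := by
    rw [Matrix.IsHermitian, Matrix.conjTranspose_eq_transpose_of_trivial]
    simp only [Matrix.transpose_mul, Matrix.transpose_transpose, hb.eq, Matrix.mul_assoc]
  set O : Matrix (Fin m) (Fin m) ℝ := (hherm.eigenvectorUnitary : Matrix (Fin m) (Fin m) ℝ)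
    with hO
  have hOO : O.transpose * O = 1 := by
    have := Matrix.mem_unitaryGroup_iff'.1 hherm.eigenvectorUnitary.2
    rwa [Matrix.star_eq_conjTranspose, Matrix.conjTranspose_eq_transpose_of_trivial] at this
  have hsp := hherm.spectral_theorem
  rw [Unitary.conjStarAlgAut_apply, Matrix.star_eq_conjTranspose,
    Matrix.conjTranspose_eq_transpose_of_trivial, ← hO] at hsp
  refine ⟨B⁻¹ * O, hherm.eigenvalues, ?_, ?_⟩
  · rw [Matrix.transpose_mul, hB]
    calc O.transpose * (B⁻¹).transpose * (B.transpose * B) * (B⁻¹ * O)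
        = O.transpose * ((B⁻¹).transpose * B.transpose) * (B * B⁻¹) * O := by
          simp only [Matrix.mul_assoc]
      _ = 1 := by rw [hB1, hB2, Matrix.mul_one, Matrix.mul_one, hOO]
  · rw [Matrix.transpose_mul]
    calc O.transpose * (B⁻¹).transpose * b * (B⁻¹ * O)
        = O.transpose * ((B⁻¹).transpose * b * B⁻¹) * O := by simp only [Matrix.mul_assoc]
      _ = (O.transpose * O) * Matrix.diagonal (RCLike.ofReal ∘ hherm.eigenvalues)
            * (O.transpose * O) := by
          conv_lhs => rw [hsp]
          simp only [Matrix.mul_assoc]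
      _ = _ := by rw [hOO, Matrix.one_mul, Matrix.mul_one]; rfl

namespace HypersurfaceOn

variable {c : ℝ} {g : Coord m → Matrix (Fin m) (Fin m) ℝ}
  {h : Coord (m + 1) → Matrix (Fin (m + 1)) (Fin (m + 1)) ℝ} {W : Set (Coord (m + 1))}
  {Φ : Coord m → Coord (m + 1)} {U : Set (Coord m)} {F : Coord m → ℝ}
  {η : Coord m → Fin (m + 1) → ℝ} {x : Coord m} {X Y : Coord m}

theorem isUnitNormal (H : HypersurfaceOn c g h W Φ U F η) (hx : x ∈ U) :
    IsUnitNormal h Φ x (η x) := ⟨H.normal x hx, H.unit x hx⟩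

theorem dot_secondFundForm_normal (H : HypersurfaceOn c g h W Φ U F η) (hx : x ∈ U)
    (i j : Fin m) : dot (h (Φ x)) (secondFundForm g h Φ i j x) (η x)
      = - dot (h (Φ x)) (covAlong h Φ η i x) (dmap Φ j x) := by
  rw [secondFundForm_eq, dot_sub_left, dot_sum_left, Finset.sum_eq_zero,
    covAlong_eq, covAlong_eq, dmap_eq, H.dot_covDir_normal_dmapDir hx, H.sym hx _ (η x)]
  · ring
  · intro k _
    rw [dot_smul_left, H.sym hx, H.normal x hx, mul_zero]

theorem dot_dmapDir_dmapDir (H : HypersurfaceOn c g h W Φ U F η) (hx : x ∈ U) (X Y : Coord m) :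
    dot (h (Φ x)) (dmapDir Φ X x) (dmapDir Φ Y x) = ∑ i, ∑ j, g x i j * X i * Y j := by
  rw [dmapDir_eq_sum, dmapDir_eq_sum, dot_sum_left]
  refine Finset.sum_congr rfl fun i _ => ?_
  rw [dot_sum_right]
  refine Finset.sum_congr rfl fun j _ => ?_
  rw [dot_smul_left, dot_smul_right, ← H.isometric x hx]; ring

theorem dot_covDir_dmapDir (_H : HypersurfaceOn c g h W Φ U F η) (X Y : Coord m) :
    dot (h (Φ x)) (covDir h Φ X η x) (dmapDir Φ Y x)
      = ∑ i, ∑ j, dot (h (Φ x)) (covAlong h Φ η i x) (dmap Φ j x) * X i * Y j := by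
  rw [covDir_eq_sum, dmapDir_eq_sum, dot_sum_left]
  refine Finset.sum_congr rfl fun i _ => ?_
  rw [dot_sum_right]
  refine Finset.sum_congr rfl fun j _ => ?_
  rw [dot_smul_left, dot_smul_right]; ring

theorem dot_covDir_covDir (_H : HypersurfaceOn c g h W Φ U F η) (X Y : Coord m) :
    dot (h (Φ x)) (covDir h Φ X η x) (covDir h Φ Y η x)
      = ∑ i, ∑ j, X i * Y j * dot (h (Φ x)) (covAlong h Φ η i x) (covAlong h Φ η j x) := by
  rw [covDir_eq_sum, covDir_eq_sum, dot_sum_left]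
  refine Finset.sum_congr rfl fun i _ => ?_
  rw [dot_sum_right]
  refine Finset.sum_congr rfl fun j _ => ?_
  rw [dot_smul_left, dot_smul_right]; ring

/-- At every point there is an orthonormal frame of principal directions. -/
theorem exists_principal_frame (H : HypersurfaceOn c g h W Φ U F η) (hx : x ∈ U) :
    ∃ (E : Fin m → Coord m) (κ : Fin m → ℝ),
      (∀ a b, dot (h (Φ x)) (dmapDir Φ (E a) x) (dmapDir Φ (E b) x) = if a = b then 1 else 0) ∧
      (∀ a, covDir h Φ (E a) η x = - κ a • dmapDir Φ (E a) x) ∧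
      (∀ S : Fin m → Fin m → ℝ,
        ∑ i, ∑ j, (g x)⁻¹ i j * S i j = ∑ a, ∑ i, ∑ j, E a i * E a j * S i j) ∧
      (∀ a, IsPrincipalCurvature g h Φ x (η x) (κ a)) ∧
      (∀ X : Coord m,
        X = ∑ a, dot (h (Φ x)) (dmapDir Φ X x) (dmapDir Φ (E a) x) • E a) := by
  set b : Matrix (Fin m) (Fin m) ℝ := Matrix.of fun i j =>
    - dot (h (Φ x)) (covAlong h Φ η i x) (dmap Φ j x) with hbdef
  have hb : b.IsSymm := by
    ext i j
    simp only [hbdef, Matrix.transpose_apply, Matrix.of_apply, H.covAlong_normal_symm hx j i]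
  obtain ⟨Q, κ, hQ1, hQ2⟩ := exists_simultaneous_diagonalization (H.posDef x hx) hb
  have hQl : (Q.transpose * g x) * Q = 1 := hQ1
  have hQr : Q * (Q.transpose * g x) = 1 := mul_eq_one_comm.1 hQl
  -- This turns traces taken with the inverse metric into sums over the orthonormal frame.
  have hinv : (g x)⁻¹ = Q * Q.transpose := by
    refine Matrix.inv_eq_left_inv ?_
    rw [Matrix.mul_assoc]; exact hQr
  set E : Fin m → Coord m := fun a => WithLp.toLp 2 fun i => Q i a with hE
  have hEi : ∀ a i, E a i = Q i a := fun a i => rfl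
  have orth : ∀ a b, dot (h (Φ x)) (dmapDir Φ (E a) x) (dmapDir Φ (E b) x)
      = if a = b then 1 else 0 := by
    intro a b'
    rw [H.dot_dmapDir_dmapDir hx, ← Matrix.one_apply, ← hQ1, Matrix.mul_apply, Finset.sum_comm]
    refine Finset.sum_congr rfl fun j _ => ?_
    rw [Matrix.mul_apply, Finset.sum_mul]
    refine Finset.sum_congr rfl fun i _ => ?_
    simp only [hEi, Matrix.transpose_apply]; ring
  have hspan : ∀ X : Coord m,
      X = ∑ a, dot (h (Φ x)) (dmapDir Φ X x) (dmapDir Φ (E a) x) • E a := by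
    intro X
    ext k
    have h1 : X k = ∑ l, (Q * (Q.transpose * g x)) k l * X l := by
      rw [hQr]; simp [Matrix.one_apply]
    rw [h1]
    simp only [WithLp.ofLp_sum, WithLp.ofLp_smul, Finset.sum_apply, Pi.smul_apply, smul_eq_mul,
      H.dot_dmapDir_dmapDir hx, hEi]
    simp only [Matrix.mul_apply (M := Q), Finset.sum_mul]
    rw [Finset.sum_comm]
    refine Finset.sum_congr rfl fun a _ => Finset.sum_congr rfl fun l _ => ?_
    rw [Matrix.mul_apply, Finset.mul_sum, Finset.sum_mul]
    refine Finset.sum_congr rfl fun i _ => ?_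
    rw [Matrix.transpose_apply, (H.metricOn.isSymm hx).apply]; ring
  have hbQ : ∀ a b', dot (h (Φ x)) (covDir h Φ (E a) η x) (dmapDir Φ (E b') x)
      = if a = b' then - κ a else 0 := by
    intro a b'
    have : (Q.transpose * b * Q) a b' = if a = b' then κ a else 0 := by
      rw [hQ2, Matrix.diagonal_apply]
    rw [H.dot_covDir_dmapDir]
    have e : ∑ i, ∑ j, dot (h (Φ x)) (covAlong h Φ η i x) (dmap Φ j x) * E a i * E b' j
        = - (Q.transpose * b * Q) a b' := by
      rw [Matrix.mul_apply, Finset.sum_comm, ← Finset.sum_neg_distrib]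
      refine Finset.sum_congr rfl fun j _ => ?_
      rw [Matrix.mul_apply, Finset.sum_mul, ← Finset.sum_neg_distrib]
      refine Finset.sum_congr rfl fun i _ => ?_
      simp only [hEi, hbdef, Matrix.transpose_apply, Matrix.of_apply]; ring
    rw [e, this]
    split_ifs <;> simp
  -- Tangential components need only be compared on the frame E, which spans all directions.
  have hdir : ∀ (u v : Fin (m + 1) → ℝ),
      (∀ a, dot (h (Φ x)) u (dmapDir Φ (E a) x) = dot (h (Φ x)) v (dmapDir Φ (E a) x)) →
      ∀ X : Coord m, dot (h (Φ x)) u (dmapDir Φ X x) = dot (h (Φ x)) v (dmapDir Φ X x) := by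
    intro u v huv X
    have hX : dmapDir Φ X x
        = ∑ a, dot (h (Φ x)) (dmapDir Φ X x) (dmapDir Φ (E a) x) • dmapDir Φ (E a) x := by
      funext k
      conv_lhs => rw [dmapDir, hspan X, dd, map_sum]
      simp only [map_smul, Finset.sum_apply, Pi.smul_apply]
      rfl
    rw [hX]
    simp only [dot_sum_right, dot_smul_right, huv]
  have weing : ∀ a, covDir h Φ (E a) η x = - κ a • dmapDir Φ (E a) x := by
    intro a
    refine H.ext_dot hx ?_ fun i => ?_
    · rw [H.dot_covDir_normal hx, dot_smul_left, H.sym hx, H.normalDir hx, mul_zero]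
    · refine hdir _ _ (fun b' => ?_) _
      rw [hbQ, dot_smul_left, orth]
      split_ifs <;> simp
  refine ⟨E, κ, orth, weing, ?_, ?_, hspan⟩
  · intro S
    simp only [hinv, Matrix.mul_apply, Finset.sum_mul, hEi, Matrix.transpose_apply]
    conv_lhs => enter [2, i]; rw [Finset.sum_comm]
    rw [Finset.sum_comm]
  · intro a
    refine ⟨fun i => E a i, ?_, fun j => ?_⟩
    · intro h0
      have h1 : E a = 0 := by ext i; exact congrFun h0 i
      have h2 := orth a a
      rw [H.dot_dmapDir_dmapDir hx, h1] at h2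
      simp at h2
    · have h1 := congrArg (fun u => dot (h (Φ x)) u (dmap Φ j x)) (weing a)
      simp only [covDir_eq_sum, dmapDir_eq_sum, dot_smul_left, dot_sum_left] at h1
      simp only [H.dot_secondFundForm_normal hx, H.isometric x hx, mul_neg,
        Finset.sum_neg_distrib, h1]
      ring

end HypersurfaceOn

end Coord

end

/-! ### The Weingarten operator of a biharmonic hypersurface where grad F ≠ 0 -/

noncomputable section

namespace Coord

variable {m n : ℕ}

theorem dmapDir_sum {ι : Type*} (s : Finset ι) (Φ : Coord m → Coord n) (r : ι → ℝ)
    (E : ι → Coord m) (x : Coord m) :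
    dmapDir Φ (∑ a ∈ s, r a • E a) x = ∑ a ∈ s, r a • dmapDir Φ (E a) x := by
  funext k
  simp only [dmapDir, dd, map_sum, map_smul, Finset.sum_apply, Pi.smul_apply]

theorem covDir_sum_dir {ι : Type*} (s : Finset ι) (h : Coord n → Matrix (Fin n) (Fin n) ℝ)
    (Φ : Coord m → Coord n) (V : Coord m → Fin n → ℝ) (r : ι → ℝ)
    (E : ι → Coord m) (x : Coord m) :
    covDir h Φ (∑ a ∈ s, r a • E a) V x = ∑ a ∈ s, r a • covDir h Φ (E a) V x := by
  simp only [covDir_eq_sum, WithLp.ofLp_sum, WithLp.ofLp_smul, Finset.sum_apply, Pi.smul_apply,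
    smul_eq_mul, Finset.sum_smul, Finset.smul_sum, smul_smul]
  rw [Finset.sum_comm]

/-- The gradient of `F` with respect to the metric `g`. -/
def gradVec (g : Coord m → Matrix (Fin m) (Fin m) ℝ) (F : Coord m → ℝ) (x : Coord m) : Coord m :=
  WithLp.toLp 2 fun i => ∑ j, (g x)⁻¹ i j * pd j F x

/-- If `-1/2` and `t` are eigenvalues of multiplicities `d` and `m - d` of an operator of trace
`1`, then `t = secondRatio m d`. -/
def secondRatio (m d : ℕ) : ℝ := (1 + d / 2) / (m - d)

namespace HypersurfaceOn

variable {c : ℝ} {g : Coord m → Matrix (Fin m) (Fin m) ℝ}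
  {h : Coord (m + 1) → Matrix (Fin (m + 1)) (Fin (m + 1)) ℝ} {W : Set (Coord (m + 1))}
  {Φ : Coord m → Coord (m + 1)} {U : Set (Coord m)} {F : Coord m → ℝ}
  {η : Coord m → Fin (m + 1) → ℝ} {x : Coord m} {X Y : Coord m}

theorem dot_dmapDir_gradVec (H : HypersurfaceOn c g h W Φ U F η) (hx : x ∈ U) (X : Coord m) :
    dot (h (Φ x)) (dmapDir Φ X x) (dmapDir Φ (gradVec g F x) x) = dd X F x := by
  rw [H.dot_dmapDir_dmapDir hx, dd_eq_sum]
  refine Finset.sum_congr rfl fun i _ => ?_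
  have h1 : pd i F x = ∑ k, (g x * (g x)⁻¹) i k * pd k F x := by
    rw [H.metricOn.mul_inv hx]; simp [Matrix.one_apply]
  rw [h1]
  simp only [gradVec, Matrix.mul_apply, Finset.mul_sum, Finset.sum_mul]
  rw [Finset.sum_comm]
  exact Finset.sum_congr rfl fun _ _ => Finset.sum_congr rfl fun _ _ => by ring

/-- For a biharmonic hypersurface the gradient of `F` is a principal direction. -/
theorem covDir_gradVec (H : HypersurfaceOn c g h W Φ U F η) (hx : x ∈ U)
    (hb : bitension g h Φ x = 0) :
    covDir h Φ (gradVec g F x) η x = (F x / 2) • dmapDir Φ (gradVec g F x) x := by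
  refine H.ext_dot hx ?_ fun l => ?_
  · rw [H.dot_covDir_normal hx, dot_smul_left, H.sym hx, H.normalDir hx, mul_zero]
  · rw [dot_smul_left, H.sym hx (dmapDir Φ (gradVec g F x) x) (dmap Φ l x), dmap_eq, H.dot_dmapDir_gradVec hx]
    have h1 := H.biharmonic_tangent hx hb l
    rw [covDir_eq_sum, dot_sum_left]
    have h2 : ∑ i, dot (h (Φ x)) ((gradVec g F x) i • covAlong h Φ η i x)
          (dmapDir Φ (EuclideanSpace.single l 1) x)
        = ∑ i, ∑ j, (g x)⁻¹ i j * pd j F x *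
          dot (h (Φ x)) (covAlong h Φ η i x) (dmap Φ l x) := by
      refine Finset.sum_congr rfl fun i _ => ?_
      rw [dot_smul_left, ← Finset.sum_mul]
      rfl
    rw [h2, ← pd_eq_dd]
    linarith

/-- The Weingarten operator of a biharmonic hypersurface with at most two principal curvatures at
a point where `F` is positive and its gradient does not vanish. -/
theorem weingarten_structure (H : HypersurfaceOn c g h W Φ U F η) (hx : x ∈ U)
    (hb : bitension g h Φ x = 0)
    (hk : {k : ℝ | IsPrincipalCurvature g h Φ x (η x) k}.encard ≤ 2)
    (hF : 0 < F x) (hgr : gradVec g F x ≠ 0) :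
    ∃ d : ℕ, 1 ≤ d ∧ d < m ∧
      ∑ i, ∑ j, (g x)⁻¹ i j * dot (h (Φ x)) (covAlong h Φ η i x) (covAlong h Φ η j x)
        = F x ^ 2 * (d / 4 + (m - d) * secondRatio m d ^ 2) ∧
      (∀ X Y, dot (h (Φ x)) (covDir h Φ X η x) (covDir h Φ Y η x)
        + (secondRatio m d - 1 / 2) * F x * dot (h (Φ x)) (covDir h Φ X η x) (dmapDir Φ Y x)
        - secondRatio m d / 2 * F x ^ 2 * dot (h (Φ x)) (dmapDir Φ X x) (dmapDir Φ Y x) = 0) ∧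
      (2 ≤ d → ∃ v, covDir h Φ v η x = (F x / 2) • dmapDir Φ v x ∧
        dot (h (Φ x)) (dmapDir Φ v x) (dmapDir Φ v x) ≠ 0 ∧
        dot (h (Φ x)) (dmapDir Φ v x) (dmapDir Φ (gradVec g F x) x) = 0) ∧
      (d = 1 → ∀ X, covDir h Φ X η x = - (secondRatio m d * F x) • dmapDir Φ X x
        + ((secondRatio m d + 1 / 2) * F x
            * dot (h (Φ x)) (dmapDir Φ X x) (dmapDir Φ (gradVec g F x) x)
            / dot (h (Φ x)) (dmapDir Φ (gradVec g F x) x) (dmapDir Φ (gradVec g F x) x))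
          • dmapDir Φ (gradVec g F x) x) := by
  obtain ⟨E, κ, orth, weing, htr, hpc, hspan⟩ := H.exists_principal_frame hx
  set u := gradVec g F x with hu
  set y : Fin m → ℝ := fun a => dot (h (Φ x)) (dmapDir Φ u x) (dmapDir Φ (E a) x) with hy
  have hT : ∀ X, dmapDir Φ X x
      = ∑ a, dot (h (Φ x)) (dmapDir Φ X x) (dmapDir Φ (E a) x) • dmapDir Φ (E a) x := by
    intro X
    conv_lhs => rw [hspan X]
    rw [dmapDir_sum]
  have hD : ∀ X, covDir h Φ X η x
      = ∑ a, (dot (h (Φ x)) (dmapDir Φ X x) (dmapDir Φ (E a) x) * -κ a) • dmapDir Φ (E a) x := by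
    intro X
    conv_lhs => rw [hspan X]
    rw [covDir_sum_dir]
    exact Finset.sum_congr rfl fun a _ => by rw [weing, smul_smul]
  have hcomb : ∀ (r : Fin m → ℝ) (b : Fin m),
      dot (h (Φ x)) (∑ a, r a • dmapDir Φ (E a) x) (dmapDir Φ (E b) x) = r b := by
    intro r b
    simp [dot_sum_left, dot_smul_left, orth]
  have hDE : ∀ X a, dot (h (Φ x)) (covDir h Φ X η x) (dmapDir Φ (E a) x)
      = - κ a * dot (h (Φ x)) (dmapDir Φ X x) (dmapDir Φ (E a) x) := by
    intro X a
    rw [hD X, hcomb]; ring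
  have hFκ : F x = ∑ a, κ a := by
    rw [H.F_eq hx, htr, ← Finset.sum_neg_distrib]
    refine Finset.sum_congr rfl fun a _ => ?_
    have : ∑ i, ∑ j, E a i * E a j * dot (h (Φ x)) (covAlong h Φ η i x) (dmap Φ j x)
        = dot (h (Φ x)) (covDir h Φ (E a) η x) (dmapDir Φ (E a) x) := by
      rw [H.dot_covDir_dmapDir]
      exact Finset.sum_congr rfl fun _ _ => Finset.sum_congr rfl fun _ _ => by ring
    rw [this, hDE, orth]; simp
  have hSκ : ∑ i, ∑ j, (g x)⁻¹ i j * dot (h (Φ x)) (covAlong h Φ η i x) (covAlong h Φ η j x)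
      = ∑ a, κ a ^ 2 := by
    rw [htr]
    refine Finset.sum_congr rfl fun a _ => ?_
    rw [← H.dot_covDir_covDir, weing, dot_smul_left, dot_smul_right, orth]
    simp; ring
  -- Since A(grad F) = -(F/2) grad F, the gradient has components only along principal directions
  -- with curvature -F/2.
  have hyκ : ∀ a, y a ≠ 0 → κ a = - F x / 2 := by
    intro a ha
    have h1 := hDE u a
    rw [H.covDir_gradVec hx hb, dot_smul_left] at h1
    have h2 : (F x / 2 + κ a) * y a = 0 := by simp only [hy]; linarith
    have := (mul_eq_zero.1 h2).resolve_right ha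
    linarith
  obtain ⟨a₀, ha₀⟩ : ∃ a, y a ≠ 0 := by
    by_contra hcon
    push Not at hcon
    refine hgr ?_
    rw [hspan u]
    exact Finset.sum_eq_zero fun a _ => by rw [show dot _ _ _ = 0 from hcon a, zero_smul]
  have hκ₀ := hyκ a₀ ha₀
  -- If all principal curvatures were -F/2, the trace would give F = -mF/2 ≤ 0.
  obtain ⟨a₁, ha₁⟩ : ∃ a, κ a ≠ - F x / 2 := by
    by_contra hcon
    push Not at hcon
    have : F x = m * (- F x / 2) := by
      conv_lhs => rw [hFκ]
      simp [hcon]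
    have : 0 ≤ m * F x := by positivity
    linarith
  set k₂ := κ a₁ with hk₂
  have htwo : ∀ a, κ a = - F x / 2 ∨ κ a = k₂ := by
    intro a
    by_contra hcon
    push Not at hcon
    have hsub : ({κ a, - F x / 2, k₂} : Set ℝ)
        ⊆ {k : ℝ | IsPrincipalCurvature g h Φ x (η x) k} := by
      rintro k (rfl | rfl | rfl)
      · exact hpc a
      · rw [← hκ₀]; exact hpc a₀
      · exact hpc a₁
    have h3 := (Set.encard_le_encard hsub).trans hk
    rw [Set.encard_insert_of_notMem (by simp [hcon.1, hcon.2]),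
      Set.encard_pair ha₁.symm] at h3
    exact absurd h3 (by decide)
  set s : Finset (Fin m) := Finset.univ.filter fun a => κ a = - F x / 2 with hs
  have hcard_lt : s.card < m := by
    have : s.card < (Finset.univ : Finset (Fin m)).card := by
      refine Finset.card_lt_card ?_
      rw [Finset.ssubset_univ_iff]
      intro h0
      have : a₁ ∈ s := h0 ▸ Finset.mem_univ a₁
      exact ha₁ (Finset.mem_filter.1 this).2
    simpa using this
  have hcard_pos : 1 ≤ s.card := Finset.card_pos.2 ⟨a₀, by simp [hs, hκ₀]⟩
  have hsum : ∀ f : ℝ → ℝ, ∑ a, f (κ a) = s.card * f (- F x / 2) + (m - s.card) * f k₂ := by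
    intro f
    have : ∀ a, f (κ a) = (if κ a = - F x / 2 then f (- F x / 2) - f k₂ else 0) + f k₂ := by
      intro a
      split_ifs with h1
      · rw [h1]; ring
      · rw [(htwo a).resolve_left h1]; ring
    simp only [this, Finset.sum_add_distrib, ← Finset.sum_filter, ← hs]
    simp; ring
  have hmd : (0 : ℝ) < m - s.card := by
    rw [sub_pos]; exact_mod_cast hcard_lt
  -- Solve the trace equation F = -dF/2 + (m - d)k₂, with d the multiplicity of -F/2.
  have hk₂F : k₂ = secondRatio m s.card * F x := by
    have := hsum id
    simp only [id] at this
    rw [← hFκ] at this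
    rw [secondRatio, div_mul_eq_mul_div, eq_div_iff hmd.ne']
    linarith
  refine ⟨s.card, hcard_pos, hcard_lt, ?_, ?_, ?_, ?_⟩
  · rw [hSκ, hsum (fun t => t ^ 2), hk₂F]; ring
  -- This is (A + F/2)(A - tF) = 0, with signs adapted to ∇η = -A. It is checked on each frame
  -- vector.
  · intro X Y
    have e1 : ∀ v : Fin (m + 1) → ℝ, dot (h (Φ x)) v (covDir h Φ Y η x)
        = ∑ a, -κ a * dot (h (Φ x)) (dmapDir Φ Y x) (dmapDir Φ (E a) x)
          * dot (h (Φ x)) v (dmapDir Φ (E a) x) := by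
      intro v
      rw [hD Y, dot_sum_right]
      exact Finset.sum_congr rfl fun a _ => by rw [dot_smul_right]; ring
    have e2 : ∀ v : Fin (m + 1) → ℝ, dot (h (Φ x)) v (dmapDir Φ Y x)
        = ∑ a, dot (h (Φ x)) (dmapDir Φ Y x) (dmapDir Φ (E a) x)
          * dot (h (Φ x)) v (dmapDir Φ (E a) x) := by
      intro v
      conv_lhs => rw [hT Y, dot_sum_right]
      exact Finset.sum_congr rfl fun a _ => by rw [dot_smul_right]
    rw [e1, e2, e2, Finset.mul_sum, Finset.mul_sum, ← Finset.sum_add_distrib,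
      ← Finset.sum_sub_distrib]
    refine Finset.sum_eq_zero fun a _ => ?_
    rw [hDE]
    rcases htwo a with h1 | h1
    · rw [h1]; ring
    · rw [h1, hk₂F]; ring
  · intro hd
    obtain ⟨a₂, ha₂, hne⟩ := Finset.exists_mem_ne (by omega : 1 < s.card) a₀
    have hκ₂ : κ a₂ = - F x / 2 := (Finset.mem_filter.1 ha₂).2
    have hTu : ∀ a, dot (h (Φ x)) (dmapDir Φ (E a) x) (dmapDir Φ u x) = y a :=
      fun a => H.sym hx _ _
    have hv : ∀ v, v = y a₂ • E a₀ + (- y a₀) • E a₂ →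
        dmapDir Φ v x = y a₂ • dmapDir Φ (E a₀) x + (- y a₀) • dmapDir Φ (E a₂) x := by
      rintro v rfl
      have := dmapDir_sum Finset.univ Φ ![y a₂, - y a₀] ![E a₀, E a₂] x
      simpa using this
    -- Within the plane of two principal directions for -F/2, rotate the components (y a₀, y a₂) of
    -- grad F by a right angle. The result is nonzero because y a₀ ≠ 0.
    refine ⟨y a₂ • E a₀ + (- y a₀) • E a₂, ?_, ?_, ?_⟩
    · have := covDir_sum_dir Finset.univ h Φ η ![y a₂, - y a₀] ![E a₀, E a₂] x
      simp only [Fin.sum_univ_two, Matrix.cons_val_zero, Matrix.cons_val_one] at this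
      rw [this, hv _ rfl, weing, weing, hκ₀, hκ₂]
      module
    · rw [hv _ rfl]
      simp only [dot_add_left, dot_add_right, dot_smul_left, dot_smul_right, orth, hne, hne.symm,
        if_true, if_false]
      have : 0 < y a₀ ^ 2 := by positivity
      nlinarith [sq_nonneg (y a₂)]
    · rw [hv _ rfl]
      simp only [dot_add_left, dot_smul_left, hTu]
      ring
  · intro hd X
    -- The eigenspace of -F/2 is now a line, and it contains grad F.
    have hs1 : s = {a₀} := by
      obtain ⟨a, ha⟩ := Finset.card_eq_one.1 hd
      have : a₀ ∈ s := by simp [hs, hκ₀]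
      rw [ha] at this ⊢
      rw [Finset.mem_singleton.1 this]
    have hother : ∀ a, a ≠ a₀ → κ a = k₂ := by
      intro a ha
      refine (htwo a).resolve_left fun h1 => ha ?_
      have : a ∈ s := by simp [hs, h1]
      rwa [hs1, Finset.mem_singleton] at this
    have hyz : ∀ a, a ≠ a₀ → y a = 0 := by
      intro a ha
      by_contra h1
      have := hyκ a h1
      rw [hother a ha] at this
      exact ha₁ this
    have hTu : dmapDir Φ u x = y a₀ • dmapDir Φ (E a₀) x := by
      rw [hT u]
      exact Finset.sum_eq_single a₀ (fun a _ ha => by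
        rw [show dot _ _ _ = 0 from hyz a ha, zero_smul]) (by simp)
    have hDX : covDir h Φ X η x = (- k₂) • dmapDir Φ X x
        + ((k₂ + F x / 2) * dot (h (Φ x)) (dmapDir Φ X x) (dmapDir Φ (E a₀) x))
          • dmapDir Φ (E a₀) x := by
      conv_lhs => rw [hD X]
      conv_rhs => enter [1]; rw [hT X]
      rw [Finset.smul_sum, ← Finset.sum_erase_add _ _ (Finset.mem_univ a₀),
        ← Finset.sum_erase_add _ _ (Finset.mem_univ a₀), add_assoc]
      congr 1
      · refine Finset.sum_congr rfl fun a ha => ?_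
        rw [hother a (Finset.ne_of_mem_erase ha), smul_smul, mul_comm]
      · rw [hκ₀]; module
    rw [hDX, hTu, hk₂F]
    congr 1
    simp only [dot_smul_left, dot_smul_right, orth, if_true, smul_smul]
    congr 1
    field_simp

end HypersurfaceOn

end Coord

end

noncomputable section

namespace Coord

variable {m n : ℕ}

/-! ### The multiplicity of the principal curvature in the direction of the gradient -/

namespace HypersurfaceOn

variable {c : ℝ} {g : Coord m → Matrix (Fin m) (Fin m) ℝ}
  {h : Coord (m + 1) → Matrix (Fin (m + 1)) (Fin (m + 1)) ℝ} {W : Set (Coord (m + 1))}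
  {Φ : Coord m → Coord (m + 1)} {U : Set (Coord m)} {F : Coord m → ℝ}
  {η : Coord m → Fin (m + 1) → ℝ} {x : Coord m} {X Y : Coord m} {t : ℝ}

/-- The covariant derivative of the Weingarten operator `A` on the eigenspace of `-F/2`, when
`(A + F/2) (A - t F) = 0`. -/
theorem dot_covDir_covDir_eigen (H : HypersurfaceOn c g h W Φ U F η)
    (hq : ∀ y ∈ U, ∀ X Y, dot (h (Φ y)) (covDir h Φ X η y) (covDir h Φ Y η y)
        + (t - 1 / 2) * F y * dot (h (Φ y)) (covDir h Φ X η y) (dmapDir Φ Y y)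
        - t / 2 * F y ^ 2 * dot (h (Φ y)) (dmapDir Φ X y) (dmapDir Φ Y y) = 0)
    (hx : x ∈ U) (ht : 0 < t) (hF : 0 < F x) {p q : Coord m}
    (hp : covDir h Φ p η x = (F x / 2) • dmapDir Φ p x)
    (hq' : covDir h Φ q η x = (F x / 2) • dmapDir Φ q x) (Z : Coord m) :
    dot (h (Φ x)) (covDir h Φ Z (covDir h Φ p η) x) (dmapDir Φ q x)
      = F x / 2 * dot (h (Φ x)) (covDir h Φ Z (dmapDir Φ p) x) (dmapDir Φ q x)
        + 1 / 2 * dd Z F x * dot (h (Φ x)) (dmapDir Φ p x) (dmapDir Φ q x) := by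
  have sη := H.smooth_normal
  have sD : ∀ X, SmoothField (covDir h Φ X η) U := fun X => H.smooth_covDir sη
  have sT : ∀ X, SmoothField (dmapDir Φ X) U := fun X => H.smooth_dmapDir
  have hd : ∀ {f : Coord m → ℝ}, ContDiffOn ℝ ∞ f U → DifferentiableAt ℝ f x :=
    fun hf => diffAt_of_smooth H.isOpen hx hf
  have s1 := H.smooth_dot (sD p) (sD q)
  have s2 := H.smooth_dot (sD p) (sT q)
  have s3 := H.smooth_dot (sT p) (sT q)
  have sF := H.smooth_F
  -- The quadratic equation of A holds on all of U, so it may be differentiated; afterwards p and q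
  -- are taken to be eigenvectors at x.
  have hder : dd Z (fun y => dot (h (Φ y)) (covDir h Φ p η y) (covDir h Φ q η y)
        + (t - 1 / 2) * (F y * dot (h (Φ y)) (covDir h Φ p η y) (dmapDir Φ q y))
        - t / 2 * (F y * F y * dot (h (Φ y)) (dmapDir Φ p y) (dmapDir Φ q y))) x = 0 := by
    refine dd_eq_zero_of_const H.isOpen hx (c := 0) fun y hy => ?_
    rw [← hq y hy p q]; ring
  rw [dd_sub (hd (s1.add (contDiffOn_const.mul (sF.mul s2))))
      (hd (contDiffOn_const.mul ((sF.mul sF).mul s3))),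
    dd_add (hd s1) (hd (contDiffOn_const.mul (sF.mul s2))), dd_const_mul _ (hd (sF.mul s2)),
    dd_const_mul _ (hd ((sF.mul sF).mul s3)), dd_mul (hd sF) (hd s2),
    dd_mul (hd (sF.mul sF)) (hd s3), dd_mul (hd sF) (hd sF), H.dd_dot hx (sD p) (sD q),
    H.dd_dot hx (sD p) (sT q), H.dd_dot hx (sT p) (sT q), hp, hq'] at hder
  have hsym : dd Z (fun y => dot (h (Φ y)) (covDir h Φ p η y) (dmapDir Φ q y)) x
      = dd Z (fun y => dot (h (Φ y)) (covDir h Φ q η y) (dmapDir Φ p y)) x :=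
    dd_congr H.isOpen hx fun y hy => H.dot_covDir_normal_symm hy p q
  rw [H.dd_dot hx (sD p) (sT q), H.dd_dot hx (sD q) (sT p), hp, hq'] at hsym
  simp only [dot_smul_left, dot_smul_right] at hder hsym
  rw [H.sym hx (dmapDir Φ p x) (covDir h Φ Z (covDir h Φ q η) x)] at hder
  rw [H.sym hx (dmapDir Φ q x) (covDir h Φ Z (dmapDir Φ p) x)] at hsym
  -- The gap tF - (-F/2) between the two principal curvatures.
  have hne : (t + 1 / 2) * F x ≠ 0 := by positivity
  refine mul_left_cancel₀ hne ?_
  linear_combination hder + F x / 2 * hsym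

/-- The principal curvature in the direction of the gradient is simple. -/
theorem false_of_multiple (H : HypersurfaceOn c g h W Φ U F η)
    (hq : ∀ y ∈ U, ∀ X Y, dot (h (Φ y)) (covDir h Φ X η y) (covDir h Φ Y η y)
        + (t - 1 / 2) * F y * dot (h (Φ y)) (covDir h Φ X η y) (dmapDir Φ Y y)
        - t / 2 * F y ^ 2 * dot (h (Φ y)) (dmapDir Φ X y) (dmapDir Φ Y y) = 0)
    (hx : x ∈ U) (ht : 0 < t) (hF : 0 < F x) {u v : Coord m}
    (hu : covDir h Φ u η x = (F x / 2) • dmapDir Φ u x)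
    (hv : covDir h Φ v η x = (F x / 2) • dmapDir Φ v x)
    (hvv : dot (h (Φ x)) (dmapDir Φ v x) (dmapDir Φ v x) ≠ 0)
    (huv : dot (h (Φ x)) (dmapDir Φ v x) (dmapDir Φ u x) = 0) (huF : dd u F x ≠ 0) : False := by
  -- The left sides of the two instances agree by Codazzi, and the first terms on the right by
  -- torsion-freeness. What remains is u(F)|v|² = v(F)⟨u, v⟩ = 0.
  have h1 := H.dot_covDir_covDir_eigen hq hx ht hF hv hv u
  have h2 := H.dot_covDir_covDir_eigen hq hx ht hF hu hv v
  rw [H.codazzi hx u v, h2, H.covDir_dmapDir_comm hx (X := u) (Y := v), H.sym hx _ (dmapDir Φ v x),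
    H.sym hx (dmapDir Φ u x) (dmapDir Φ v x), huv, H.sym hx _ (dmapDir Φ v x)] at h1
  exact mul_ne_zero huF hvv (by linarith)

end HypersurfaceOn

/-! ### The case of a simple principal curvature -/

/-- A hypersurface with `dF = s ⟨·, N⟩`, `N` a unit tangent field, whose Weingarten operator is
`-F/2` on `N` and `t F` on the orthogonal complement of `N`. -/
structure SimpleHypersurfaceOn (c : ℝ) (g : Coord m → Matrix (Fin m) (Fin m) ℝ)
    (h : Coord (m + 1) → Matrix (Fin (m + 1)) (Fin (m + 1)) ℝ) (W : Set (Coord (m + 1)))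
    (Φ : Coord m → Coord (m + 1)) (U : Set (Coord m)) (F : Coord m → ℝ)
    (η : Coord m → Fin (m + 1) → ℝ) (t : ℝ) (s : Coord m → ℝ) (N : Coord m → Fin (m + 1) → ℝ) :
    Prop extends HypersurfaceOn c g h W Φ U F η where
  t_pos : 0 < t
  F_pos : ∀ x ∈ U, 0 < F x
  s_pos : ∀ x ∈ U, 0 < s x
  smooth_s : ContDiffOn ℝ ∞ s U
  smooth_N : SmoothField N U
  unit_N : ∀ x ∈ U, dot (h (Φ x)) (N x) (N x) = 1
  tangent_N : ∀ x ∈ U, ∃ u, dmapDir Φ u x = N x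
  dd_F : ∀ x ∈ U, ∀ X, dd X F x = s x * dot (h (Φ x)) (dmapDir Φ X x) (N x)
  weingarten : ∀ x ∈ U, ∀ X, covDir h Φ X η x = (-t * F x) • dmapDir Φ X x
    + ((t + 1 / 2) * (F x * dot (h (Φ x)) (dmapDir Φ X x) (N x))) • N x

namespace SimpleHypersurfaceOn

variable {c : ℝ} {g : Coord m → Matrix (Fin m) (Fin m) ℝ}
  {h : Coord (m + 1) → Matrix (Fin (m + 1)) (Fin (m + 1)) ℝ} {W : Set (Coord (m + 1))}
  {Φ : Coord m → Coord (m + 1)} {U : Set (Coord m)} {F : Coord m → ℝ}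
  {η : Coord m → Fin (m + 1) → ℝ} {x : Coord m} {t : ℝ} {s : Coord m → ℝ}
  {N : Coord m → Fin (m + 1) → ℝ}

theorem smooth_angle (H : SimpleHypersurfaceOn c g h W Φ U F η t s N) (X : Coord m) :
    ContDiffOn ℝ ∞ (fun y => dot (h (Φ y)) (dmapDir Φ X y) (N y)) U :=
  H.smooth_dot H.smooth_dmapDir H.smooth_N

theorem dot_normal_N (H : SimpleHypersurfaceOn c g h W Φ U F η t s N) (hx : x ∈ U) :
    dot (h (Φ x)) (η x) (N x) = 0 := by
  obtain ⟨u, hu⟩ := H.tangent_N x hx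
  rw [← hu, H.normalDir hx]

theorem dot_covDir_N (H : SimpleHypersurfaceOn c g h W Φ U F η t s N) (hx : x ∈ U)
    (X : Coord m) : dot (h (Φ x)) (covDir h Φ X N x) (N x) = 0 := by
  have h1 := H.dd_dot hx H.smooth_N H.smooth_N (X := X)
  rw [dd_eq_zero_of_const H.isOpen hx H.unit_N, H.sym hx (N x)] at h1
  linarith

/-- The Codazzi equation for the special Weingarten operator. -/
theorem codazzi_N (H : SimpleHypersurfaceOn c g h W Φ U F η t s N) (hx : x ∈ U)
    (X Y : Coord m) :
    (-t * s x) • (dot (h (Φ x)) (dmapDir Φ X x) (N x) • dmapDir Φ Y x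
        - dot (h (Φ x)) (dmapDir Φ Y x) (N x) • dmapDir Φ X x)
      + ((t + 1 / 2) * F x * (dd X (fun y => dot (h (Φ y)) (dmapDir Φ Y y) (N y)) x
        - dd Y (fun y => dot (h (Φ y)) (dmapDir Φ X y) (N y)) x)) • N x
      + ((t + 1 / 2) * F x) • (dot (h (Φ x)) (dmapDir Φ Y x) (N x) • covDir h Φ X N x
        - dot (h (Φ x)) (dmapDir Φ X x) (N x) • covDir h Φ Y N x) = 0 := by
  have hd : ∀ {f : Coord m → ℝ}, ContDiffOn ℝ ∞ f U → DifferentiableAt ℝ f x :=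
    fun hf => diffAt_of_smooth H.isOpen hx hf
  have sF := H.smooth_F
  have key : ∀ X Y : Coord m, covDir h Φ X (covDir h Φ Y η) x
      = (-t * dd X F x) • dmapDir Φ Y x + (-t * F x) • covDir h Φ X (dmapDir Φ Y) x
        + (((t + 1 / 2) * (dd X F x * dot (h (Φ x)) (dmapDir Φ Y x) (N x)
            + F x * dd X (fun y => dot (h (Φ y)) (dmapDir Φ Y y) (N y)) x)) • N x
          + ((t + 1 / 2) * (F x * dot (h (Φ x)) (dmapDir Φ Y x) (N x))) • covDir h Φ X N x) := by
    intro X Y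
    have s1 : ContDiffOn ℝ ∞ (fun y => -t * F y) U := contDiffOn_const.mul sF
    have s2 := sF.mul (H.smooth_angle Y)
    have s3 : ContDiffOn ℝ ∞ (fun y => (t + 1 / 2) *
      (F y * dot (h (Φ y)) (dmapDir Φ Y y) (N y))) U := contDiffOn_const.mul s2
    rw [H.covDir_congr hx (fun y hy => H.weingarten y hy Y),
      H.covDir_add hx (SmoothField.smul s1 H.smooth_dmapDir) (SmoothField.smul s3 H.smooth_N),
      H.covDir_smul hx s1 H.smooth_dmapDir, H.covDir_smul hx s3 H.smooth_N,
      dd_const_mul _ (hd sF), dd_const_mul _ (hd s2), dd_mul (hd sF) (hd (H.smooth_angle Y))]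
  have h1 := H.codazzi hx X Y
  rw [key X Y, key Y X, H.covDir_dmapDir_comm hx (X := X) (Y := Y), H.dd_F x hx, H.dd_F x hx] at h1
  rw [← sub_eq_zero] at h1
  rw [← h1]
  module

/-- The N-component of the Codazzi equation: its first bracket has no component along N, and ∇N ⟂ N,
so the exterior derivative of the one-form ⟨·, N⟩ vanishes. -/
theorem angle_closed (H : SimpleHypersurfaceOn c g h W Φ U F η t s N) (hx : x ∈ U)
    (X Y : Coord m) : dd X (fun y => dot (h (Φ y)) (dmapDir Φ Y y) (N y)) x
      = dd Y (fun y => dot (h (Φ y)) (dmapDir Φ X y) (N y)) x := by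
  have h1 := congrArg (fun v => dot (h (Φ x)) v (N x)) (H.codazzi_N hx X Y)
  simp only [dot_add_left, dot_sub_left, dot_smul_left, dot_zero_left, H.dot_covDir_N hx,
    H.unit_N x hx] at h1
  have hne : (t + 1 / 2) * F x ≠ 0 := by
    have := H.t_pos
    have := H.F_pos x hx
    positivity
  refine sub_eq_zero.1 (mul_left_cancel₀ hne ?_)
  linear_combination h1

/-- The integral curves of `N` are geodesics of the hypersurface. -/
theorem covDir_self_N (H : SimpleHypersurfaceOn c g h W Φ U F η t s N) (hx : x ∈ U)
    {u : Coord m} (hu : dmapDir Φ u x = N x) : covDir h Φ u N x = (- F x / 2) • η x := by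
  refine H.ext_dot hx ?_ fun i => ?_
  · rw [dot_smul_left, H.unit x hx, mul_one]
    have h1 := H.dd_dot hx H.smooth_N H.smooth_normal (X := u)
    rw [dd_eq_zero_of_const H.isOpen hx (c := 0)
      fun y hy => by rw [H.sym hy, H.dot_normal_N hy], H.weingarten x hx u, hu, dot_add_right,
      dot_smul_right, dot_smul_right, H.unit_N x hx] at h1
    linarith
  · rw [dot_smul_left, H.normal x hx, mul_zero]
    -- In the closedness relation for ∂ᵢ and u the terms ∇ᵢdΦ(u) and ∇ᵤTᵢ cancel, and ⟨∇ᵢN, N⟩ = 0.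
    -- This leaves ⟨Tᵢ, ∇ᵤN⟩ = 0.
    have h1 := H.angle_closed hx (EuclideanSpace.single i 1) u
    rw [H.dd_dot hx H.smooth_dmapDir H.smooth_N, H.dd_dot hx H.smooth_dmapDir H.smooth_N,
      H.covDir_dmapDir_comm hx (X := u), hu, H.sym hx (N x), H.dot_covDir_N hx,
      H.sym hx (dmapDir Φ _ x)] at h1
    rw [dmap_eq]
    linarith

/-- The covariant derivative of `N`. -/
theorem covDir_N (H : SimpleHypersurfaceOn c g h W Φ U F η t s N) (hx : x ∈ U) (X : Coord m) :
    covDir h Φ X N x = (-(t / (t + 1 / 2)) * (s x * (F x)⁻¹)) •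
        (dmapDir Φ X x - dot (h (Φ x)) (dmapDir Φ X x) (N x) • N x)
      + (- (1 / 2) * (F x * dot (h (Φ x)) (dmapDir Φ X x) (N x))) • η x := by
  obtain ⟨u, hu⟩ := H.tangent_N x hx
  -- With N as second vector the Codazzi equation is linear in ∇_X N with invertible coefficient (t
  -- + 1/2)F, and ∇ᵤN is already known.
  have h1 := H.codazzi_N hx X u
  rw [H.angle_closed hx X u, H.covDir_self_N hx hu, hu, H.unit_N x hx] at h1
  have ht := H.t_pos
  have hF := H.F_pos x hx
  have hr : t + 1 / 2 ≠ 0 := by positivity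
  have hne : (t + 1 / 2) * F x ≠ 0 := by positivity
  funext k
  have h2 := congrFun h1 k
  simp only [Pi.add_apply, Pi.sub_apply, Pi.smul_apply, smul_eq_mul, Pi.zero_apply] at h2 ⊢
  refine mul_left_cancel₀ hne ?_
  field_simp at h2 ⊢
  linear_combination h2

end SimpleHypersurfaceOn

end Coord

end

/-! ### The Gauss equation, the Laplacian of F, and the contradiction for a simple principal
curvature -/

noncomputable section

namespace Coord

variable {m n : ℕ}

namespace SimpleHypersurfaceOn

variable {c : ℝ} {g : Coord m → Matrix (Fin m) (Fin m) ℝ}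
  {h : Coord (m + 1) → Matrix (Fin (m + 1)) (Fin (m + 1)) ℝ} {W : Set (Coord (m + 1))}
  {Φ : Coord m → Coord (m + 1)} {U : Set (Coord m)} {F : Coord m → ℝ}
  {η : Coord m → Fin (m + 1) → ℝ} {x : Coord m} {t : ℝ} {s : Coord m → ℝ}
  {N : Coord m → Fin (m + 1) → ℝ}

theorem smooth_ratio (H : SimpleHypersurfaceOn c g h W Φ U F η t s N) :
    ContDiffOn ℝ ∞ (fun y => -(t / (t + 1 / 2)) * (s y * (F y)⁻¹)) U :=
  contDiffOn_const.mul (H.smooth_s.mul (H.smooth_F.inv fun y hy => (H.F_pos y hy).ne'))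

theorem covDir_covDir_N (H : SimpleHypersurfaceOn c g h W Φ U F η t s N) (hx : x ∈ U)
    (X Y : Coord m) : covDir h Φ X (covDir h Φ Y N) x
      = (dd X (fun y => -(t / (t + 1 / 2)) * (s y * (F y)⁻¹)) x) •
          (dmapDir Φ Y x - dot (h (Φ x)) (dmapDir Φ Y x) (N x) • N x)
        + (-(t / (t + 1 / 2)) * (s x * (F x)⁻¹)) • (covDir h Φ X (dmapDir Φ Y) x
          - (dd X (fun y => dot (h (Φ y)) (dmapDir Φ Y y) (N y)) x • N x
            + dot (h (Φ x)) (dmapDir Φ Y x) (N x) • covDir h Φ X N x))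
        + ((dd X (fun y => -(1 / 2) * (F y * dot (h (Φ y)) (dmapDir Φ Y y) (N y))) x) • η x
          + (- (1 / 2) * (F x * dot (h (Φ x)) (dmapDir Φ Y x) (N x))) • covDir h Φ X η x) := by
  have sA := H.smooth_angle Y
  have sAN := SmoothField.smul sA H.smooth_N
  have sT : SmoothField (dmapDir Φ Y) U := H.smooth_dmapDir
  have sC : ContDiffOn ℝ ∞
      (fun y => -(1 / 2) * (F y * dot (h (Φ y)) (dmapDir Φ Y y) (N y))) U :=
    contDiffOn_const.mul (H.smooth_F.mul sA)
  rw [H.covDir_congr hx (fun y hy => H.covDir_N hy Y),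
    H.covDir_add hx (SmoothField.smul H.smooth_ratio (sT.sub sAN))
      (SmoothField.smul sC H.smooth_normal),
    H.covDir_smul hx H.smooth_ratio (sT.sub sAN), H.covDir_smul hx sC H.smooth_normal,
    H.covDir_sub hx sT sAN, H.covDir_smul hx sA H.smooth_N]

/-- The Gauss equation for a plane containing `N`. -/
theorem gauss_N (H : SimpleHypersurfaceOn c g h W Φ U F η t s N) (hx : x ∈ U)
    {u v : Coord m} (hu : dmapDir Φ u x = N x)
    (hv : dot (h (Φ x)) (dmapDir Φ v x) (N x) = 0)
    (hvv : dot (h (Φ x)) (dmapDir Φ v x) (dmapDir Φ v x) ≠ 0) :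
    dd u (fun y => -(t / (t + 1 / 2)) * (s y * (F y)⁻¹)) x
      + (-(t / (t + 1 / 2)) * (s x * (F x)⁻¹)) ^ 2 - t / 2 * F x ^ 2 = - c := by
  -- R(N, v)N = -cv for v ⟂ N; the scalar product of the commutator with v isolates N(ρ) + ρ² -
  -- tF²/2, where ρ is the coefficient in ∇N.
  have h1 := H.covDir_covDir_sub hx H.smooth_N (X := u) (Y := v)
  rw [H.curvature _ (H.mapsTo x hx), H.covDir_covDir_N hx u v, H.covDir_covDir_N hx v u,
    H.covDir_dmapDir_comm hx (X := u) (Y := v)] at h1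
  have h2 := congrArg (fun w => dot (h (Φ x)) w (dmapDir Φ v x)) h1
  have hv' : dot (h (Φ x)) (N x) (dmapDir Φ v x) = 0 := by rw [H.sym hx, hv]
  simp only [hu, H.covDir_N hx v, H.weingarten x hx v, dot_add_left, dot_sub_left, dot_smul_left,
    hv, hv', H.unit_N x hx, H.normalDir hx v] at h2
  refine mul_right_cancel₀ hvv ?_
  linear_combination h2

/-- Raising the index of ⟨·, N⟩ returns the coordinates u of N, so traces against this one-form
become derivatives along u. -/
theorem sum_inv_mul_angle (H : SimpleHypersurfaceOn c g h W Φ U F η t s N) (hx : x ∈ U)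
    {u : Coord m} (hu : dmapDir Φ u x = N x) (i : Fin m) :
    ∑ j, (g x)⁻¹ i j * dot (h (Φ x)) (dmap Φ j x) (N x) = u i := by
  have h1 : ∀ j, dot (h (Φ x)) (dmap Φ j x) (N x) = ∑ k, g x j k * u k := by
    intro j
    rw [← hu, dmapDir_eq_sum, dot_sum_right]
    exact Finset.sum_congr rfl fun k _ => by
      rw [dot_smul_right, ← H.isometric x hx, mul_comm]
  have h2 : u i = ∑ k, ((g x)⁻¹ * g x) i k * u k := by
    rw [H.metricOn.inv_mul hx]; simp [Matrix.one_apply]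
  rw [h2]
  simp only [h1, Matrix.mul_apply, Finset.mul_sum, Finset.sum_mul]
  rw [Finset.sum_comm]
  exact Finset.sum_congr rfl fun _ _ => Finset.sum_congr rfl fun _ _ => by ring

/-- The Laplacian of `F`. -/
theorem laplacian_F (H : SimpleHypersurfaceOn c g h W Φ U F η t s N) (hx : x ∈ U)
    {u : Coord m} (hu : dmapDir Φ u x = N x) :
    ∑ i, ∑ j, (g x)⁻¹ i j * (pd i (pd j F) x - ∑ k, christoffel g k i j x * pd k F x)
      = dd u s x + (m - 1) * (s x * (-(t / (t + 1 / 2)) * (s x * (F x)⁻¹))) := by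
  set ρ := -(t / (t + 1 / 2)) * (s x * (F x)⁻¹) with hρ
  set θ : Fin m → ℝ := fun j => dot (h (Φ x)) (dmap Φ j x) (N x) with hθ
  have hB : ∀ i j, dot (h (Φ x)) (secondFundForm g h Φ i j x) (N x) = 0 := by
    intro i j
    rw [← hu, dmapDir_eq_sum, dot_sum_right]
    exact Finset.sum_eq_zero fun k _ => by
      rw [dot_smul_right, H.dot_secondFundForm_dmap hx, mul_zero]
  -- The Hessian comes from differentiating dF = sθ, with θ = ⟨·, N⟩ and ∇N known. Its trace is N(s)
  -- plus sρ times the dimension m - 1 of the complement of N.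
  have h1 : ∀ i j, pd i (pd j F) x - ∑ k, christoffel g k i j x * pd k F x
      = pd i s x * θ j + s x * ρ * (g x i j - θ i * θ j) := by
    intro i j
    have e1 : pd i (pd j F) x
        = pd i (fun y => s y * dot (h (Φ y)) (dmap Φ j y) (N y)) x :=
      dd_congr H.isOpen hx fun y hy => H.dd_F y hy _
    have e2 : covDir h Φ (EuclideanSpace.single i 1) (dmap Φ j) x
        = secondFundForm g h Φ i j x + ∑ k, christoffel g k i j x • dmap Φ k x := by
      rw [secondFundForm_eq, covAlong_eq]; abel
    have sA : ContDiffOn ℝ ∞ (fun y => dot (h (Φ y)) (dmap Φ j y) (N y)) U := H.smooth_angle _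
    rw [e1, pd_eq_dd, dd_mul (diffAt_of_smooth H.isOpen hx H.smooth_s)
      (diffAt_of_smooth H.isOpen hx sA),
      H.dd_dot hx (H.smooth_dmap j) H.smooth_N, e2, H.covDir_N hx, ← hρ, dot_add_left, hB,
      dot_add_right, dot_smul_right, dot_sub_right, dot_smul_right, dot_smul_right,
      H.sym hx _ (η x), H.normal x hx, dot_sum_left, ← dmap_eq, ← H.isometric x hx,
      (H.metricOn.isSymm hx).apply]
    have e3 : ∑ k, christoffel g k i j x * pd k F x
        = s x * ∑ k, dot (h (Φ x)) (christoffel g k i j x • dmap Φ k x) (N x) := by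
      rw [Finset.mul_sum]
      refine Finset.sum_congr rfl fun k _ => ?_
      rw [dot_smul_left, pd_eq_dd, H.dd_F x hx, ← dmap_eq]; ring
    rw [e3, pd_eq_dd]
    simp only [hθ]
    ring
  have h2 : ∀ p : Fin m → ℝ, ∑ i, ∑ j, (g x)⁻¹ i j * (p i * θ j) = ∑ i, u i * p i := by
    intro p
    refine Finset.sum_congr rfl fun i _ => ?_
    rw [← H.sum_inv_mul_angle hx hu i, Finset.sum_mul]
    exact Finset.sum_congr rfl fun j _ => by simp only [hθ]; ring
  have h3 : ∑ i, u i * θ i = 1 := by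
    have := H.unit_N x hx
    conv_lhs at this => enter [2]; rw [← hu]
    rw [dmapDir_eq_sum, dot_sum_left] at this
    simpa only [dot_smul_left] using this
  have h4 : ∀ i j, (g x)⁻¹ i j * (pd i s x * θ j + s x * ρ * (g x i j - θ i * θ j))
      = (g x)⁻¹ i j * (pd i s x * θ j) + s x * ρ * ((g x)⁻¹ i j * g x i j)
        - s x * ρ * ((g x)⁻¹ i j * (θ i * θ j)) := by intros; ring
  simp only [h1, h4, Finset.sum_add_distrib, Finset.sum_sub_distrib, ← Finset.mul_sum]
  rw [h2, h2, h3, H.trace_metric hx, ← dd_eq_sum]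
  ring

/-- A second direction is needed for the Gauss equation: for m ≥ 2 two coordinate vectors can be
combined so that their N-components cancel. -/
theorem exists_orthogonal (H : SimpleHypersurfaceOn c g h W Φ U F η t s N) (hx : x ∈ U)
    (hm : 2 ≤ m) : ∃ v, dot (h (Φ x)) (dmapDir Φ v x) (N x) = 0 ∧
      dot (h (Φ x)) (dmapDir Φ v x) (dmapDir Φ v x) ≠ 0 := by
  have hpos : ∀ v : Coord m, v ≠ 0 →
      dot (h (Φ x)) (dmapDir Φ v x) (dmapDir Φ v x) ≠ 0 := by
    intro v hv
    rw [H.dot_dmapDir_dmapDir hx]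
    exact (dot_self_pos v.ofLp (H.posDef x hx) (by simpa using hv)).ne'
  let i₀ : Fin m := ⟨0, by omega⟩
  let i₁ : Fin m := ⟨1, by omega⟩
  have hne : i₀ ≠ i₁ := by simp [i₀, i₁]
  set a := dot (h (Φ x)) (dmap Φ i₀ x) (N x) with ha
  set b := dot (h (Φ x)) (dmap Φ i₁ x) (N x) with hb
  by_cases h0 : a = 0
  · refine ⟨EuclideanSpace.single i₀ 1, h0, hpos _ ?_⟩
    simp
  · refine ⟨b • EuclideanSpace.single i₀ 1 + (-a) • EuclideanSpace.single i₁ 1, ?_, hpos _ ?_⟩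
    · have := dmapDir_sum Finset.univ Φ ![b, -a]
        ![EuclideanSpace.single i₀ 1, EuclideanSpace.single i₁ 1] x
      simp only [Fin.sum_univ_two, Matrix.cons_val_zero, Matrix.cons_val_one] at this
      rw [this, dot_add_left, dot_smul_left, dot_smul_left, ← dmap_eq, ← dmap_eq, ← ha, ← hb]
      ring
    · intro h1
      have h2 := congrArg (fun w : Coord m => w i₁) h1
      simp [hne.symm, h0] at h2

/-- A biharmonic hypersurface cannot have a simple principal curvature `-F/2` with principal
direction the gradient of `F`. -/
theorem false_of_biharmonic (H : SimpleHypersurfaceOn c g h W Φ U F η t s N) (hm : 2 ≤ m)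
    (ht : t = 3 / (2 * (m - 1))) (hx : x ∈ U) (hb : ∀ y ∈ U, bitension g h Φ y = 0)
    (hS : ∀ y ∈ U, ∑ i, ∑ j, (g y)⁻¹ i j *
        dot (h (Φ y)) (covAlong h Φ η i y) (covAlong h Φ η j y)
      = F y ^ 2 * (1 / 4 + (m - 1) * t ^ 2)) : False := by
  have hm2 : (2 : ℝ) ≤ m := by exact_mod_cast hm
  have hm1 : (m : ℝ) - 1 ≠ 0 := by linarith
  have hm3 : (m : ℝ) + 2 ≠ 0 := by linarith
  have ha : t / (t + 1 / 2) = 3 / (m + 2) := by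
    rw [ht]
    have : (3 : ℝ) / (2 * (m - 1)) + 1 / 2 = (m + 2) / (2 * (m - 1)) := by field_simp; ring
    rw [this]
    field_simp
  -- The coefficient in ∇N is ρ = as/F, and K below is |A|²/F².
  set a : ℝ := - (3 / (m + 2)) with hadef
  set K : ℝ := 1 / 4 + (m - 1) * t ^ 2 with hK
  have hd : ∀ {f : Coord m → ℝ}, ContDiffOn ℝ ∞ f U → ∀ y ∈ U, DifferentiableAt ℝ f y :=
    fun hf y hy => diffAt_of_smooth H.isOpen hy hf
  have sF := H.smooth_F
  have ss := H.smooth_s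
  have sI : ContDiffOn ℝ ∞ (fun y => (F y)⁻¹) U := sF.inv fun z hz => (H.F_pos z hz).ne'
  -- The normal biharmonic equation, multiplied by F.
  have e1 : ∀ y ∈ U, ∀ u, dmapDir Φ u y = N y →
      dd u s y * F y = (K * F y ^ 2 - m * c) * F y ^ 2 - (m - 1) * a * s y ^ 2 := by
    intro y hy u hu
    have h1 := H.biharmonic_normal hy (hb y hy)
    rw [H.laplacian_F hy hu, hS y hy, ha, ← hadef] at h1
    have hF := (H.F_pos y hy).ne'
    field_simp at h1
    linear_combination h1
  have e2 : ∀ y ∈ U, ∀ u, dmapDir Φ u y = N y → dd u F y = s y := by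
    intro y hy u hu
    rw [H.dd_F y hy, hu, H.unit_N y hy, mul_one]
  -- The Gauss equation multiplied by F², with N(s) eliminated by `e1`.
  have e3 : ∀ y ∈ U, ((m - 2) * a ^ 2 + a) * (s y * s y)
      = (a * K - t / 2) * (F y * F y * (F y * F y)) + c * (1 - a * m) * (F y * F y) := by
    intro y hy
    obtain ⟨u, hu⟩ := H.tangent_N y hy
    obtain ⟨v, hv, hvv⟩ := H.exists_orthogonal hy hm
    have h1 := H.gauss_N hy hu hv hvv
    have hF := (H.F_pos y hy).ne'
    have h2 : dd u (fun y => (F y)⁻¹) y = - s y * ((F y)⁻¹ * (F y)⁻¹) := by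
      have hone : dd u (fun z => F z * (F z)⁻¹) y = 0 :=
        dd_eq_zero_of_const H.isOpen hy fun z hz => mul_inv_cancel₀ (H.F_pos z hz).ne'
      rw [dd_mul (hd sF y hy) (hd sI y hy), e2 y hy u hu]
        at hone
      refine mul_left_cancel₀ hF ?_
      field_simp at hone ⊢
      linear_combination hone
    rw [ha, ← hadef, dd_const_mul _ (hd (ss.mul sI) y hy),
      dd_mul (hd ss y hy) (hd sI y hy), h2] at h1
    have h3 := e1 y hy u hu
    field_simp at h1
    linear_combination -h1 / 2 + a * h3
  -- Differentiate `e3` along N, cancel s, and eliminate N(s) and s² by `e1` and `e3`. There is no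
  -- division by (m - 2)a² + a, which vanishes for m = 4.
  have e4 : ∀ y ∈ U, (((m - 2) * a ^ 2 + a) * K - ((m - 1) * a + 2) * (a * K - t / 2))
        * (F y * F y)
      = ((m - 2) * a ^ 2 + a) * m * c + ((m - 1) * a + 1) * (c * (1 - a * m)) := by
    intro y hy
    obtain ⟨u, hu⟩ := H.tangent_N y hy
    have hF := (H.F_pos y hy).ne'
    have hs := (H.s_pos y hy).ne'
    have h1 := dd_congr (X := u) H.isOpen hy e3
    have sFF := sF.mul sF
    rw [dd_const_mul _ (hd (ss.mul ss) y hy), dd_mul (hd ss y hy) (hd ss y hy),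
      dd_add (hd (contDiffOn_const.mul (sFF.mul sFF)) y hy) (hd (contDiffOn_const.mul sFF) y hy),
      dd_const_mul _ (hd (sFF.mul sFF) y hy), dd_const_mul _ (hd sFF y hy),
      dd_mul (hd sFF y hy) (hd sFF y hy), dd_mul (hd sF y hy) (hd sF y hy), e2 y hy u hu] at h1
    have h2 : ((m - 2) * a ^ 2 + a) * dd u s y
        = 2 * (a * K - t / 2) * F y ^ 3 + c * (1 - a * m) * F y := by
      refine mul_left_cancel₀ hs ?_
      linear_combination h1 / 2
    have h3 := e1 y hy u hu
    have h4 := e3 y hy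
    refine mul_left_cancel₀ (pow_ne_zero 2 hF) ?_
    linear_combination F y * h2 - ((m - 2) * a ^ 2 + a) * h3 + (m - 1) * a * h4
  -- The coefficient of F² is nonzero, so `e4` makes F constant although its derivative along N is s
  -- > 0.
  have hC : ((m - 2) * a ^ 2 + a) * K - ((m - 1) * a + 2) * (a * K - t / 2) ≠ 0 := by
    have : ((m - 2) * a ^ 2 + a) * K - ((m - 1) * a + 2) * (a * K - t / 2)
        = 9 * (2 * m + 1) / (2 * (m - 1) * (m + 2) ^ 2) := by
      rw [hK, hadef, ht]
      field_simp
      ring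
    rw [this]
    have : (0 : ℝ) < m - 1 := by linarith
    positivity
  obtain ⟨u, hu⟩ := H.tangent_N x hx
  have h1 := dd_congr (X := u) H.isOpen hx e4
  rw [dd_const, dd_const_mul _ (hd (sF.mul sF) x hx), dd_mul (hd sF x hx) (hd sF x hx),
    e2 x hx u hu] at h1
  have h2 := (mul_eq_zero.1 h1).resolve_left hC
  have := mul_pos (H.s_pos x hx) (H.F_pos x hx)
  linarith

end SimpleHypersurfaceOn

end Coord

end

noncomputable section

namespace Coord

variable {m n : ℕ}

/-! ### The mean curvature is locally constant in coordinates -/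

/-- The sum of the squares of the principal curvatures is determined by the multiplicity. -/
theorem multiplicity_injective {d e : ℕ} (hd : d < m) (he : e < m)
    (h : (d : ℝ) / 4 + (m - d) * secondRatio m d ^ 2
      = (e : ℝ) / 4 + (m - e) * secondRatio m e ^ 2) : d = e := by
  have key : ∀ {d e : ℕ}, e < m → d < e →
      (d : ℝ) / 4 + (m - d) * secondRatio m d ^ 2 < (e : ℝ) / 4 + (m - e) * secondRatio m e ^ 2 := by
    intro d e he hde
    have h1 : (0 : ℝ) < m - e := by rw [sub_pos]; exact_mod_cast he
    have h2 : (d : ℝ) < e := by exact_mod_cast hde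
    have h3 : (0 : ℝ) < m - d := by linarith
    have e1 : ∀ r : ℝ, 0 < m - r → (m - r) * ((1 + r / 2) / (m - r)) ^ 2
        = (1 + r / 2) ^ 2 / (m - r) := by
      intro r hr; field_simp
    have h0 : (0 : ℝ) ≤ d := by positivity
    rw [secondRatio, secondRatio, e1 _ h1, e1 _ h3]
    -- As d grows the numerator increases and the positive denominator decreases; the term d/4 makes
    -- the comparison strict.
    have : (1 + (d : ℝ) / 2) ^ 2 / (m - d) ≤ (1 + (e : ℝ) / 2) ^ 2 / (m - e) := by
      gcongr
    linarith
  rcases lt_trichotomy d e with h1 | h1 | h1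
  · exact absurd h (key he h1).ne
  · exact h1
  · exact absurd h (key hd h1).ne'

variable {c : ℝ} {g : Coord m → Matrix (Fin m) (Fin m) ℝ}
  {h : Coord (m + 1) → Matrix (Fin (m + 1)) (Fin (m + 1)) ℝ} {W : Set (Coord (m + 1))}
  {Φ : Coord m → Coord (m + 1)} {U : Set (Coord m)} {F : Coord m → ℝ}
  {η : Coord m → Fin (m + 1) → ℝ} {x : Coord m}

/-- The multiplicity of the principal curvature `-F/2` is locally constant. -/
theorem HypersurfaceOn.exists_constant_multiplicity (H : HypersurfaceOn c g h W Φ U F η)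
    (hx : x ∈ U) (hF : ∀ y ∈ U, 0 < F y) (d : Coord m → ℕ) (hd : ∀ y ∈ U, d y < m)
    (hS : ∀ y ∈ U, ∑ i, ∑ j, (g y)⁻¹ i j *
        dot (h (Φ y)) (covAlong h Φ η i y) (covAlong h Φ η j y)
      = F y ^ 2 * (d y / 4 + (m - d y) * secondRatio m (d y) ^ 2)) :
    ∃ U' ⊆ U, IsOpen U' ∧ x ∈ U' ∧ ∀ y ∈ U', d y = d x := by
  set ψ : ℕ → ℝ := fun k => (k : ℝ) / 4 + (m - k) * secondRatio m k ^ 2 with hψ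
  set σ : Coord m → ℝ := fun y => (∑ i, ∑ j, (g y)⁻¹ i j *
        dot (h (Φ y)) (covAlong h Φ η i y) (covAlong h Φ η j y)) * (F y ^ 2)⁻¹ with hσ
  have hσψ : ∀ y ∈ U, σ y = ψ (d y) := by
    intro y hy
    have := (hF y hy).ne'
    simp only [hσ, hψ, hS y hy]
    field_simp
  have hcont : ContinuousOn σ U := by
    refine ContinuousOn.mul (ContDiffOn.continuousOn (𝕜 := ℝ) (n := ∞) ?_) (ContinuousOn.inv₀
      (H.smooth_F.continuousOn.pow 2) fun y hy => pow_ne_zero 2 (hF y hy).ne')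
    exact ContDiffOn.sum fun i _ => ContDiffOn.sum fun j _ => (H.metricOn.smooth_inv i j).mul
      (H.smooth_dot (H.smooth_covAlong i) (H.smooth_covAlong j))
  -- The values of |A|²/F² for the other possible multiplicities. They are finitely many, so
  -- continuity keeps σ away from them near x.
  set B : Set ℝ := (ψ '' Set.Iio m) \ {ψ (d x)} with hB
  have hBc : IsOpen Bᶜ := (((Set.finite_Iio m).image ψ).subset Set.sdiff_subset).isClosed.isOpen_compl
  refine ⟨U ∩ σ ⁻¹' Bᶜ, Set.inter_subset_left, hcont.isOpen_inter_preimage H.isOpen hBc,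
    ⟨hx, ?_⟩, ?_⟩
  · rw [Set.mem_preimage, hσψ x hx]
    exact fun h1 => h1.2 rfl
  · rintro y ⟨hy, hyB⟩
    rw [Set.mem_preimage, hσψ y hy] at hyB
    have h1 : ψ (d y) = ψ (d x) := by
      by_contra hne
      exact hyB ⟨⟨d y, hd y hy, rfl⟩, hne⟩
    exact multiplicity_injective (hd y hy) (hd x hx) h1

/-- On a biharmonic hypersurface with at most two principal curvatures, `F > 0` has a critical
point in every open set. -/
theorem HypersurfaceOn.false_of_gradVec_ne_zero (H : HypersurfaceOn c g h W Φ U F η)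
    (hx : x ∈ U) (hb : ∀ y ∈ U, bitension g h Φ y = 0)
    (hk : ∀ y ∈ U, {k : ℝ | IsPrincipalCurvature g h Φ y (η y) k}.encard ≤ 2)
    (hF : ∀ y ∈ U, 0 < F y) (hgr : ∀ y ∈ U, gradVec g F y ≠ 0) : False := by
  have hst := fun y (hy : y ∈ U) =>
    H.weingarten_structure hy (hb y hy) (hk y hy) (hF y hy) (hgr y hy)
  classical
  choose! d hd1 hdm hS hq hmul hone using hst
  obtain ⟨V, hVU, hVo, hxV, hVd⟩ := H.exists_constant_multiplicity hx hF d hdm hS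
  have HV := H.restrictTo hVU hVo
  have hm : 2 ≤ m := by have := hd1 x hx; have := hdm x hx; omega
  have hgpos : ∀ y ∈ U, 0 < dot (h (Φ y)) (dmapDir Φ (gradVec g F y) y)
      (dmapDir Φ (gradVec g F y) y) := by
    intro y hy
    rw [H.dot_dmapDir_dmapDir hy]
    exact dot_self_pos (gradVec g F y).ofLp (H.posDef y hy) (by simpa using hgr y hy)
  -- Multiplicity one leads to the structure with N = grad F/|grad F|; higher multiplicity is
  -- excluded at the single point x by the Codazzi argument.
  rcases (hd1 x hx).eq_or_lt with h1 | h1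
  · have hd : ∀ y ∈ V, d y = 1 := fun y hy => (hVd y hy).trans h1.symm
    set Gr : Coord m → Fin (m + 1) → ℝ := fun y => dmapDir Φ (gradVec g F y) y with hGr
    have sGr : SmoothField Gr V := by
      have : Gr = fun y => ∑ i, (∑ j, (g y)⁻¹ i j * pd j F y) • dmap Φ i y := by
        funext y
        simp only [hGr, dmapDir_eq_sum]
        rfl
      rw [this]
      exact SmoothField.sum fun i _ => SmoothField.smul (ContDiffOn.sum fun j _ =>
        (HV.metricOn.smooth_inv i j).mul (smooth_dd HV.isOpen HV.smooth_F)) (HV.smooth_dmap i)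
    set s : Coord m → ℝ := fun y => √(dot (h (Φ y)) (Gr y) (Gr y)) with hs
    have hspos : ∀ y ∈ V, 0 < s y := fun y hy => Real.sqrt_pos.2 (hgpos y (hVU hy))
    have hss : ∀ y ∈ V, s y * s y = dot (h (Φ y)) (Gr y) (Gr y) := fun y hy =>
      Real.mul_self_sqrt (hgpos y (hVU hy)).le
    have ssm : ContDiffOn ℝ ∞ s V :=
      (HV.smooth_dot sGr sGr).sqrt fun y hy => (hgpos y (hVU hy)).ne'
    have ht : secondRatio m 1 = 3 / (2 * (m - 1)) := by
      have : (m : ℝ) - 1 ≠ 0 := by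
        have : (2 : ℝ) ≤ m := by exact_mod_cast hm
        linarith
      rw [secondRatio]; push_cast; field_simp; norm_num
    have S : SimpleHypersurfaceOn c g h W Φ V F η (secondRatio m 1) s fun y => (s y)⁻¹ • Gr y :=
      { HV with
        t_pos := by
          have : (2 : ℝ) ≤ m := by exact_mod_cast hm
          have : (0 : ℝ) < m - 1 := by linarith
          rw [ht]; positivity
        F_pos := fun y hy => hF y (hVU hy)
        s_pos := hspos
        smooth_s := ssm
        smooth_N := SmoothField.smul (ssm.inv fun y hy => (hspos y hy).ne') sGr
        unit_N := fun y hy => by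
          have := (hspos y hy).ne'
          rw [dot_smul_left, dot_smul_right, ← hss y hy]
          field_simp
        tangent_N := fun y hy => ⟨(s y)⁻¹ • gradVec g F y, by
          have := dmapDir_sum Finset.univ Φ ![(s y)⁻¹] ![gradVec g F y] y
          simpa using this⟩
        dd_F := fun y hy X => by
          have := (hspos y hy).ne'
          rw [dot_smul_right, H.dot_dmapDir_gradVec (hVU hy)]
          field_simp
        weingarten := fun y hy X => by
          have := (hspos y hy).ne'
          have h2 := hone y (hVU hy) (hd y hy) X
          rw [hd y hy] at h2
          rw [h2, ← hss y hy, dot_smul_right, smul_smul]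
          congr 2
          · ring
          · simp only [hGr]; field_simp }
    refine S.false_of_biharmonic hm ht hxV (fun y hy => hb y (hVU hy)) fun y hy => ?_
    rw [hS y (hVU hy), hd y hy]
    push_cast; ring
  · obtain ⟨v, hv, hvv, hvu⟩ := hmul x hx h1
    refine HV.false_of_multiple (t := secondRatio m (d x)) (u := gradVec g F x) (v := v) (x := x)
      (fun y hy X Y => ?_) hxV ?_ (hF x hx) (H.covDir_gradVec hx (hb x hx)) hv hvv hvu ?_
    · rw [← hVd y hy]; exact hq y (hVU hy) X Y
    · have : (d x : ℝ) < m := by exact_mod_cast hdm x hx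
      have : (0 : ℝ) < m - d x := by linarith
      rw [secondRatio]; positivity
    · rw [← H.dot_dmapDir_gradVec hx]; exact ne_of_gt (hgpos x hx)

/-- The length of the tension field of a biharmonic hypersurface with at most two principal
curvatures is locally constant. -/
theorem IsometricOn.dd_tension_sq (H : IsometricOn g h W Φ U)
    (hc : ∀ y ∈ W, ∀ X Y Z : Fin (m + 1) → ℝ,
      riemannVec h y X Y Z = c • (dot (h y) Y Z • X - dot (h y) X Z • Y))
    (hb : ∀ y ∈ U, bitension g h Φ y = 0)
    (hk : ∀ y ∈ U, ∀ η, IsUnitNormal h Φ y η →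
      {k : ℝ | IsPrincipalCurvature g h Φ y η k}.encard ≤ 2) (hx : x ∈ U) (X : Coord m) :
    dd X (fun y => dot (h (Φ y)) (tension g h Φ y) (tension g h Φ y)) x = 0 := by
  set τ := tension g h Φ with hτ
  set q : Coord m → ℝ := fun y => dot (h (Φ y)) (τ y) (τ y) with hq
  have sq : ContDiffOn ℝ ∞ q U := H.smooth_dot H.smooth_tension H.smooth_tension
  have hq0 : ∀ y ∈ U, 0 ≤ q y := fun y hy =>
    dot_self_nonneg _ (H.metric.posDef _ (H.mapsTo y hy))
  by_contra hne
  have hqx : q x ≠ 0 := by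
    intro h0
    refine hne ?_
    -- A zero of |τ|² is a minimum, so its derivative vanishes there.
    have hmin : IsLocalMin q x := by
      filter_upwards [H.isOpen.mem_nhds hx] with y hy
      rw [h0]; exact hq0 y hy
    rw [dd, hmin.fderiv_eq_zero]; rfl
  -- On this open set both τ and the derivative of |τ|² in the direction X are nonzero, so η = τ/|τ|
  -- is defined and F = |τ| has no critical point.
  set V : Set (Coord m) := U ∩ (fun y => q y * dd X q y) ⁻¹' {0}ᶜ with hV
  have hVo : IsOpen V :=
    (sq.continuousOn.mul (smooth_dd H.isOpen sq).continuousOn).isOpen_inter_preimage H.isOpen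
      isOpen_compl_singleton
  have hVU : V ⊆ U := Set.inter_subset_left
  have hxV : x ∈ V := ⟨hx, mul_ne_zero hqx hne⟩
  have hVq : ∀ y ∈ V, 0 < q y := fun y hy =>
    lt_of_le_of_ne (hq0 y hy.1) fun h0 => hy.2 (by simp [← h0])
  have hVd : ∀ y ∈ V, dd X q y ≠ 0 := fun y hy h0 => hy.2 (by simp [h0])
  have HV := H.restrict hVU hVo
  set F : Coord m → ℝ := fun y => √(q y) with hF
  have hFpos : ∀ y ∈ V, 0 < F y := fun y hy => Real.sqrt_pos.2 (hVq y hy)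
  have hFF : ∀ y ∈ V, q y = F y * F y := fun y hy => (Real.mul_self_sqrt (hVq y hy).le).symm
  have sF : ContDiffOn ℝ ∞ F V := (sq.mono hVU).sqrt fun y hy => (hVq y hy).ne'
  have Hyp : HypersurfaceOn c g h W Φ V F fun y => (F y)⁻¹ • τ y :=
    { HV with
      curvature := hc
      smooth_F := sF
      smooth_normal := SmoothField.smul (sF.inv fun y hy => (hFpos y hy).ne') HV.smooth_tension
      unit := fun y hy => by
        have := (hFpos y hy).ne'
        rw [dot_smul_left, dot_smul_right, show dot _ (τ y) (τ y) = _ from hFF y hy]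
        field_simp
      normal := fun y hy i => by rw [dot_smul_left, HV.dot_tension_dmap hy, mul_zero]
      tension_eq := fun y hy => by rw [smul_inv_smul₀ (hFpos y hy).ne'] }
  refine Hyp.false_of_gradVec_ne_zero hxV (fun y hy => hb y (hVU hy))
    (fun y hy => hk y (hVU hy) _ (Hyp.isUnitNormal hy)) hFpos fun y hy h0 => hVd y hy ?_
  have h1 := Hyp.dot_dmapDir_gradVec hy X
  rw [h0, dmapDir_eq_sum Φ 0] at h1
  simp only [PiLp.zero_apply, zero_smul, Finset.sum_const_zero, dot_zero_right] at h1
  have hdF := diffAt_of_smooth hVo hy sF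
  rw [dd_congr hVo hy hFF, dd_mul hdF hdF, ← h1]
  ring

end Coord

end

noncomputable section

namespace Coord

variable {m n p : ℕ}

/-! ### Invariance of the tension field under changes of coordinates -/

/-- The image of the field `V` along `Φ` under the differential of `Ψ`. -/
def pushField (Ψ : Coord n → Coord p) (Φ : Coord m → Coord n) (V : Coord m → Fin n → ℝ)
    (x : Coord m) : Fin p → ℝ :=
  ∑ a, V x a • dmap Ψ a (Φ x)

section Chain

variable {g : Coord m → Matrix (Fin m) (Fin m) ℝ} {h : Coord n → Matrix (Fin n) (Fin n) ℝ}
  {k : Coord p → Matrix (Fin p) (Fin p) ℝ} {W : Set (Coord n)} {Z : Set (Coord p)}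
  {Φ : Coord m → Coord n} {Ψ : Coord n → Coord p} {U : Set (Coord m)} {x : Coord m}

theorem MapOn.comp (HΨ : MapOn k Z Ψ W) (HΦ : MapOn h W Φ U) :
    MapOn k Z (fun y => Ψ (Φ y)) U where
  metric := HΨ.metric
  isOpen := HΦ.isOpen
  smooth a := HΦ.smooth_comp (HΨ.smooth a)
  mapsTo x hx := HΨ.mapsTo _ (HΦ.mapsTo x hx)

theorem dmapDir_comp (HΨ : MapOn k Z Ψ W) (HΦ : MapOn h W Φ U) (hx : x ∈ U) (X : Coord m) :
    dmapDir (fun y => Ψ (Φ y)) X x = pushField Ψ Φ (dmapDir Φ X) x := by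
  funext a
  rw [dmapDir, dd_comp (f := fun z => Ψ z a)
    (fun b => diffAt_of_smooth HΦ.isOpen hx (HΦ.smooth b))
    (diffAt_of_smooth HΨ.isOpen (HΦ.mapsTo x hx) (HΨ.smooth a))]
  simp only [pushField, Finset.sum_apply, Pi.smul_apply, smul_eq_mul, dmap]
  exact Finset.sum_congr rfl fun b _ => mul_comm _ _

/-- For a field pulled back from the intermediate space, the chain rule makes the covariant
derivative depend on Φ only through dΦ(X). -/
theorem covDir_comp (HΨ : MapOn k Z Ψ W) (HΦ : MapOn h W Φ U) (hx : x ∈ U) (X : Coord m)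
    {Y : Coord n → Fin p → ℝ} (hY : SmoothField Y W) :
    covDir k (fun y => Ψ (Φ y)) X (fun y => Y (Φ y)) x
      = ∑ b, dmapDir Φ X x b • covAlong k Ψ Y b (Φ x) := by
  have hΦx := HΦ.mapsTo x hx
  have h1 : ∑ b, dmapDir Φ X x b • covAlong k Ψ Y b (Φ x)
      = covDir k Ψ (WithLp.toLp 2 (dmapDir Φ X x)) Y (Φ x) :=
    (covDir_eq_sum k Ψ (WithLp.toLp 2 (dmapDir Φ X x)) Y (Φ x)).symm
  rw [h1]
  funext a
  simp only [covDir]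
  congr 1
  · rw [dd_comp (f := fun z => Y z a) (fun b => diffAt_of_smooth HΦ.isOpen hx (HΦ.smooth b))
      (diffAt_of_smooth HΨ.isOpen hΦx (hY a)), dd_eq_sum]
    exact Finset.sum_congr rfl fun b _ => mul_comm _ _
  · refine Finset.sum_congr rfl fun c _ => ?_
    congr 1
    refine Finset.sum_congr rfl fun b _ => ?_
    rw [dmapDir_comp HΨ HΦ hx, dmapDir_eq_sum, pushField]

/-- The chain rule for covariant derivatives. -/
theorem covDir_pushField (HΨ : MapOn k Z Ψ W) (HΦ : MapOn h W Φ U) (hx : x ∈ U)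
    (X : Coord m) {V : Coord m → Fin n → ℝ} (hV : SmoothField V U) :
    covDir k (fun y => Ψ (Φ y)) X (pushField Ψ Φ V) x
      = pushField Ψ Φ (covDir h Φ X V) x
        + ∑ a, ∑ b, (V x a * dmapDir Φ X x b) • secondFundForm h k Ψ b a (Φ x) := by
  have HC := HΨ.comp HΦ
  have sY : ∀ a, SmoothField (dmap Ψ a) W := fun a => HΨ.smooth_dmapDir
  have sYΦ : ∀ a, SmoothField (fun y => dmap Ψ a (Φ y)) U := fun a b => HΦ.smooth_comp (sY a b)
  have h1 : covDir k (fun y => Ψ (Φ y)) X (pushField Ψ Φ V) x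
      = ∑ a, covDir k (fun y => Ψ (Φ y)) X (fun y => V y a • dmap Ψ a (Φ y)) x :=
    HC.covDir_sum hx fun a _ => SmoothField.smul (hV a) (sYΦ a)
  have h2 : ∀ a, covDir k (fun y => Ψ (Φ y)) X (fun y => V y a • dmap Ψ a (Φ y)) x
      = dd X (fun y => V y a) x • dmap Ψ a (Φ x)
        + (∑ b, ∑ c, (V x a * dmapDir Φ X x b * christoffel h c b a (Φ x)) • dmap Ψ c (Φ x)
        + ∑ b, (V x a * dmapDir Φ X x b) • secondFundForm h k Ψ b a (Φ x)) := by
    intro a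
    rw [HC.covDir_smul hx (hV a) (sYΦ a), covDir_comp HΨ HΦ hx X (sY a), Finset.smul_sum,
      ← Finset.sum_add_distrib]
    congr 1
    refine Finset.sum_congr rfl fun b _ => ?_
    rw [secondFundForm_eq, smul_smul, smul_sub, Finset.smul_sum]
    simp only [smul_smul]
    abel
  have h3 : pushField Ψ Φ (covDir h Φ X V) x = ∑ a, dd X (fun y => V y a) x • dmap Ψ a (Φ x)
      + ∑ a, ∑ b, ∑ c, (V x a * dmapDir Φ X x b * christoffel h c b a (Φ x)) •
        dmap Ψ c (Φ x) := by
    simp only [pushField, covDir, conn, add_smul, Finset.sum_add_distrib, Finset.sum_smul,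
      Finset.sum_mul]
    congr 1
    rw [Finset.sum_comm]
    refine Finset.sum_congr rfl fun a _ => ?_
    rw [Finset.sum_comm]
    refine Finset.sum_congr rfl fun b _ => Finset.sum_congr rfl fun c _ => ?_
    congr 1; ring
  rw [h1, h3]
  simp only [h2, Finset.sum_add_distrib]
  abel

theorem pushField_sum {ι : Type*} (s : Finset ι) (r : ι → ℝ) (V : ι → Fin n → ℝ) :
    pushField Ψ Φ (fun _ => ∑ i ∈ s, r i • V i) x
      = ∑ i ∈ s, r i • pushField Ψ Φ (fun _ => V i) x := by
  simp only [pushField, Finset.sum_apply, Pi.smul_apply, smul_eq_mul, Finset.sum_smul,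
    Finset.smul_sum, smul_smul]
  rw [Finset.sum_comm]

/-- The chain rule `covDir_pushField` applied to dΦ(∂ⱼ). The tangential correction by the
Christoffel symbols of g passes through dΨ by linearity. -/
theorem secondFundForm_comp (HΨ : MapOn k Z Ψ W) (HΦ : MapOn h W Φ U) (hx : x ∈ U)
    (i j : Fin m) : secondFundForm g k (fun y => Ψ (Φ y)) i j x
      = pushField Ψ Φ (secondFundForm g h Φ i j) x
        + ∑ a, ∑ b, (dmap Φ j x a * dmap Φ i x b) • secondFundForm h k Ψ b a (Φ x) := by
  have HC := HΨ.comp HΦ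
  have h1 : covAlong k (fun y => Ψ (Φ y)) (dmap (fun y => Ψ (Φ y)) j) i x
      = covDir k (fun y => Ψ (Φ y)) (EuclideanSpace.single i 1)
        (pushField Ψ Φ (dmap Φ j)) x := by
    rw [covAlong_eq]
    exact HC.covDir_congr hx fun y hy => dmapDir_comp HΨ HΦ hy _
  have h2 : ∀ l, dmap (fun y => Ψ (Φ y)) l x = pushField Ψ Φ (fun _ => dmap Φ l x) x :=
    fun l => dmapDir_comp HΨ HΦ hx _
  rw [secondFundForm_eq, h1, covDir_pushField HΨ HΦ hx _ (V := dmap Φ j) HΦ.smooth_dmapDir,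
    ← covAlong_eq]
  simp only [h2]
  rw [← pushField_sum]
  have h3 : pushField Ψ Φ (covAlong h Φ (dmap Φ j) i) x
      = pushField Ψ Φ (secondFundForm g h Φ i j) x
        + pushField Ψ Φ (fun _ => ∑ l, christoffel g l i j x • dmap Φ l x) x := by
    simp only [pushField, ← Finset.sum_add_distrib, ← add_smul]
    refine Finset.sum_congr rfl fun a _ => ?_
    rw [secondFundForm_eq]; simp
  rw [h3]
  change _ + _ + ∑ a, ∑ b, (dmap Φ j x a * dmap Φ i x b) • _ - _ = _
  abel

end Chain

section EqualDimension

variable {g : Coord n → Matrix (Fin n) (Fin n) ℝ} {h : Coord n → Matrix (Fin n) (Fin n) ℝ}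
  {W : Set (Coord n)} {ψ : Coord n → Coord n} {U : Set (Coord n)} {x : Coord n}

/-- The Jacobian matrix of `ψ`. -/
def jacobian (ψ : Coord n → Coord n) (x : Coord n) : Matrix (Fin n) (Fin n) ℝ :=
  Matrix.of fun a i => dmap ψ i x a

theorem IsometricOn.metric_eq_jacobian (H : IsometricOn g h W ψ U) (hx : x ∈ U) :
    g x = (jacobian ψ x).transpose * h (ψ x) * jacobian ψ x := by
  ext i j
  rw [H.isometric x hx, Matrix.mul_apply, dot, Finset.sum_comm]
  refine Finset.sum_congr rfl fun b _ => ?_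
  rw [Matrix.mul_apply, Finset.sum_mul]
  refine Finset.sum_congr rfl fun a _ => ?_
  simp only [jacobian, Matrix.transpose_apply, Matrix.of_apply]; ring

theorem IsometricOn.det_jacobian_ne_zero (H : IsometricOn g h W ψ U) (hx : x ∈ U) :
    (jacobian ψ x).det ≠ 0 := by
  have h1 := (H.posDef x hx).det_pos.ne'
  rw [H.metric_eq_jacobian hx, Matrix.det_mul] at h1
  exact right_ne_zero_of_mul h1

/-- Isometric changes of coordinates are totally geodesic. -/
theorem IsometricOn.secondFundForm_eq_zero (H : IsometricOn g h W ψ U) (hx : x ∈ U)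
    (i j : Fin n) : secondFundForm g h ψ i j x = 0 := by
  -- The second fundamental form is normal, while in equal dimension the dψ(∂ₗ) span the whole
  -- space. Invertibility of hJ expresses that no nonzero normal vector exists.
  have hdet : (h (ψ x) * jacobian ψ x).det ≠ 0 := by
    rw [Matrix.det_mul]
    exact mul_ne_zero (H.metric.posDef _ (H.mapsTo x hx)).det_pos.ne' (H.det_jacobian_ne_zero hx)
  refine Matrix.eq_zero_of_vecMul_eq_zero hdet (funext fun l => ?_)
  have h1 := H.dot_secondFundForm_dmap hx i j l
  rw [dot, Finset.sum_congr rfl fun a _ => show _ = secondFundForm g h ψ i j x a *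
    (h (ψ x) * jacobian ψ x) a l by
      rw [Matrix.mul_apply, Finset.mul_sum]
      exact Finset.sum_congr rfl fun b _ => by simp only [jacobian, Matrix.of_apply]; ring] at h1
  exact h1

/-- Inversion of g = JᵀhJ. It carries traces over to the new coordinates. -/
theorem IsometricOn.jacobian_inv (H : IsometricOn g h W ψ U) (hx : x ∈ U) :
    jacobian ψ x * (g x)⁻¹ * (jacobian ψ x).transpose = (h (ψ x))⁻¹ := by
  have hJ : IsUnit (jacobian ψ x).det := (H.det_jacobian_ne_zero hx).isUnit
  have hJT : IsUnit (jacobian ψ x).transpose.det := by rwa [Matrix.det_transpose]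
  rw [H.metric_eq_jacobian hx, Matrix.mul_inv_rev, Matrix.mul_inv_rev, Matrix.mul_assoc,
    Matrix.mul_assoc, Matrix.mul_assoc, Matrix.nonsing_inv_mul _ hJT, Matrix.mul_one,
    ← Matrix.mul_assoc, Matrix.mul_nonsing_inv _ hJ, Matrix.one_mul]

theorem IsometricOn.dot_pushField (H : IsometricOn g h W ψ U) (hx : x ∈ U) (u v : Fin n → ℝ) :
    dot (h (ψ x)) (∑ a, u a • dmap ψ a x) (∑ a, v a • dmap ψ a x) = dot (g x) u v := by
  rw [dot_sum_left, dot]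
  refine Finset.sum_congr rfl fun a _ => ?_
  rw [dot_sum_right]
  refine Finset.sum_congr rfl fun b _ => ?_
  rw [dot_smul_left, dot_smul_right, ← H.isometric x hx]; ring

end EqualDimension

theorem tension_congr {g : Coord m → Matrix (Fin m) (Fin m) ℝ}
    {h : Coord n → Matrix (Fin n) (Fin n) ℝ} {W : Set (Coord n)} {Φ Φ' : Coord m → Coord n}
    {U : Set (Coord m)} {x : Coord m} (H : MapOn h W Φ U) (hx : x ∈ U)
    (hΦ : ∀ y ∈ U, Φ y = Φ' y) : tension g h Φ x = tension g h Φ' x := by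
  have h1 : ∀ y ∈ U, ∀ X, dmapDir Φ X y = dmapDir Φ' X y := fun y hy X =>
    funext fun a => dd_congr H.isOpen hy fun z hz => by rw [hΦ z hz]
  have h2 : ∀ j, dmap Φ j x = dmap Φ' j x := fun j => h1 x hx _
  have h3 : ∀ i j, covAlong h Φ (dmap Φ j) i x = covAlong h Φ' (dmap Φ' j) i x := by
    intro i j
    rw [covAlong_eq, covAlong_eq, H.covDir_congr hx (V₁ := dmap Φ j) (V₂ := dmap Φ' j)
      fun y hy => h1 y hy _]
    funext a
    simp only [covDir, conn, h1 x hx, hΦ x hx]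
  simp only [tension_eq_sum, secondFundForm_eq, h2, h3]

theorem sum_reverse_four {E : Type*} [AddCommMonoid E] (f : Fin m → Fin m → Fin m → Fin m → E) :
    ∑ i, ∑ j, ∑ a, ∑ b, f i j a b = ∑ b, ∑ a, ∑ j, ∑ i, f i j a b := by
  have h1 : ∀ i, ∑ j, ∑ a, ∑ b, f i j a b = ∑ b, ∑ a, ∑ j, f i j a b := by
    intro i
    rw [Finset.sum_comm, Finset.sum_congr rfl fun a _ => Finset.sum_comm, Finset.sum_comm]
  rw [Finset.sum_congr rfl fun i _ => h1 i, Finset.sum_comm]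
  refine Finset.sum_congr rfl fun b _ => ?_
  rw [Finset.sum_comm]
  exact Finset.sum_congr rfl fun a _ => Finset.sum_comm

/-- The length of the tension field does not depend on the coordinates. -/
theorem dot_tension_eq {g₁ g₂ : Coord m → Matrix (Fin m) (Fin m) ℝ}
    {h₁ h₂ : Coord n → Matrix (Fin n) (Fin n) ℝ} {U₁ U₂ : Set (Coord m)} {W₁ W₂ : Set (Coord n)}
    {Φ₁ Φ₂ : Coord m → Coord n} {ψ : Coord m → Coord m} {χ : Coord n → Coord n} {x : Coord m}
    (Hψ : IsometricOn g₁ g₂ U₂ ψ U₁) (Hχ : IsometricOn h₁ h₂ W₂ χ W₁)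
    (H₁ : MapOn h₁ W₁ Φ₁ U₁) (H₂ : MapOn h₂ W₂ Φ₂ U₂)
    (hcomm : ∀ y ∈ U₁, Φ₂ (ψ y) = χ (Φ₁ y)) (hx : x ∈ U₁) :
    dot (h₂ (Φ₂ (ψ x))) (tension g₂ h₂ Φ₂ (ψ x)) (tension g₂ h₂ Φ₂ (ψ x))
      = dot (h₁ (Φ₁ x)) (tension g₁ h₁ Φ₁ x) (tension g₁ h₁ Φ₁ x) := by
  -- Change of coordinates in the source: ψ is totally geodesic, so only ∇dΦ₂ evaluated on dψ
  -- remains, and the trace is transported by `jacobian_inv`.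
  have e1 : tension g₁ h₂ (fun y => Φ₂ (ψ y)) x = tension g₂ h₂ Φ₂ (ψ x) := by
    have hB : ∀ i j, secondFundForm g₁ h₂ (fun y => Φ₂ (ψ y)) i j x
        = ∑ a, ∑ b, (jacobian ψ x b i * jacobian ψ x a j) •
          secondFundForm g₂ h₂ Φ₂ b a (ψ x) := by
      intro i j
      rw [secondFundForm_comp (g := g₁) (h := g₂) H₂ Hψ.toMapOn hx]
      simp only [pushField, Hψ.secondFundForm_eq_zero hx, Pi.zero_apply, zero_smul,
        Finset.sum_const_zero, zero_add]
      exact Finset.sum_congr rfl fun a _ => Finset.sum_congr rfl fun b _ => by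
        rw [mul_comm]; rfl
    rw [tension_eq_sum, tension_eq_sum, ← Hψ.jacobian_inv hx]
    simp only [hB, Finset.smul_sum, smul_smul, Matrix.mul_apply, Matrix.transpose_apply,
      Finset.sum_mul, Finset.sum_smul]
    rw [sum_reverse_four]
    exact Finset.sum_congr rfl fun b _ => Finset.sum_congr rfl fun a _ =>
      Finset.sum_congr rfl fun j _ => Finset.sum_congr rfl fun i _ => by
        congr 1; ring
  -- Change of coordinates in the target: χ is totally geodesic, so the tension field is pushed
  -- forward by dχ.
  have e2 : tension g₁ h₂ (fun y => χ (Φ₁ y)) x = ∑ a, tension g₁ h₁ Φ₁ x a • dmap χ a (Φ₁ x) := by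
    have hB : ∀ i j, secondFundForm g₁ h₂ (fun y => χ (Φ₁ y)) i j x
        = pushField χ Φ₁ (fun _ => secondFundForm g₁ h₁ Φ₁ i j x) x := by
      intro i j
      rw [secondFundForm_comp (g := g₁) Hχ.toMapOn H₁ hx]
      simp only [Hχ.secondFundForm_eq_zero (H₁.mapsTo x hx), smul_zero, Finset.sum_const_zero,
        add_zero]
      rfl
    rw [tension_eq_sum]
    simp only [hB, ← pushField_sum]
    have := pushField_sum (Ψ := χ) (Φ := Φ₁) (x := x) Finset.univ (fun _ : Fin m => (1 : ℝ))
      fun i => ∑ j, (g₁ x)⁻¹ i j • secondFundForm g₁ h₁ Φ₁ i j x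
    simp only [one_smul] at this
    rw [← this, ← tension_eq_sum]
    rfl
  rw [← e1, tension_congr (H₂.comp Hψ.toMapOn) hx hcomm, e2, hcomm x hx,
    Hχ.dot_pushField (H₁.mapsTo x hx)]

end Coord

end

/-! ### The components of a smooth metric in a chart -/

noncomputable section

open Coord Bundle

section Charts

variable {m n : ℕ}
  {M : Type*} [TopologicalSpace M] [ChartedSpace (Coord m) M] [IsManifold 𝓘(ℝ, Coord m) ∞ M]
  {N : Type*} [TopologicalSpace N] [ChartedSpace (Coord n) N] [IsManifold 𝓘(ℝ, Coord n) ∞ N]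

/-- The scalar product of tangent vectors at `p`, as a function on the model space. -/
def SmoothMetric.ip (h : SmoothMetric n N) (p : N) (u v : Coord n) : ℝ := h.inner p u v

/-- The differential of the inverse of a chart, as a map of the model space. -/
def chartFrame (e : OpenPartialHomeomorph N (Coord n)) (x : Coord n) : Coord n →L[ℝ] Coord n :=
  mfderiv 𝓘(ℝ, Coord n) 𝓘(ℝ, Coord n) e.symm x

theorem SmoothMetric.ip_sum_sum (h : SmoothMetric n N) (p : N) (r t : Fin n → ℝ)
    (L : Coord n →L[ℝ] Coord n) :
    h.ip p (L (WithLp.toLp 2 r)) (L (WithLp.toLp 2 t))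
      = ∑ i, ∑ j, h.ip p (L (EuclideanSpace.single i 1)) (L (EuclideanSpace.single j 1))
        * r i * t j := by
  rw [coord_eq_sum (WithLp.toLp 2 r), coord_eq_sum (WithLp.toLp 2 t), map_sum, map_sum]
  let B : Coord n →L[ℝ] Coord n →L[ℝ] ℝ := h.inner p
  change B _ _ = _
  rw [map_sum B, sum_apply]
  refine Finset.sum_congr rfl fun i _ => ?_
  rw [map_sum]
  refine Finset.sum_congr rfl fun j _ => ?_
  change _ = B _ _ * _ * _
  rw [map_smul L, map_smul L, map_smul B, map_smul, smul_apply, smul_eq_mul, smul_eq_mul]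
  ring

theorem SmoothMetric.dot_inChart (h : SmoothMetric n N) (e : OpenPartialHomeomorph N (Coord n))
    (x : Coord n) (r t : Fin n → ℝ) : dot (h.inChart e x) r t
      = h.ip (e.symm x) (chartFrame e x (WithLp.toLp 2 r)) (chartFrame e x (WithLp.toLp 2 t)) := by
  rw [h.ip_sum_sum]
  rfl

omit [IsManifold 𝓘(ℝ, Coord n) ∞ N] in
theorem chartFrame_injective {e : OpenPartialHomeomorph N (Coord n)} (he : IsSmoothChart e)
    {x : Coord n} (hx : x ∈ e.target) : Function.Injective (chartFrame e x) := by
  have hd : e.MDifferentiable 𝓘(ℝ, Coord n) 𝓘(ℝ, Coord n) :=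
    ⟨(contMDiffOn_of_mem_maximalAtlas he).mdifferentiableOn (by simp),
      (contMDiffOn_symm_of_mem_maximalAtlas he).mdifferentiableOn (by simp)⟩
  exact hd.symm.mfderiv_injective hx

/-- The coordinate fields are images of constant fields under the tangent map of `e.symm`, hence
smooth along it; contracting the smooth metric section with two of them is smooth. -/
theorem SmoothMetric.smooth_inChart (h : SmoothMetric n N)
    {e : OpenPartialHomeomorph N (Coord n)} (he : IsSmoothChart e) (i j : Fin n) :
    ContDiffOn ℝ ∞ (fun x => h.inChart e x i j) e.target := by
  have hsymm : ContMDiffOn 𝓘(ℝ, Coord n) 𝓘(ℝ, Coord n) ∞ e.symm e.target :=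
    contMDiffOn_symm_of_mem_maximalAtlas he
  have hvec : ∀ v : Coord n, ContMDiffOn 𝓘(ℝ, Coord n) (𝓘(ℝ, Coord n).prod 𝓘(ℝ, Coord n)) ∞
      (fun x => TotalSpace.mk' (Coord n) (E := fun p : N => TangentSpace 𝓘(ℝ, Coord n) p)
        (e.symm x) (mfderiv 𝓘(ℝ, Coord n) 𝓘(ℝ, Coord n) e.symm x v)) e.target := by
    intro v
    have h1 := hsymm.contMDiffOn_tangentMapWithin (m := ∞) (by simp)
      e.open_target.uniqueMDiffOn
    have h2 : ContMDiff 𝓘(ℝ, Coord n) 𝓘(ℝ, Coord n).tangent ∞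
        (fun x : Coord n => (⟨x, v⟩ : TangentBundle 𝓘(ℝ, Coord n) (Coord n))) :=
      contMDiff_vectorSpace_iff_contDiff.2 contDiff_const
    have h3 := h1.comp (h2.contMDiffOn (s := e.target)) (fun x hx => hx)
    refine h3.congr fun x hx => ?_
    simp only [Function.comp, tangentMapWithin,
      mfderivWithin_of_isOpen e.open_target hx]
  have hmet : ContMDiffOn 𝓘(ℝ, Coord n) (𝓘(ℝ, Coord n).prod
      𝓘(ℝ, Coord n →L[ℝ] Coord n →L[ℝ] ℝ)) ∞
      (fun x => TotalSpace.mk' (Coord n →L[ℝ] Coord n →L[ℝ] ℝ)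
        (E := fun p : N => (TangentSpace 𝓘(ℝ, Coord n) p →L[ℝ]
          TangentSpace 𝓘(ℝ, Coord n) p →L[ℝ] Bundle.Trivial N ℝ p))
        (e.symm x) (h.inner (e.symm x))) e.target :=
    h.contMDiff.comp_contMDiffOn hsymm
  have h4 : ContMDiffOn 𝓘(ℝ, Coord n) (𝓘(ℝ, Coord n).prod 𝓘(ℝ)) ∞
      (fun x => TotalSpace.mk' ℝ (E := Bundle.Trivial N ℝ) (e.symm x) (h.inner (e.symm x)
        (mfderiv 𝓘(ℝ, Coord n) 𝓘(ℝ, Coord n) e.symm x (EuclideanSpace.single i (1 : ℝ)))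
        (mfderiv 𝓘(ℝ, Coord n) 𝓘(ℝ, Coord n) e.symm x (EuclideanSpace.single j (1 : ℝ)))))
      e.target := by
    apply ContMDiffOn.clm_bundle_apply₂ (F₁ := Coord n) (F₂ := Coord n)
    · exact hmet
    · exact hvec _
    · exact hvec _
  rw [← contMDiffOn_iff_contDiffOn]
  intro x hx
  exact ((contMDiffWithinAt_totalSpace).1 (h4 x hx)).2

theorem SmoothMetric.metricOn (h : SmoothMetric n N) {e : OpenPartialHomeomorph N (Coord n)}
    (he : IsSmoothChart e) : MetricOn (h.inChart e) e.target where
  isOpen := e.open_target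
  smooth := h.smooth_inChart he
  posDef x hx := by
    refine Matrix.PosDef.of_dotProduct_mulVec_pos ?_ fun v hv => ?_
    · ext i j
      exact h.symm _ _ _
    · have h1 : 0 < dot (h.inChart e x) v v := by
        rw [h.dot_inChart]
        refine h.pos _ _ fun h0 => hv ?_
        have := chartFrame_injective he hx (h0.trans (map_zero (chartFrame e x)).symm)
        simpa using this
      rw [dot_eq_dotProduct] at h1
      simpa using h1

end Charts

end

/-! ### Isometric immersions in charts and independence of the charts -/

noncomputable section

open Coord Bundle

section Charts

variable {m n : ℕ}
  {M : Type*} [TopologicalSpace M] [ChartedSpace (Coord m) M] [IsManifold 𝓘(ℝ, Coord m) ∞ M]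
  {N : Type*} [TopologicalSpace N] [ChartedSpace (Coord n) N] [IsManifold 𝓘(ℝ, Coord n) ∞ N]
  {g : SmoothMetric m M} {h : SmoothMetric n N} {φ : M → N}
  {e : OpenPartialHomeomorph M (Coord m)} {e' : OpenPartialHomeomorph N (Coord n)}
  {U : Set (Coord m)} {W : Set (Coord n)}

omit [IsManifold 𝓘(ℝ, Coord m) ∞ M] [IsManifold 𝓘(ℝ, Coord n) ∞ N] in
theorem contDiffOn_mapInCharts (hφ : ContMDiff 𝓘(ℝ, Coord m) 𝓘(ℝ, Coord n) ∞ φ)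
    (he : IsSmoothChart e) (he' : IsSmoothChart e') (hU : U ⊆ e.target)
    (hUφ : ∀ x ∈ U, φ (e.symm x) ∈ e'.source) :
    ContDiffOn ℝ ∞ (mapInCharts φ e e') U := by
  rw [← contMDiffOn_iff_contDiffOn]
  have h1 : ContMDiffOn 𝓘(ℝ, Coord m) 𝓘(ℝ, Coord m) ∞ e.symm U :=
    (contMDiffOn_symm_of_mem_maximalAtlas he).mono hU
  exact (contMDiffOn_of_mem_maximalAtlas he').comp (hφ.comp_contMDiffOn h1) hUφ

omit [ChartedSpace (Coord m) M] [IsManifold 𝓘(ℝ, Coord m) ∞ M] in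
theorem isOpen_preimage_chart (hφ : Continuous φ) {A : Set M} (hA : IsOpen A) {B : Set N}
    (hB : IsOpen B) : IsOpen (e.target ∩ e.symm ⁻¹' (A ∩ φ ⁻¹' B)) :=
  e.isOpen_inter_preimage_symm (hA.inter (hB.preimage hφ))

omit [IsManifold 𝓘(ℝ, Coord m) ∞ M] [IsManifold 𝓘(ℝ, Coord n) ∞ N] in
-- The chain rule applied to the two factorizations of φ ∘ `e.symm` near x, directly and through the
-- chart of N.
theorem chartFrame_mapInCharts (hφ : ContMDiff 𝓘(ℝ, Coord m) 𝓘(ℝ, Coord n) ∞ φ)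
    (he : IsSmoothChart e) (he' : IsSmoothChart e') (hU : IsOpen U) (hUe : U ⊆ e.target)
    (hUφ : ∀ x ∈ U, φ (e.symm x) ∈ e'.source) {x : Coord m} (hx : x ∈ U) (v : Coord m) :
    chartFrame e' (mapInCharts φ e e' x) (fderiv ℝ (mapInCharts φ e e') x v)
      = mfderiv 𝓘(ℝ, Coord m) 𝓘(ℝ, Coord n) φ (e.symm x) (chartFrame e x v) := by
  have hΦ : HasMFDerivAt 𝓘(ℝ, Coord m) 𝓘(ℝ, Coord n) (mapInCharts φ e e') x
      (fderiv ℝ (mapInCharts φ e e') x) :=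
    ((((contDiffOn_mapInCharts hφ he he' hUe hUφ).contDiffAt (hU.mem_nhds hx)).differentiableAt
      (by simp)).hasFDerivAt).hasMFDerivAt
  have hy : mapInCharts φ e e' x ∈ e'.target := e'.map_source (hUφ x hx)
  have h1 : HasMFDerivAt 𝓘(ℝ, Coord n) 𝓘(ℝ, Coord n) e'.symm (mapInCharts φ e e' x)
      (mfderiv 𝓘(ℝ, Coord n) 𝓘(ℝ, Coord n) e'.symm (mapInCharts φ e e' x)) :=
    (((contMDiffOn_symm_of_mem_maximalAtlas he').contMDiffAt
      (e'.open_target.mem_nhds hy)).mdifferentiableAt (by simp)).hasMFDerivAt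
  have h2 : HasMFDerivAt 𝓘(ℝ, Coord m) 𝓘(ℝ, Coord m) e.symm x
      (mfderiv 𝓘(ℝ, Coord m) 𝓘(ℝ, Coord m) e.symm x) :=
    (((contMDiffOn_symm_of_mem_maximalAtlas he).contMDiffAt
      (e.open_target.mem_nhds (hUe hx))).mdifferentiableAt (by simp)).hasMFDerivAt
  have h3 : HasMFDerivAt 𝓘(ℝ, Coord m) 𝓘(ℝ, Coord n) φ (e.symm x)
      (mfderiv 𝓘(ℝ, Coord m) 𝓘(ℝ, Coord n) φ (e.symm x)) :=
    (hφ.mdifferentiableAt (by simp)).hasMFDerivAt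
  have hev : (e'.symm ∘ mapInCharts φ e e') =ᶠ[nhds x] φ ∘ e.symm := by
    filter_upwards [hU.mem_nhds hx] with y hy
    exact e'.left_inv (hUφ y hy)
  have h4 := hasMFDerivAt_unique ((h3.comp x h2).congr_of_eventuallyEq hev) (h1.comp x hΦ)
  exact (DFunLike.congr_fun h4 v).symm

theorem toLp_dmap {Φ : Coord m → Coord n} {x : Coord m} (hΦ : DifferentiableAt ℝ Φ x)
    (i : Fin m) : WithLp.toLp 2 (dmap Φ i x) = fderiv ℝ Φ x (EuclideanSpace.single i 1) := by
  ext a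
  have h1 := ((EuclideanSpace.proj (𝕜 := ℝ) a : Coord n →L[ℝ] ℝ).hasFDerivAt.comp x
    hΦ.hasFDerivAt).fderiv
  change fderiv ℝ ((EuclideanSpace.proj (𝕜 := ℝ) a : Coord n →L[ℝ] ℝ) ∘ Φ) x _ = _
  rw [h1]
  rfl

theorem IsIsometricImmersion.isometricOn (hφ : IsIsometricImmersion g h φ)
    (he : IsSmoothChart e) (he' : IsSmoothChart e') (hU : IsOpen U) (hUe : U ⊆ e.target)
    (hW : IsOpen W) (hWe : W ⊆ e'.target) (hUφ : ∀ x ∈ U, φ (e.symm x) ∈ e'.source)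
    (hUW : ∀ x ∈ U, mapInCharts φ e e' x ∈ W) :
    IsometricOn (g.inChart e) (h.inChart e') W (mapInCharts φ e e') U where
  metric := ⟨hW, fun i j => (h.smooth_inChart he' i j).mono hWe,
    fun y hy => (h.metricOn he').posDef y (hWe hy)⟩
  isOpen := hU
  smooth a := (contDiffOn_euclidean (𝕜 := ℝ)).1 (contDiffOn_mapInCharts hφ.1 he he' hUe hUφ) a
  mapsTo := hUW
  posDef x hx := (g.metricOn he).posDef x (hUe hx)
  isometric x hx i j := by
    have hd : DifferentiableAt ℝ (mapInCharts φ e e') x :=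
      ((contDiffOn_mapInCharts hφ.1 he he' hUe hUφ).contDiffAt
        (hU.mem_nhds hx)).differentiableAt (by simp)
    rw [h.dot_inChart, toLp_dmap hd, toLp_dmap hd,
      chartFrame_mapInCharts hφ.1 he he' hU hUe hUφ hx,
      chartFrame_mapInCharts hφ.1 he he' hU hUe hUφ hx, mapInCharts, e'.left_inv (hUφ x hx)]
    exact (hφ.2 _ _ _).symm

/-- Read in two different charts, the identity is a change of coordinates; in this way `isometricOn`
also covers transition maps. -/
theorem isIsometricImmersion_id (g : SmoothMetric m M) : IsIsometricImmersion g g id := by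
  refine ⟨contMDiff_id, fun p u v => ?_⟩
  rw [mfderiv_id]
  rfl

/-- The squared length of the tension field at `p`, computed in given charts. -/
def tensionSq (g : SmoothMetric m M) (h : SmoothMetric n N) (φ : M → N)
    (e : OpenPartialHomeomorph M (Coord m)) (e' : OpenPartialHomeomorph N (Coord n)) (p : M) : ℝ :=
  dot (h.inChart e' (mapInCharts φ e e' (e p)))
    (tension (g.inChart e) (h.inChart e') (mapInCharts φ e e') (e p))
    (tension (g.inChart e) (h.inChart e') (mapInCharts φ e e') (e p))

theorem IsIsometricImmersion.tensionSq_eq (hφ : IsIsometricImmersion g h φ)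
    {e₁ e₂ : OpenPartialHomeomorph M (Coord m)} {e₁' e₂' : OpenPartialHomeomorph N (Coord n)}
    (he₁ : IsSmoothChart e₁) (he₂ : IsSmoothChart e₂) (he₁' : IsSmoothChart e₁')
    (he₂' : IsSmoothChart e₂') {p : M} (hp₁ : p ∈ e₁.source) (hp₂ : p ∈ e₂.source)
    (hp₁' : φ p ∈ e₁'.source) (hp₂' : φ p ∈ e₂'.source) :
    tensionSq g h φ e₂ e₂' p = tensionSq g h φ e₁ e₁' p := by
  have hcont := hφ.1.continuous
  -- The coordinates of the points at which all four charts are available, so that both ways around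
  -- the square of transition maps are defined.
  set U₁ : Set (Coord m) :=
    e₁.target ∩ e₁.symm ⁻¹' (e₂.source ∩ φ ⁻¹' (e₁'.source ∩ e₂'.source)) with hU₁
  set U₂ : Set (Coord m) := e₂.target ∩ e₂.symm ⁻¹' (Set.univ ∩ φ ⁻¹' e₂'.source) with hU₂
  set W₁ : Set (Coord n) := e₁'.target ∩ e₁'.symm ⁻¹' e₂'.source with hW₁
  have oU₁ : IsOpen U₁ :=
    isOpen_preimage_chart hcont e₂.open_source (e₁'.open_source.inter e₂'.open_source)
  have oU₂ : IsOpen U₂ := isOpen_preimage_chart hcont isOpen_univ e₂'.open_source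
  have oW₁ : IsOpen W₁ := e₁'.isOpen_inter_preimage_symm e₂'.open_source
  have Hψ : IsometricOn (g.inChart e₁) (g.inChart e₂) U₂ (mapInCharts id e₁ e₂) U₁ :=
    (isIsometricImmersion_id g).isometricOn he₁ he₂ oU₁ Set.inter_subset_left oU₂
      Set.inter_subset_left (fun x hx => hx.2.1) fun x hx => by
        refine ⟨e₂.map_source hx.2.1, trivial, ?_⟩
        change φ (e₂.symm (e₂ (e₁.symm x))) ∈ e₂'.source
        rw [e₂.left_inv hx.2.1]
        exact hx.2.2.2
  have Hχ : IsometricOn (h.inChart e₁') (h.inChart e₂') e₂'.target (mapInCharts id e₁' e₂') W₁ :=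
    (isIsometricImmersion_id h).isometricOn he₁' he₂' oW₁ Set.inter_subset_left e₂'.open_target
      subset_rfl (fun x hx => hx.2) fun x hx => e₂'.map_source hx.2
  have H₁ : IsometricOn (g.inChart e₁) (h.inChart e₁') W₁ (mapInCharts φ e₁ e₁') U₁ :=
    hφ.isometricOn he₁ he₁' oU₁ Set.inter_subset_left oW₁ Set.inter_subset_left
      (fun x hx => hx.2.2.1) fun x hx => by
        refine ⟨e₁'.map_source hx.2.2.1, ?_⟩
        change e₁'.symm (e₁' (φ (e₁.symm x))) ∈ e₂'.source
        rw [e₁'.left_inv hx.2.2.1]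
        exact hx.2.2.2
  have H₂ : IsometricOn (g.inChart e₂) (h.inChart e₂') e₂'.target (mapInCharts φ e₂ e₂') U₂ :=
    hφ.isometricOn he₂ he₂' oU₂ Set.inter_subset_left e₂'.open_target subset_rfl
      (fun x hx => hx.2.2) fun x hx => e₂'.map_source hx.2.2
  have hx : e₁ p ∈ U₁ := by
    refine ⟨e₁.map_source hp₁, ?_⟩
    rw [Set.mem_preimage, e₁.left_inv hp₁]
    exact ⟨hp₂, hp₁', hp₂'⟩
  have key := dot_tension_eq Hψ Hχ H₁.toMapOn H₂.toMapOn (fun y hy => by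
    simp only [mapInCharts, id]
    rw [e₂.left_inv hy.2.1, e₁'.left_inv hy.2.2.1]) hx
  have hψ : mapInCharts id e₁ e₂ (e₁ p) = e₂ p := by
    simp only [mapInCharts, id]
    rw [e₁.left_inv hp₁]
  rwa [hψ] at key

theorem meanCurvature_eq_sqrt (g : Coord m → Matrix (Fin m) (Fin m) ℝ)
    (h : Coord n → Matrix (Fin n) (Fin n) ℝ) (Φ : Coord m → Coord n) (x : Coord m) :
    meanCurvature g h Φ x
      = √((1 / (m : ℝ)) ^ 2 * dot (h (Φ x)) (tension g h Φ x) (tension g h Φ x)) := by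
  simp only [meanCurvature, dot, Finset.mul_sum]
  congr 1
  refine Finset.sum_congr rfl fun i _ => Finset.sum_congr rfl fun j _ => ?_
  simp only [tension, ← Finset.mul_sum]
  ring

end Charts

/-! ### Local constancy on the manifold -/

section Hypersurface

variable {m : ℕ} {c : ℝ}
  {M : Type*} [TopologicalSpace M] [ChartedSpace (Coord m) M] [IsManifold 𝓘(ℝ, Coord m) ∞ M]
  {N : Type*} [TopologicalSpace N] [ChartedSpace (Coord (m + 1)) N]
  [IsManifold 𝓘(ℝ, Coord (m + 1)) ∞ N]
  {g : SmoothMetric m M} {h : SmoothMetric (m + 1) N} {φ : M → N}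

theorem tensionSq_eventually_eq (hc : HasConstSectionalCurvature h c)
    (hφ : IsIsometricImmersion g h φ) (hk : HasAtMostTwoPrincipalCurvatures g h φ)
    (hb : IsBiharmonicMap g h φ) {e : OpenPartialHomeomorph M (Coord m)}
    {e' : OpenPartialHomeomorph N (Coord (m + 1))} (he : IsSmoothChart e)
    (he' : IsSmoothChart e') {p : M} (hp : p ∈ e.source) (hp' : φ p ∈ e'.source) :
    ∀ᶠ q in nhds p, tensionSq g h φ e e' q = tensionSq g h φ e e' p := by
  set U : Set (Coord m) := e.target ∩ e.symm ⁻¹' (Set.univ ∩ φ ⁻¹' e'.source) with hU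
  have oU : IsOpen U := isOpen_preimage_chart hφ.1.continuous isOpen_univ e'.open_source
  have H : IsometricOn (g.inChart e) (h.inChart e') e'.target (mapInCharts φ e e') U :=
    hφ.isometricOn he he' oU Set.inter_subset_left e'.open_target subset_rfl
      (fun x hx => hx.2.2) fun x hx => e'.map_source hx.2.2
  have hpU : e p ∈ U := by
    refine ⟨e.map_source hp, trivial, ?_⟩
    rw [Set.mem_preimage, e.left_inv hp]
    exact hp'
  -- A ball is connected, so vanishing of the derivative gives constancy on it.
  obtain ⟨ε, hε, hball⟩ := Metric.isOpen_iff.1 oU _ hpU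
  have hdd : ∀ x ∈ U, ∀ X, dd X (fun y => dot (h.inChart e' (mapInCharts φ e e' y))
      (tension (g.inChart e) (h.inChart e') (mapInCharts φ e e') y)
      (tension (g.inChart e) (h.inChart e') (mapInCharts φ e e') y)) x = 0 := fun x hx X =>
    H.dd_tension_sq (fun y hy X Y Z => (h.metricOn he').riemannVec_of_const hy (hc e' he' y hy) X Y Z)
      (fun y hy => hb e e' he he' y hy.1 hy.2.2) (fun y hy => hk e e' he he' y hy.1 hy.2.2) hx X
  have hsm : ContDiffOn ℝ ∞ (fun y => dot (h.inChart e' (mapInCharts φ e e' y))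
      (tension (g.inChart e) (h.inChart e') (mapInCharts φ e e') y)
      (tension (g.inChart e) (h.inChart e') (mapInCharts φ e e') y)) U :=
    H.smooth_dot H.smooth_tension H.smooth_tension
  have hconst : ∀ x ∈ Metric.ball (e p) ε, (fun y => dot (h.inChart e' (mapInCharts φ e e' y))
      (tension (g.inChart e) (h.inChart e') (mapInCharts φ e e') y)
      (tension (g.inChart e) (h.inChart e') (mapInCharts φ e e') y)) x
      = tensionSq g h φ e e' p := fun x hx =>
    Metric.isOpen_ball.is_const_of_fderiv_eq_zero (𝕜 := ℝ)
      (convex_ball _ _).isPreconnected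
      ((hsm.mono hball).differentiableOn (by simp))
      (fun y hy => ContinuousLinearMap.ext fun X => hdd y (hball hy) X) hx
      (Metric.mem_ball_self hε)
  have hcont := e.continuousAt hp
  filter_upwards [hcont (Metric.ball_mem_nhds _ hε)] with q hq
  exact hconst _ hq

theorem meanCurvatureAt_eq_sqrt (g : SmoothMetric m M) (h : SmoothMetric (m + 1) N) (φ : M → N)
    (p : M) : meanCurvatureAt g h φ p = √((1 / (m : ℝ)) ^ 2
      * tensionSq g h φ (chartAt (Coord m) p) (chartAt (Coord (m + 1)) (φ p)) p) :=
  meanCurvature_eq_sqrt _ _ _ _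

/-- The preferred charts vary with the point. Near p the value at q is therefore first rewritten in
the charts of p by `tensionSq_eq`, where |τ|² is locally constant. -/
theorem isLocallyConstant_meanCurvatureAt (hc : HasConstSectionalCurvature h c)
    (hφ : IsIsometricImmersion g h φ) (hk : HasAtMostTwoPrincipalCurvatures g h φ)
    (hb : IsBiharmonicMap g h φ) : IsLocallyConstant (meanCurvatureAt g h φ) := by
  rw [IsLocallyConstant.iff_eventually_eq]
  intro p
  have hchart : ∀ q : M, IsSmoothChart (chartAt (Coord m) q) := fun q =>
    IsManifold.chart_mem_maximalAtlas q
  have hchart' : ∀ q : N, IsSmoothChart (chartAt (Coord (m + 1)) q) := fun q =>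
    IsManifold.chart_mem_maximalAtlas q
  have hsrc := (chartAt (Coord m) p).open_source.mem_nhds (mem_chart_source (Coord m) p)
  have hsrc' := hφ.1.continuous.continuousAt.preimage_mem_nhds
    ((chartAt (Coord (m + 1)) (φ p)).open_source.mem_nhds (mem_chart_source (Coord (m + 1)) (φ p)))
  filter_upwards [tensionSq_eventually_eq hc hφ hk hb (hchart p) (hchart' (φ p))
    (mem_chart_source _ p) (mem_chart_source _ (φ p)), hsrc, hsrc'] with q hq h1 h2
  rw [meanCurvatureAt_eq_sqrt, meanCurvatureAt_eq_sqrt, ← hq,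
    hφ.tensionSq_eq (hchart p) (hchart q) (hchart' (φ p)) (hchart' (φ q)) h1
      (mem_chart_source _ q) h2 (mem_chart_source _ (φ q))]

end Hypersurface

end

theorem mainTheorem2 {m : ℕ} (c : ℝ)
    {M : Type*} [TopologicalSpace M] [ChartedSpace (Coord m) M]
    [IsManifold 𝓘(ℝ, Coord m) ∞ M] [ConnectedSpace M]
    {N : Type*} [TopologicalSpace N] [ChartedSpace (Coord (m + 1)) N]
    [IsManifold 𝓘(ℝ, Coord (m + 1)) ∞ N]
    (g : SmoothMetric m M) (h : SmoothMetric (m + 1) N)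
    (hc : HasConstSectionalCurvature h c)
    (φ : M → N) (hφ : IsIsometricImmersion g h φ)
    (hk : HasAtMostTwoPrincipalCurvatures g h φ)
    (hb : IsProperBiharmonicMap g h φ) :
    ∃ κ : ℝ, ∀ p : M, meanCurvatureAt g h φ p = κ := by
  obtain ⟨p₀⟩ : Nonempty M := inferInstance
  exact ⟨meanCurvatureAt g h φ p₀, fun p =>
    (isLocallyConstant_meanCurvatureAt hc hφ hk hb.1).apply_eq_of_preconnectedSpace p p₀⟩
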